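/- **Setting.** A type $\sigma$ of size $k$ is a tournament on the label set $\{1,\dots,k\}$; a $\sigma$-flag is a finite tournament together with an embedding of $\sigma$ into it, considered up to label-preserving isomorphism. Let $\mathcal F^\sigma$ be the set of $\sigma$-flags and $\mathcal F^\sigma_N$ the set of those with $N$ vertices. For $F,G\in\mathcal F^\sigma$ with $|F|\le|G|$, $p(F;G)$ is the probability that a uniformly random set of $|F|$ vertices of $G$ containing all labelled vertices induces $F$; for $|F_1|+|F_2|-k\le |G|$, $p(F_1,F_2;G)$ is the probability that a uniformly random pair of vertex sets of sizes $|F_1|,|F_2|$ that intersect exactly in the set of labelled vertices induces $F_1$ and $F_2$ respectively. The flag algebra $\mathcal A^\sigma$ is the space of formal real linear combinations of $\sigma$-flags modulo the relations $F=\sum_{G\in\mathcal F^\sigma_N}p(F;G)\,G$ $(N\ge |F|)$, with the product $F_1F_2=\sum_{G\in\mathcal F^\sigma_N}p(F_1,F_2;G)\,G$ $(N\ge|F_1|+|F_2|-k)$; its unit $\mathbb 1_\sigma$ is the flag $\sigma$ with all vertices labelled. $\mathrm{Hom}^+(\mathcal A^\sigma,\mathbb R)$ is the set of algebra homomorphisms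 $\mathcal A^\sigma\to\mathbb R$ that are nonnegative on all flags, with the topology of pointwise convergence on flags. Write $0$ for the empty type. For $F\in\mathcal F^\sigma$ let $[\![F]\!]_\sigma=q_\sigma(F)\,F|_0\in\mathcal A^0$, where $F|_0$ is $F$ with its labels removed and $q_\sigma(F)$ is the probability that a uniformly random injection of the labels into the vertices of $F|_0$ yields a $\sigma$-flag isomorphic to $F$. Let $A$ be the type of size $2$ in which label $1$ beats label $2$, and let $\vec C_3^A$ be the $A$-flag on the directed $3$-cycle with vertices $1,2,w$ and arcs $1\to2$, $2\to w$, $w\to1$. For $\phi\in\mathrm{Hom}^+(\mathcal A^0,\mathbb R)$, the $A$-extension $\boldsymbol{\phi^A}$ is the (unique in law) $\mathrm{Hom}^+(\mathcal A^A,\mathbb R)$-valued random variable such that $$\mathbb E\big[\boldsymbol{\phi^A}(F)\big]=\frac{\phi([\![F]\!]_A)}{\phi([\![\mathbb 1_A]\!]_A)}\qquad\text{for every } F\in\mathcal F^A .$$ Let $\phi_{\mathrm{rdm}}\in\mathrm{Hom}^+(\mathcal A^0,\mathbb R)$ be the almost sure limit, as the number of vertices tends to infinity, of the random tournaments in which every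 arc is oriented independently by a fair coin; that is, almost surely the density of every finite tournament $T$ in the random tournament on $n$ vertices tends to $\phi_{\mathrm{rdm}}(T)$. **Theorem.** The homomorphism $\phi_{\mathrm{rdm}}$ exists, every $\phi\in\mathrm{Hom}^+(\mathcal A^0,\mathbb R)$ has an $A$-extension $\boldsymbol{\phi^A}$, unique in law, and for every $\phi\in\mathrm{Hom}^+(\mathcal A^0,\mathbb R)$, $$\boldsymbol{\phi^A}(\vec C_3^A)=\frac14\ \text{ almost surely}\quad\Longleftrightarrow\quad \phi=\phi_{\mathrm{rdm}} .$$ -/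

import Mathlib

open MeasureTheory Filter Topology

noncomputable section

namespace TournamentFlags

/-- A tournament on `V`: every two distinct vertices are joined by exactly one arc. -/
structure Tournament (V : Type) where
  Beats : V → V → Prop
  asymm : ∀ u v, Beats u v → ¬ Beats v u
  total : ∀ u v, u ≠ v → Beats u v ∨ Beats v u

/-- Types of size `k` are tournaments on the label set `Fin k`. A `σ`-flag with vertex set `V`
is a tournament on `V` with an embedding of `σ` into it. -/
structure LabelledTournament {k : ℕ} (σ : Tournament (Fin k)) (V : Type) where
  tour : Tournament V
  label : Fin k ↪ V
  label_beats : ∀ i j, tour.Beats (label i) (label j) ↔ σ.Beats i j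

variable {k : ℕ} {σ : Tournament (Fin k)}

namespace LabelledTournament

/-- Label-preserving isomorphism. -/
def Isomorphic {V W : Type} (F : LabelledTournament σ V) (G : LabelledTournament σ W) : Prop :=
  ∃ e : V ≃ W, (∀ u v, F.tour.Beats u v ↔ G.tour.Beats (e u) (e v)) ∧
    ∀ i, e (F.label i) = G.label i

theorem Isomorphic.refl {V : Type} (F : LabelledTournament σ V) : F.Isomorphic F :=
  ⟨Equiv.refl V, fun _ _ => Iff.rfl, fun _ => rfl⟩

theorem Isomorphic.symm {V W : Type} {F : LabelledTournament σ V} {G : LabelledTournament σ W}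
    (h : F.Isomorphic G) : G.Isomorphic F := by
  obtain ⟨e, he, hl⟩ := h
  refine ⟨e.symm, fun u v => ?_, fun i => ?_⟩
  · rw [he, e.apply_symm_apply, e.apply_symm_apply]
  · rw [← hl, e.symm_apply_apply]

theorem Isomorphic.trans {U V W : Type} {F : LabelledTournament σ U}
    {G : LabelledTournament σ V} {H : LabelledTournament σ W}
    (h₁ : F.Isomorphic G) (h₂ : G.Isomorphic H) : F.Isomorphic H := by
  obtain ⟨e, he, hl⟩ := h₁
  obtain ⟨f, hf, hm⟩ := h₂
  refine ⟨e.trans f, fun u v => ?_, fun i => ?_⟩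
  · rw [he, hf]; rfl
  · rw [← hm, ← hl]; rfl

instance isoSetoid (σ : Tournament (Fin k)) (V : Type) : Setoid (LabelledTournament σ V) where
  r := Isomorphic
  iseqv := ⟨Isomorphic.refl, Isomorphic.symm, Isomorphic.trans⟩

/-- The induced sub-flag on a set of vertices containing all labelled vertices. -/
def restrict {V : Type} (F : LabelledTournament σ V) (S : Finset V)
    (hS : ∀ i, F.label i ∈ S) : LabelledTournament σ S where
  tour :=
    { Beats := fun u v => F.tour.Beats u v
      asymm := fun u v => F.tour.asymm u v
      total := fun u v h => F.tour.total u v (fun h' => h (Subtype.ext h')) }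
  label := ⟨fun i => ⟨F.label i, hS i⟩, fun _ _ h => F.label.injective (congrArg Subtype.val h)⟩
  label_beats := F.label_beats

instance finite_fin (σ : Tournament (Fin k)) (n : ℕ) : Finite (LabelledTournament σ (Fin n)) := by
  refine Finite.of_injective
    (β := (Fin n → Fin n → Prop) × (Fin k ↪ Fin n)) (fun F => (F.tour.Beats, F.label)) ?_
  rintro ⟨⟨b, _, _⟩, l, _⟩ ⟨⟨b', _, _⟩, l', _⟩ h
  obtain ⟨rfl, rfl⟩ := Prod.mk.inj h
  rfl

end LabelledTournament

open LabelledTournament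

/-- Isomorphism classes of `σ`-flags with `n` vertices. -/
def FlagOfSize (σ : Tournament (Fin k)) (n : ℕ) : Type :=
  Quotient (isoSetoid σ (Fin n))

instance (σ : Tournament (Fin k)) (n : ℕ) : Finite (FlagOfSize σ n) :=
  inferInstanceAs (Finite (Quotient (isoSetoid σ (Fin n))))

instance (σ : Tournament (Fin k)) (n : ℕ) : Fintype (FlagOfSize σ n) :=
  Fintype.ofFinite _

/-- The set of all (finite) `σ`-flags up to isomorphism. -/
def Flag (σ : Tournament (Fin k)) : Type := Σ n : ℕ, FlagOfSize σ n

/-- The flag of a labelled tournament on `Fin n`. -/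
def LabelledTournament.toFlag {n : ℕ} (F : LabelledTournament σ (Fin n)) : FlagOfSize σ n :=
  Quotient.mk _ F

/-- A labelled tournament representing a given flag. -/
def FlagOfSize.rep {n : ℕ} (F : FlagOfSize σ n) : LabelledTournament σ (Fin n) :=
  Quotient.out F

/-- In the labelled tournament `G`, the set `S` contains all labelled vertices and induces a
copy of `F`. (In particular `S` then has exactly `n` elements.) -/
def Induces {n : ℕ} {V : Type} (G : LabelledTournament σ V) (S : Finset V)
    (F : FlagOfSize σ n) : Prop :=
  ∃ hS : ∀ i, G.label i ∈ S, (G.restrict S hS).Isomorphic F.rep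

/-- The density `p(F, G)`: the probability that a uniformly random set of `n` vertices of `G`
containing all labelled ones induces a copy of `F`. -/
def density {n : ℕ} {V : Type} [Fintype V] (F : FlagOfSize σ n)
    (G : LabelledTournament σ V) : ℝ :=
  (Nat.card {S : Finset V // Induces G S F} : ℝ) / ((Fintype.card V - k).choose (n - k) : ℝ)

/-- The joint density `p(F₁, F₂; G)`: the probability that a uniformly random pair of sets, of
sizes `n₁` and `n₂`, meeting exactly in the labelled vertices, induces `F₁` and `F₂`. -/
def density₂ {n₁ n₂ : ℕ} {V : Type} [Fintype V] (F₁ : FlagOfSize σ n₁) (F₂ : FlagOfSize σ n₂)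
    (G : LabelledTournament σ V) : ℝ :=
  (Nat.card {S : Finset V × Finset V // Induces G S.1 F₁ ∧ Induces G S.2 F₂ ∧
      ∀ v, v ∈ S.1 → v ∈ S.2 → v ∈ Set.range G.label} : ℝ) /
    ((Fintype.card V - k).choose (n₁ - k) * (Fintype.card V - n₁).choose (n₂ - k) : ℝ)

/-- The type itself as a flag, all of whose vertices are labelled. -/
def unitFlag (σ : Tournament (Fin k)) : FlagOfSize σ k :=
  LabelledTournament.toFlag ⟨σ, Function.Embedding.refl _, fun _ _ => Iff.rfl⟩

/-- The generator of the polynomial ring belonging to a flag. -/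
def gen {n : ℕ} (F : FlagOfSize σ n) : MvPolynomial (Flag σ) ℝ :=
  MvPolynomial.X (⟨n, F⟩ : Flag σ)

/-- The defining relations of the flag algebra: averaging over flags of a larger size, the
multiplication of flags, and the unit. -/
inductive Relation (σ : Tournament (Fin k)) : MvPolynomial (Flag σ) ℝ → Prop
  | average {n N : ℕ} (F : FlagOfSize σ n) (h : n ≤ N) :
      Relation σ (gen F - ∑ G : FlagOfSize σ N, MvPolynomial.C (density F G.rep) * gen G)
  | product {n₁ n₂ N : ℕ} (F₁ : FlagOfSize σ n₁) (F₂ : FlagOfSize σ n₂) (h : n₁ + n₂ ≤ N + k) :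
      Relation σ (gen F₁ * gen F₂ -
        ∑ G : FlagOfSize σ N, MvPolynomial.C (density₂ F₁ F₂ G.rep) * gen G)
  | unit : Relation σ (gen (unitFlag σ) - 1)

/-- The flag algebra `𝒜^σ`, presented by generators and relations. Modulo the relations every
element is a linear combination of flags, so this is the space of formal linear combinations of
flags modulo the averaging relations, with the product `F₁ F₂ = ∑ p(F₁, F₂; G) G`. -/
abbrev FlagAlgebra (σ : Tournament (Fin k)) : Type :=
  MvPolynomial (Flag σ) ℝ ⧸ Ideal.span {r | Relation σ r}

/-- A flag as an element of the flag algebra. -/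
def FlagOfSize.toAlgebra {n : ℕ} (F : FlagOfSize σ n) : FlagAlgebra σ :=
  Ideal.Quotient.mk _ (gen F)

/-- `Hom⁺(𝒜^σ, ℝ)`: the algebra homomorphisms that are nonnegative on all flags. -/
structure HomPlus (σ : Tournament (Fin k)) where
  toHom : FlagAlgebra σ →ₐ[ℝ] ℝ
  nonneg : ∀ (n : ℕ) (F : FlagOfSize σ n), 0 ≤ toHom F.toAlgebra

/-- The σ-algebra on `Hom⁺(𝒜^σ, ℝ)` generated by the evaluations at flags; as there are
countably many flags, it is the Borel σ-algebra of the topology of pointwise convergence. -/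
instance (σ : Tournament (Fin k)) : MeasurableSpace (HomPlus σ) :=
  MeasurableSpace.comap (fun (ψ : HomPlus σ) (F : Flag σ) => ψ.toHom F.2.toAlgebra)
    MeasurableSpace.pi

/-- The type of size `0`. -/
def emptyType : Tournament (Fin 0) where
  Beats _ _ := False
  asymm _ _ h := h.elim
  total u := u.elim0

/-- Forgetting the labels. -/
def LabelledTournament.unlabel {V : Type} (F : LabelledTournament σ V) :
    LabelledTournament emptyType V where
  tour := F.tour
  label := ⟨fun i => i.elim0, fun i => i.elim0⟩
  label_beats i := i.elim0

/-- The probability that a uniformly random injection of the labels into the vertex set of `F`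
turns the underlying tournament of `F` into a copy of `F`. -/
def labellingProb {n : ℕ} (F : FlagOfSize σ n) : ℝ :=
  (Nat.card {θ : Fin k ↪ Fin n // ∃ h : ∀ i j, F.rep.tour.Beats (θ i) (θ j) ↔ σ.Beats i j,
      Isomorphic (⟨F.rep.tour, θ, h⟩ : LabelledTournament σ (Fin n)) F.rep} : ℝ) /
    (Nat.card (Fin k ↪ Fin n) : ℝ)

/-- The downward operator `⟦F⟧_σ` on flags. -/
def downward {n : ℕ} (F : FlagOfSize σ n) : FlagAlgebra emptyType :=
  labellingProb F • (F.rep.unlabel.toFlag).toAlgebra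

/-- `P` is the law of the `σ`-extension of `φ`: a probability measure on `Hom⁺(𝒜^σ, ℝ)`
with `𝔼[ψ(F)] = φ(⟦F⟧_σ) / φ(⟦1_σ⟧_σ)` for every `σ`-flag `F`. -/
structure IsExtension (φ : HomPlus emptyType) (P : Measure (HomPlus σ)) : Prop where
  isProbabilityMeasure : IsProbabilityMeasure P
  expectation : ∀ (n : ℕ) (F : FlagOfSize σ n),
    ∫ ψ, ψ.toHom F.toAlgebra ∂P = φ.toHom (downward F) / φ.toHom (downward (unitFlag σ))

/-- Independent fair coins, one for each pair of natural numbers. -/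
def coins : Measure (ℕ × ℕ → Bool) :=
  Measure.infinitePi fun _ => (PMF.uniformOfFintype Bool).toMeasure

/-- The random tournament on `n` vertices: for `i < j` the coin at `(i, j)` orients the arc. -/
def randomTournament (ω : ℕ × ℕ → Bool) (n : ℕ) : LabelledTournament emptyType (Fin n) where
  tour :=
    { Beats := fun i j => (i < j ∧ ω (i, j) = true) ∨ (j < i ∧ ω (j, i) = false)
      asymm := by
        rintro u v (⟨h, hω⟩ | ⟨h, hω⟩) (⟨h', hω'⟩ | ⟨h', hω'⟩)
        · exact absurd h' h.asymm
        · simp [hω] at hω'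
        · simp [hω] at hω'
        · exact absurd h' h.asymm
      total := by
        intro u v huv
        rcases lt_or_gt_of_ne huv with h | h
        · rcases Bool.eq_false_or_eq_true (ω (u, v)) with hω | hω
          · exact Or.inl (Or.inl ⟨h, hω⟩)
          · exact Or.inr (Or.inr ⟨h, hω⟩)
        · rcases Bool.eq_false_or_eq_true (ω (v, u)) with hω | hω
          · exact Or.inr (Or.inl ⟨h, hω⟩)
          · exact Or.inl (Or.inr ⟨h, hω⟩) }
  label := ⟨fun i => i.elim0, fun i => i.elim0⟩
  label_beats i := i.elim0

/-- `φ` is the almost sure limit of the random tournaments. -/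
def IsRandomLimit (φ : HomPlus emptyType) : Prop :=
  ∀ᵐ ω ∂coins, ∀ (m : ℕ) (F : FlagOfSize emptyType m),
    Tendsto (fun n => density F (randomTournament ω n)) atTop (𝓝 (φ.toHom F.toAlgebra))

/-- The type `A` of size `2`, in which the first label beats the second. -/
def typeA : Tournament (Fin 2) where
  Beats i j := i = 0 ∧ j = 1
  asymm := by decide
  total := by decide

/-- The `A`-flag on the directed 3-cycle `0 → 1 → 2 → 0`, with labelled vertices `0` and `1`. -/
def cycleFlag : FlagOfSize typeA 3 :=
  LabelledTournament.toFlag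
    { tour :=
        { Beats := fun i j => j = i + 1
          asymm := by decide
          total := by decide }
      label := Fin.castLEEmb (by decide)
      label_beats := by
        change ∀ i j : Fin 2, ((Fin.castLE (by decide) j : Fin 3) =
          (Fin.castLE (by decide) i : Fin 3) + 1) ↔ (i = 0 ∧ j = 1)
        decide }

end TournamentFlags

end

/-! A homomorphism φ is a consistent exchangeable family of random tournaments: `expect` gives the
mean of any function of the random tournament on a finite vertex set, and restricting to fewer
vertices preserves the law (`expect_comap`). Two properties of this family are compared. `Balanced`
says that, given everything else, a new vertex w closes an arc u→v to a directed triangle with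
probability 1/4. `Uniform` says that a nonempty product of arc signs s at a new vertex is orthogonal
to every function of the other vertices.

For the A-extension, the product relation turns E[(ψ(C₃) - 1/4) ψ(F)] into such an expectation
(`IsExtension.integral_cycleFlag_mul`). If ψ(C₃) = 1/4 almost surely, this vanishes for all F, which
is `Balanced`. Conversely, `Balanced` gives first moment 1/4 and second moment 1/16 for ψ(C₃), so
its variance is zero.

`Balanced` implies `Uniform` as follows. Adding the conditions for (u,v) and (v,u) shows that
s(v,w)s(w,u) + s(u,v)s(v,w) + s(u,v)s(w,u) is orthogonal to functions of the tournament without w.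
Against the constant 1 this forces every cherry s(a,b)s(a,c) to have mean zero. By Cauchy-Schwarz
over many copies of the new vertex (`expect_eq_zero_of_copies`), one sign at a new vertex is then
orthogonal to the rest; the identity upgrades this to two signs. For a product over A, two copies of
the new vertex give a product of squares-like pairs, and any v in A, seen as the new vertex, carries
exactly two distinguished signs, so the mean is zero and the copies argument applies again.

`Uniform` determines every expectation, by expanding in signs at one vertex and removing vertices
one at a time. The limit of random tournaments exists and is `Uniform` by a second-moment bound of
order 1/n², which is summable. Extensions exist by compactness: the laws of densities in large
random flags have a weak limit, which is carried by homomorphisms. They are unique since flags span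
the algebra and polynomials separate points of the cube. -/

open MeasureTheory Filter Topology

noncomputable section

namespace TournamentFlags

variable {k : ℕ} {σ : Tournament (Fin k)}

open LabelledTournament

/-! ### Averages over finite types -/

/-- The average of a real function over a finite type (`0` on the empty type). -/
def avg {α : Type*} [Finite α] (f : α → ℝ) : ℝ :=
  letI := Fintype.ofFinite α
  (∑ a, f a) / Nat.card α

section avg
variable {α β : Type*} [Finite α] [Finite β]

theorem avg_eq [inst : Fintype α] (f : α → ℝ) : avg f = (∑ a, f a) / Nat.card α := by
  unfold avg
  congr 2
  exact congrArg (fun i : Fintype α => (@Finset.univ α i)) (Subsingleton.elim _ _)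

theorem avg_equiv (e : α ≃ β) (f : β → ℝ) : avg (fun a => f (e a)) = avg f := by
  let _ := Fintype.ofFinite α
  let _ := Fintype.ofFinite β
  rw [avg_eq, avg_eq, Nat.card_congr e, e.sum_comp]

theorem avg_const [Nonempty α] (c : ℝ) : avg (fun _ : α => c) = c := by
  let _ := Fintype.ofFinite α
  rw [avg_eq]
  have : (Nat.card α : ℝ) ≠ 0 := by exact_mod_cast Nat.card_pos.ne'
  simp only [Finset.sum_const, Finset.card_univ, nsmul_eq_mul, ← Nat.card_eq_fintype_card]
  field_simp

theorem avg_add (f g : α → ℝ) : avg (fun a => f a + g a) = avg f + avg g := by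
  let _ := Fintype.ofFinite α
  simp only [avg_eq, Finset.sum_add_distrib, add_div]

theorem avg_const_mul (c : ℝ) (f : α → ℝ) : avg (fun a => c * f a) = c * avg f := by
  let _ := Fintype.ofFinite α
  simp only [avg_eq, ← Finset.mul_sum, mul_div_assoc]

theorem avg_sum {ι : Type*} (s : Finset ι) (f : ι → α → ℝ) :
    avg (fun a => ∑ i ∈ s, f i a) = ∑ i ∈ s, avg (f i) := by
  let _ := Fintype.ofFinite α
  simp only [avg_eq, Finset.sum_div]
  exact Finset.sum_comm

theorem avg_comm (f : α → β → ℝ) :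
    avg (fun a => avg (fun b => f a b)) = avg (fun b => avg (fun a => f a b)) := by
  let _ := Fintype.ofFinite α
  let _ := Fintype.ofFinite β
  simp only [avg_eq, ← Finset.sum_div]
  rw [Finset.sum_comm, div_right_comm]

theorem avg_nonneg {f : α → ℝ} (h : ∀ a, 0 ≤ f a) : 0 ≤ avg f := by
  let _ := Fintype.ofFinite α
  rw [avg_eq]
  exact div_nonneg (Finset.sum_nonneg fun a _ => h a) (Nat.cast_nonneg _)

theorem avg_mono {f g : α → ℝ} (h : ∀ a, f a ≤ g a) : avg f ≤ avg g := by
  let _ := Fintype.ofFinite α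
  rw [avg_eq, avg_eq]
  exact div_le_div_of_nonneg_right (Finset.sum_le_sum fun a _ => h a) (Nat.cast_nonneg _)

theorem avg_le_one {f : α → ℝ} (h : ∀ a, f a ≤ 1) : avg f ≤ 1 := by
  rcases isEmpty_or_nonempty α with hα | hα
  · let _ := Fintype.ofFinite α
    rw [avg_eq]
    simp
  · exact (avg_mono h).trans (avg_const (α := α) 1).le

theorem avg_indicator (p : α → Prop) [DecidablePred p] :
    avg (fun a => if p a then (1 : ℝ) else 0) = (Nat.card {a // p a} : ℝ) / Nat.card α := by
  let _ := Fintype.ofFinite α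
  rw [avg_eq, Finset.sum_boole, Nat.card_eq_fintype_card (α := {a // p a}), Fintype.card_subtype]

/-- Averages are preserved by a map all of whose fibres have the same size. -/
theorem avg_comp [Nonempty α] (f : α → β)
    (hf : ∀ x y, ∃ e : α ≃ α, ∀ a, f a = x ↔ f (e a) = y) (u : β → ℝ) :
    avg (fun a => u (f a)) = avg u := by
  classical
  let _ := Fintype.ofFinite α
  let _ := Fintype.ofFinite β
  obtain ⟨a₀⟩ := ‹Nonempty α›
  set c : ℕ := (Finset.univ.filter fun a => f a = f a₀).card with hc
  have hcard : ∀ y, (Finset.univ.filter fun a => f a = y).card = c := by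
    intro y
    obtain ⟨e, he⟩ := hf y (f a₀)
    rw [hc]
    refine Finset.card_equiv e fun a => ?_
    simp [he a]
  have hsum : ∀ v : β → ℝ, ∑ a, v (f a) = c * ∑ y, v y := by
    intro v
    rw [← Finset.sum_fiberwise (s := Finset.univ) (g := f), Finset.mul_sum]
    refine Finset.sum_congr rfl fun y _ => ?_
    rw [Finset.sum_congr rfl (g := fun _ => v y), Finset.sum_const, hcard, nsmul_eq_mul]
    intro a ha
    rw [(Finset.mem_filter.mp ha).2]
  have hc0 : (c : ℝ) ≠ 0 := by
    rw [hc]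
    exact_mod_cast (Finset.card_pos.mpr ⟨a₀, by simp⟩).ne'
  -- The constant 1 gives |α| = c·|β|, so the fibre size c cancels from the average.
  have h1 := hsum fun _ => 1
  simp only [Finset.sum_const, Finset.card_univ, nsmul_eq_mul, mul_one] at h1
  rw [avg_eq, avg_eq, hsum, Nat.card_eq_fintype_card, Nat.card_eq_fintype_card, h1,
    mul_div_mul_left _ _ hc0]

end avg

/-! ### Extending embeddings to permutations -/

/-- The bijection between the two ranges extends to the complements by finiteness. This transitivity
is what makes the averages over embeddings below uniform. -/
theorem exists_perm_comp {V W : Type} [Finite W] (η θ : V ↪ W) :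
    ∃ π : W ≃ W, ∀ v, π (η v) = θ v := by
  classical
  let _ := Fintype.ofFinite W
  let e : {w // w ∈ Set.range η} ≃ {w // w ∈ Set.range θ} :=
    (Equiv.ofInjective η η.injective).symm.trans (Equiv.ofInjective θ θ.injective)
  refine ⟨e.extendSubtype, fun v => ?_⟩
  rw [e.extendSubtype_apply_of_mem _ ⟨v, rfl⟩]
  have : (Equiv.ofInjective η η.injective).symm ⟨η v, ⟨v, rfl⟩⟩ = v :=
    Equiv.ofInjective_symm_apply η.injective v
  simp only [e, Equiv.trans_apply, this, Equiv.ofInjective_apply]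

/-! ### Pulling back tournaments -/

namespace Tournament
variable {U V W : Type}

@[ext] theorem ext {S T : Tournament V} (h : ∀ u v, S.Beats u v ↔ T.Beats u v) : S = T := by
  obtain ⟨b, _, _⟩ := S
  obtain ⟨b', _, _⟩ := T
  obtain rfl : b = b' := by
    funext u v
    exact propext (h u v)
  rfl

theorem irrefl (T : Tournament V) (v : V) : ¬ T.Beats v v := fun h => T.asymm v v h h

/-- The pull-back of a tournament along an injection of vertices. -/
def comap (T : Tournament W) (η : V ↪ W) : Tournament V where
  Beats u v := T.Beats (η u) (η v)
  asymm u v := T.asymm (η u) (η v)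
  total u v h := T.total (η u) (η v) (fun h' => h (η.injective h'))

theorem comap_comap (T : Tournament W) (η : V ↪ W) (θ : U ↪ V) :
    (T.comap η).comap θ = T.comap (θ.trans η) := rfl

instance [Finite V] : Finite (Tournament V) :=
  Finite.of_injective (fun T : Tournament V => T.Beats) fun S T h =>
    ext fun u v => by
      have : S.Beats = T.Beats := h
      rw [this]

end Tournament

/-! ### Embeddings with prescribed labels -/

/-- The embeddings of `V` into `W` that carry the labels `ι` to the labels `ℓ`. -/
def Rel {V W : Type} (ι : Fin k ↪ V) (ℓ : Fin k ↪ W) : Type :=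
  {η : V ↪ W // ∀ i, η (ι i) = ℓ i}

section Rel
variable {U V W : Type}

instance [Finite V] [Finite W] (ι : Fin k ↪ V) (ℓ : Fin k ↪ W) : Finite (Rel ι ℓ) :=
  inferInstanceAs (Finite {η : V ↪ W // ∀ i, η (ι i) = ℓ i})

theorem Rel.nonempty [Finite V] [Finite W] (ι : Fin k ↪ V) (ℓ : Fin k ↪ W)
    (h : Nat.card V ≤ Nat.card W) : Nonempty (Rel ι ℓ) := by
  classical
  let _ := Fintype.ofFinite V
  let _ := Fintype.ofFinite W
  rw [Nat.card_eq_fintype_card, Nat.card_eq_fintype_card] at h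
  obtain ⟨θ⟩ := Function.Embedding.nonempty_of_card_le h
  obtain ⟨π, hπ⟩ := exists_perm_comp (ι.trans θ) ℓ
  exact ⟨θ.trans π.toEmbedding, hπ⟩

/-- Permuting the target by a permutation that respects the labels. -/
def Rel.post {ι : Fin k ↪ V} {ℓ : Fin k ↪ W} (π : W ≃ W) (hπ : ∀ i, π (ℓ i) = ℓ i) :
    Rel ι ℓ ≃ Rel ι ℓ where
  toFun η := ⟨η.1.trans π.toEmbedding, fun i => by simp [η.2 i, hπ i]⟩
  invFun η := ⟨η.1.trans π.symm.toEmbedding, fun i => by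
    simp [η.2 i, Equiv.symm_apply_eq, hπ i]⟩
  left_inv η := Subtype.ext (by ext; simp)
  right_inv η := Subtype.ext (by ext; simp)

@[simp] theorem Rel.post_apply {ι : Fin k ↪ V} {ℓ : Fin k ↪ W} (π : W ≃ W)
    (hπ : ∀ i, π (ℓ i) = ℓ i) (η : Rel ι ℓ) (v : V) : (Rel.post π hπ η).1 v = π (η.1 v) := rfl

/-- Composition of label preserving embeddings. -/
def Rel.comp {ι : Fin k ↪ U} {κ : Fin k ↪ V} {ℓ : Fin k ↪ W} (η : Rel ι κ) (θ : Rel κ ℓ) :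
    Rel ι ℓ :=
  ⟨η.1.trans θ.1, fun i => by simp [η.2 i, θ.2 i]⟩

/-- Permutations of W that fix the labels act transitively on label preserving embeddings of U, so
all fibres of θ ↦ `η.comp θ` have the same size. Thus a uniform embedding of V restricts to a
uniform embedding of U. -/
theorem avg_rel_comp [Finite U] [Finite V] [Finite W] {ι : Fin k ↪ U} {κ : Fin k ↪ V}
    {ℓ : Fin k ↪ W} (h : Nat.card V ≤ Nat.card W) (η : Rel ι κ) (u : Rel ι ℓ → ℝ) :
    avg (fun θ : Rel κ ℓ => u (η.comp θ)) = avg u := by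
  have := Rel.nonempty κ ℓ h
  refine avg_comp (fun θ : Rel κ ℓ => η.comp θ) (fun x y => ?_) u
  obtain ⟨π, hπ⟩ := exists_perm_comp x.1 y.1
  have hl : ∀ i, π (ℓ i) = ℓ i := fun i => by
    have := hπ (ι i)
    rwa [x.2, y.2] at this
  refine ⟨Rel.post π hl, fun θ => ?_⟩
  constructor
  · rintro rfl
    refine Subtype.ext (Function.Embedding.ext fun v => ?_)
    exact hπ v
  · rintro rfl
    refine Subtype.ext (Function.Embedding.ext fun v => ?_)
    exact π.injective (hπ v).symm

end Rel

/-! ### Densities as averages over embeddings -/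

/-- With the labels `ℓ`, the tournament `T` is a copy of the flag `F`. -/
def Ind {V : Type} {n : ℕ} (F : FlagOfSize σ n) (ℓ : Fin k ↪ V) (T : Tournament V) : Prop :=
  ∃ h : ∀ i j, T.Beats (ℓ i) (ℓ j) ↔ σ.Beats i j,
    Isomorphic (⟨T, ℓ, h⟩ : LabelledTournament σ V) F.rep

/-- The indicator of a proposition, as a real number. -/
def ind (p : Prop) : ℝ := open Classical in if p then 1 else 0

theorem ind_true {p : Prop} (h : p) : ind p = 1 := by classical exact if_pos h
theorem ind_false {p : Prop} (h : ¬ p) : ind p = 0 := by classical exact if_neg h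
theorem ind_nonneg (p : Prop) : 0 ≤ ind p := by
  by_cases h : p
  · rw [ind_true h]; exact zero_le_one
  · rw [ind_false h]
theorem ind_le_one (p : Prop) : ind p ≤ 1 := by
  by_cases h : p
  · rw [ind_true h]
  · rw [ind_false h]; exact zero_le_one
theorem ind_and (p q : Prop) : ind (p ∧ q) = ind p * ind q := by
  by_cases hp : p <;> by_cases hq : q <;> simp [ind, hp, hq]

theorem avg_ind {α : Type*} [Finite α] (p : α → Prop) :
    avg (fun a => ind (p a)) = (Nat.card {a // p a} : ℝ) / Nat.card α := by
  classical
  rw [← avg_indicator]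
  refine congrArg avg (funext fun a => ?_)
  unfold ind
  congr

section
variable {U V W : Type}

/-- The pull-back of a labelled tournament along a label preserving embedding. -/
def LabelledTournament.pull (G : LabelledTournament σ W) {ι : Fin k ↪ V} (η : Rel ι G.label) :
    LabelledTournament σ V where
  tour := G.tour.comap η.1
  label := ι
  label_beats i j := by
    change G.tour.Beats (η.1 (ι i)) (η.1 (ι j)) ↔ _
    rw [η.2, η.2, G.label_beats]

theorem ind_iff {n : ℕ} (F : FlagOfSize σ n) (G : LabelledTournament σ V) :
    Ind F G.label G.tour ↔ G.Isomorphic F.rep :=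
  ⟨fun ⟨_, h⟩ => h, fun h => ⟨G.label_beats, h⟩⟩

theorem FlagOfSize.rep_isomorphic_iff {n : ℕ} (G : LabelledTournament σ (Fin n))
    (F : FlagOfSize σ n) : G.Isomorphic F.rep ↔ F = G.toFlag := by
  constructor
  · intro h
    rw [← Quotient.out_eq F]
    exact (Quotient.sound h).symm
  · rintro rfl
    exact (Quotient.mk_out (s := isoSetoid σ (Fin n)) G).symm

/-- Every labelled tournament on `n` vertices is a copy of exactly one flag. -/
theorem exists_flag [Finite V] {n : ℕ} (hV : Nat.card V = n) (G : LabelledTournament σ V) :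
    ∃ F : FlagOfSize σ n, ∀ F', G.Isomorphic F'.rep ↔ F' = F := by
  subst hV
  let e := Finite.equivFin V
  have hlab : ∀ i, e.symm.toEmbedding ((G.label.trans e.toEmbedding) i) = G.label i := by
    intro i; simp
  let H : LabelledTournament σ (Fin (Nat.card V)) :=
    G.pull (ι := G.label.trans e.toEmbedding) ⟨e.symm.toEmbedding, hlab⟩
  have hGH : G.Isomorphic H := by
    refine ⟨e, fun u v => ?_, fun i => rfl⟩
    change _ ↔ G.tour.Beats (e.symm (e u)) (e.symm (e v))
    simp
  refine ⟨H.toFlag, fun F' => ?_⟩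
  rw [← FlagOfSize.rep_isomorphic_iff]
  exact ⟨fun h => hGH.symm.trans h, fun h => hGH.trans h⟩

theorem sum_ind_isomorphic [Finite V] {n : ℕ} (hV : Nat.card V = n) (G : LabelledTournament σ V)
    (f : FlagOfSize σ n → ℝ) (c : ℝ) (hf : ∀ F, G.Isomorphic F.rep → f F = c) :
    ∑ F : FlagOfSize σ n, f F * ind (G.Isomorphic F.rep) = c := by
  obtain ⟨F, hF⟩ := exists_flag hV G
  rw [Finset.sum_eq_single F]
  · rw [ind_true ((hF F).mpr rfl), mul_one, hf F ((hF F).mpr rfl)]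
  · intro F' _ hne
    rw [ind_false (fun h => hne ((hF F').mp h)), mul_zero]
  · simp

/-- The restriction to the range of an embedding is the pull-back. -/
theorem restrict_isomorphic_pull (G : LabelledTournament σ W) {ι : Fin k ↪ V}
    (η : Rel ι G.label) (S : Finset W) (hS : ∀ w, w ∈ S ↔ ∃ v, η.1 v = w)
    (hl : ∀ i, G.label i ∈ S) : (G.pull η).Isomorphic (G.restrict S hl) := by
  refine ⟨Equiv.ofBijective (fun v => ⟨η.1 v, (hS _).mpr ⟨v, rfl⟩⟩) ⟨?_, ?_⟩, ?_, ?_⟩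
  · intro u v h
    exact η.1.injective (congrArg Subtype.val h)
  · rintro ⟨w, hw⟩
    obtain ⟨v, rfl⟩ := (hS w).mp hw
    exact ⟨v, rfl⟩
  · intro u v
    exact Iff.rfl
  · intro i
    exact Subtype.ext (η.2 i)

theorem induces_iff {n : ℕ} (F : FlagOfSize σ n) (G : LabelledTournament σ W) {ι : Fin k ↪ V}
    (η : Rel ι G.label) (S : Finset W) (hS : ∀ w, w ∈ S ↔ ∃ v, η.1 v = w) :
    Induces G S F ↔ Ind F ι (G.tour.comap η.1) := by
  have hl : ∀ i, G.label i ∈ S := fun i => (hS _).mpr ⟨ι i, η.2 i⟩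
  have hiso := restrict_isomorphic_pull G η S hS hl
  rw [show Ind F ι (G.tour.comap η.1) ↔ (G.pull η).Isomorphic F.rep from ind_iff F (G.pull η)]
  exact ⟨fun ⟨_, h⟩ => hiso.trans h, fun h => ⟨hl, hiso.symm.trans h⟩⟩

theorem Induces.card_eq {n : ℕ} {F : FlagOfSize σ n} {G : LabelledTournament σ W}
    {S : Finset W} (h : Induces G S F) : S.card = n := by
  obtain ⟨_, e, _⟩ := h
  simpa using Fintype.card_congr e

theorem FlagOfSize.le_size {n : ℕ} (F : FlagOfSize σ n) : k ≤ n := by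
  simpa using Fintype.card_le_of_embedding F.rep.label

/-- The sets of `n` vertices containing all labels. -/
def LabelledSets (ℓ : Fin k ↪ W) (n : ℕ) : Type :=
  {S : Finset W // (∀ i, ℓ i ∈ S) ∧ S.card = n}

/-- The pairs of vertex sets of sizes `n₁` and `n₂` meeting exactly in the labels. -/
def LabelledPairs (ℓ : Fin k ↪ W) (n₁ n₂ : ℕ) : Type :=
  {S : Finset W × Finset W // ((∀ i, ℓ i ∈ S.1) ∧ S.1.card = n₁) ∧
    ((∀ i, ℓ i ∈ S.2) ∧ S.2.card = n₂) ∧ ∀ v, v ∈ S.1 → v ∈ S.2 → v ∈ Set.range ℓ}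

instance [Finite W] (ℓ : Fin k ↪ W) (n : ℕ) : Finite (LabelledSets ℓ n) :=
  inferInstanceAs (Finite {_S : Finset W // _})

instance [Finite W] (ℓ : Fin k ↪ W) (n₁ n₂ : ℕ) : Finite (LabelledPairs ℓ n₁ n₂) :=
  inferInstanceAs (Finite {_S : Finset W × Finset W // _})

/-- Removing L is a bijection onto the subsets of M with n - |L| elements. Both denominators in the
densities are counted this way. -/
theorem card_supersets_within [DecidableEq W] {L M : Finset W} (hLM : Disjoint L M) {n : ℕ}
    (hn : L.card ≤ n) :
    Nat.card {S : Finset W // L ⊆ S ∧ S.card = n ∧ ∀ v ∈ S, v ∉ L → v ∈ M} =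
      M.card.choose (n - L.card) := by
  rw [← Finset.card_powersetCard, ← Fintype.card_coe, ← Nat.card_eq_fintype_card]
  refine Nat.card_congr ⟨fun S => ⟨S.1 \ L, ?_⟩, fun A => ⟨A.1 ∪ L, ?_⟩, fun S => ?_, fun A => ?_⟩
  · obtain ⟨S, h₁, h₂, h₃⟩ := S
    rw [Finset.mem_powersetCard, Finset.card_sdiff_of_subset h₁]
    refine ⟨fun v hv => ?_, congrArg (· - L.card) h₂⟩
    rw [Finset.mem_sdiff] at hv
    exact h₃ v hv.1 hv.2
  · obtain ⟨A, hA⟩ := A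
    rw [Finset.mem_powersetCard] at hA
    refine ⟨Finset.subset_union_right, ?_, fun v hv hvL => ?_⟩
    · rw [Finset.card_union_of_disjoint (hLM.symm.mono_left hA.1), hA.2]
      omega
    · exact hA.1 ((Finset.mem_union.mp hv).resolve_right hvL)
  · exact Subtype.ext (Finset.sdiff_union_of_subset S.2.1)
  · obtain ⟨A, hA⟩ := A
    rw [Finset.mem_powersetCard] at hA
    exact Subtype.ext (Finset.union_sdiff_cancel_right (hLM.symm.mono_left hA.1))

theorem card_labelledSets [Fintype W] (ℓ : Fin k ↪ W) {n : ℕ} (hn : k ≤ n) :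
    Nat.card (LabelledSets ℓ n) = (Fintype.card W - k).choose (n - k) := by
  classical
  have hL : (Finset.univ.map ℓ).card = k := by simp
  have := card_supersets_within (L := Finset.univ.map ℓ) (M := (Finset.univ.map ℓ)ᶜ)
    disjoint_compl_right (hL.trans_le hn)
  rw [Finset.card_compl, hL] at this
  rw [← this]
  refine Nat.card_congr (Equiv.subtypeEquivRight fun S => ?_)
  simp [Finset.subset_iff]

theorem card_labelledPairs [Fintype W] (ℓ : Fin k ↪ W) {n₁ n₂ : ℕ} (h₁ : k ≤ n₁) (h₂ : k ≤ n₂) :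
    Nat.card (LabelledPairs ℓ n₁ n₂) =
      (Fintype.card W - k).choose (n₁ - k) * (Fintype.card W - n₁).choose (n₂ - k) := by
  classical
  have hL : (Finset.univ.map ℓ).card = k := by simp
  rw [← card_labelledSets ℓ h₁]
  have key : ∀ S : LabelledSets ℓ n₁, Nat.card {T : Finset W // ((∀ i, ℓ i ∈ T) ∧ T.card = n₂) ∧
      ∀ v, v ∈ S.1 → v ∈ T → v ∈ Set.range ℓ} = (Fintype.card W - n₁).choose (n₂ - k) := by
    rintro ⟨S, hS, hc⟩
    have hd : Disjoint (Finset.univ.map ℓ) Sᶜ := by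
      rw [Finset.disjoint_left]
      intro v hv
      obtain ⟨i, -, rfl⟩ := Finset.mem_map.mp hv
      simpa using hS i
    have := card_supersets_within hd (hL.trans_le h₂)
    rw [Finset.card_compl, hL, hc] at this
    rw [← this]
    refine Nat.card_congr (Equiv.subtypeEquivRight fun T => ?_)
    simp only [Finset.subset_iff, Finset.mem_map, Finset.mem_univ, true_and, Finset.mem_compl,
      Set.mem_range, forall_exists_index, forall_apply_eq_imp_iff, and_assoc]
    refine and_congr_right fun _ => and_congr_right fun _ => forall_congr' fun v => ?_
    tauto
  let e : LabelledPairs ℓ n₁ n₂ ≃ Σ S : LabelledSets ℓ n₁,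
      {T : Finset W // ((∀ i, ℓ i ∈ T) ∧ T.card = n₂) ∧
        ∀ v, v ∈ S.1 → v ∈ T → v ∈ Set.range ℓ} :=
    ⟨fun S => ⟨⟨S.1.1, S.2.1⟩, S.1.2, S.2.2⟩, fun S => ⟨(S.1.1, S.2.1), S.1.2, S.2.2⟩,
      fun _ => rfl, fun _ => rfl⟩
  let _ := Fintype.ofFinite (LabelledSets ℓ n₁)
  rw [Nat.card_congr e, Nat.card_sigma, Finset.sum_congr rfl (fun S _ => key S)]
  simp

theorem density_eq_avg_sets [Fintype W] {n : ℕ} (F : FlagOfSize σ n)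
    (G : LabelledTournament σ W) :
    density F G = avg (fun S : LabelledSets G.label n => ind (Induces G S.1 F)) := by
  rw [avg_ind, card_labelledSets _ F.le_size, density]
  congr 2
  refine Nat.card_congr ⟨fun S => ⟨⟨S.1, S.2.1, S.2.card_eq⟩, S.2⟩, fun S => ⟨S.1.1, S.2⟩,
    fun _ => rfl, fun _ => rfl⟩

theorem density₂_eq_avg_sets [Fintype W] {n₁ n₂ : ℕ} (F₁ : FlagOfSize σ n₁)
    (F₂ : FlagOfSize σ n₂) (G : LabelledTournament σ W) :
    density₂ F₁ F₂ G = avg (fun S : LabelledPairs G.label n₁ n₂ =>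
      ind (Induces G S.1.1 F₁ ∧ Induces G S.1.2 F₂)) := by
  rw [avg_ind, card_labelledPairs _ F₁.le_size F₂.le_size, density₂]
  push_cast
  congr 2
  refine Nat.card_congr ⟨fun S => ⟨⟨S.1, ⟨S.2.1.1, S.2.1.card_eq⟩,
    ⟨S.2.2.1.1, S.2.2.1.card_eq⟩, S.2.2.2⟩, S.2.1, S.2.2.1⟩,
    fun S => ⟨S.1.1, S.2.1, S.2.2, S.1.2.2.2⟩, fun _ => rfl, fun _ => rfl⟩

/-- The hypothesis `hf` says that label-fixing permutations carry fibres of f into fibres. As they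
act transitively on embeddings and f is onto, all fibres have equal size. -/
theorem avg_rel_of_surjective [Finite V] [Finite W] {ι : Fin k ↪ V} {ℓ : Fin k ↪ W}
    {β : Type*} [Finite β] (h : Nat.card V ≤ Nat.card W) (f : Rel ι ℓ → β)
    (hsurj : Function.Surjective f)
    (hf : ∀ (π : W ≃ W) (hπ : ∀ i, π (ℓ i) = ℓ i) (η θ : Rel ι ℓ), f η = f θ →
      f (Rel.post π hπ η) = f (Rel.post π hπ θ)) (u : β → ℝ) :
    avg (fun η => u (f η)) = avg u := by
  have := Rel.nonempty ι ℓ h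
  refine avg_comp f (fun x y => ?_) u
  obtain ⟨x, rfl⟩ := hsurj x
  obtain ⟨y, rfl⟩ := hsurj y
  obtain ⟨π, hπ⟩ := exists_perm_comp x.1 y.1
  have hl : ∀ i, π (ℓ i) = ℓ i := fun i => by
    have := hπ (ι i)
    rwa [x.2, y.2] at this
  have hl' : ∀ i, π.symm (ℓ i) = ℓ i := fun i => by rw [Equiv.symm_apply_eq, hl]
  have hxy : Rel.post π hl x = y := Subtype.ext (Function.Embedding.ext hπ)
  refine ⟨Rel.post π hl, fun a => ⟨fun h => ?_, fun h => ?_⟩⟩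
  · rw [hf π hl a x h, hxy]
  · rw [← hxy] at h
    have hinv : ∀ η : Rel ι ℓ, Rel.post π.symm hl' (Rel.post π hl η) = η := fun η =>
      Subtype.ext (Function.Embedding.ext fun v => π.symm_apply_apply _)
    simpa only [hinv] using hf π.symm hl' _ _ h

/-- The average of `g` over all label preserving embeddings into `G`. -/
def LabelledTournament.avgOn [Finite V] [Finite W] (G : LabelledTournament σ W) (ι : Fin k ↪ V)
    (g : Tournament V → ℝ) : ℝ :=
  avg (fun η : Rel ι G.label => g (G.tour.comap η.1))

/-- The image of a uniform label preserving embedding is a uniform vertex set containing the labels.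
The vertex type V is left free, so that it can be adapted to each later use. -/
theorem density_eq_avgOn [Finite V] [Fintype W] {n : ℕ} (F : FlagOfSize σ n)
    (G : LabelledTournament σ W) (ι : Fin k ↪ V) (hV : Nat.card V = n) (hn : n ≤ Fintype.card W) :
    density F G = G.avgOn ι (fun T => ind (Ind F ι T)) := by
  classical
  let _ := Fintype.ofFinite V
  rw [density_eq_avg_sets]
  let f : Rel ι G.label → LabelledSets G.label n := fun η =>
    ⟨Finset.univ.map η.1, fun i => by rw [← η.2 i]; simp, by
      rw [Finset.card_map, Finset.card_univ, ← hV, Nat.card_eq_fintype_card]⟩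
  have hmem : ∀ η w, w ∈ (f η).1 ↔ ∃ v, η.1 v = w := fun η w => by simp [f]
  rw [← avg_rel_of_surjective (by rw [hV]; simpa using hn) f]
  · refine congrArg avg (funext fun η => ?_)
    rw [induces_iff F G η _ (hmem η)]
  · rintro ⟨S, hS, hcard⟩
    let ℓ' : Fin k ↪ S := ⟨fun i => ⟨G.label i, hS i⟩, fun _ _ h =>
      G.label.injective (congrArg Subtype.val h)⟩
    obtain ⟨η⟩ := Rel.nonempty ι ℓ' (by rw [hV, Nat.card_eq_fintype_card, Fintype.card_coe, hcard])
    refine ⟨⟨η.1.trans (Function.Embedding.subtype _), fun i => congrArg Subtype.val (η.2 i)⟩, ?_⟩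
    refine Subtype.ext (Finset.eq_of_subset_of_card_le ?_ ?_)
    · intro w hw
      obtain ⟨v, rfl⟩ := (hmem _ w).mp hw
      exact (η.1 v).2
    · simp [f, hcard, ← hV]
  · intro π hπ η θ h
    refine Subtype.ext (Finset.ext fun w => ?_)
    have h' : ∀ w, (∃ v, η.1 v = w) ↔ ∃ v, θ.1 v = w := fun w => by rw [← hmem, ← hmem, h]
    rw [hmem, hmem]
    simpa [← Equiv.eq_symm_apply] using h' (π.symm w)

/-- The embedding of the first of two petals. -/
def petal₁ (X Y Z : Type) : X ⊕ Y ↪ X ⊕ (Y ⊕ Z) :=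
  Function.Embedding.sumMap (Function.Embedding.refl X) Function.Embedding.inl

/-- The embedding of the second of two petals. -/
def petal₂ (X Y Z : Type) : X ⊕ Z ↪ X ⊕ (Y ⊕ Z) :=
  Function.Embedding.sumMap (Function.Embedding.refl X) Function.Embedding.inr

/-- A uniform pair of sets meeting exactly in the labels is the image of a uniform embedding of the
labels together with two disjoint petals. -/
theorem density₂_eq_avgOn [Fintype W] {n₁ n₂ a b : ℕ} (F₁ : FlagOfSize σ n₁)
    (F₂ : FlagOfSize σ n₂) (G : LabelledTournament σ W) (h₁ : n₁ = k + a) (h₂ : n₂ = k + b)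
    (hn : n₁ + b ≤ Fintype.card W) :
    density₂ F₁ F₂ G = G.avgOn (Function.Embedding.inl : Fin k ↪ Fin k ⊕ (Fin a ⊕ Fin b))
      (fun T => ind (Ind F₁ Function.Embedding.inl (T.comap (petal₁ (Fin k) (Fin a) (Fin b))) ∧
        Ind F₂ Function.Embedding.inl (T.comap (petal₂ (Fin k) (Fin a) (Fin b))))) := by
  classical
  subst h₁ h₂
  rw [density₂_eq_avg_sets]
  let f : Rel (Function.Embedding.inl : Fin k ↪ Fin k ⊕ (Fin a ⊕ Fin b)) G.label →
      LabelledPairs G.label (k + a) (k + b) := fun η =>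
    ⟨(Finset.univ.map ((petal₁ _ _ _).trans η.1), Finset.univ.map ((petal₂ _ _ _).trans η.1)),
      ⟨fun i => by rw [← η.2 i]; simp [petal₁], by simp⟩,
      ⟨fun i => by rw [← η.2 i]; simp [petal₂], by simp⟩, by
        rintro v h h'
        simp only [Finset.mem_map, Finset.mem_univ, true_and] at h h'
        obtain ⟨x, hx⟩ := h
        obtain ⟨y, hy⟩ := h'
        rw [← hx] at hy
        have := η.1.injective hy
        rcases x with x | x <;> rcases y with y | y <;> simp [petal₁, petal₂] at this
        exact ⟨x, by rw [← hx, ← η.2 x]; rfl⟩⟩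
  have hmem₁ : ∀ η w, w ∈ (f η).1.1 ↔ ∃ v, η.1 (petal₁ _ _ _ v) = w := fun η w => by simp [f]
  have hmem₂ : ∀ η w, w ∈ (f η).1.2 ↔ ∃ v, η.1 (petal₂ _ _ _ v) = w := fun η w => by simp [f]
  rw [← avg_rel_of_surjective (by simpa [add_assoc] using hn) f]
  · refine congrArg avg (funext fun η => ?_)
    rw [induces_iff F₁ G (ι := Function.Embedding.inl)
      ⟨(petal₁ _ _ _).trans η.1, fun i => η.2 i⟩ _ (hmem₁ η),
      induces_iff F₂ G (ι := Function.Embedding.inl)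
      ⟨(petal₂ _ _ _).trans η.1, fun i => η.2 i⟩ _ (hmem₂ η)]
    rfl
  · rintro ⟨⟨S₁, S₂⟩, ⟨hS₁, hc₁⟩, ⟨hS₂, hc₂⟩, hS⟩
    simp only at hS₁ hc₁ hS₂ hc₂ hS
    let L := Finset.univ.map G.label
    have hL : L.card = k := by simp [L]
    have hL₁ : L ⊆ S₁ := fun v hv => by
      obtain ⟨i, -, rfl⟩ := Finset.mem_map.mp hv
      exact hS₁ i
    have hL₂ : L ⊆ S₂ := fun v hv => by
      obtain ⟨i, -, rfl⟩ := Finset.mem_map.mp hv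
      exact hS₂ i
    -- A preimage of the pair is glued from the labels and enumerations of the two sets without
    -- them; `hS` keeps the petals disjoint.
    let e₁ := Finset.equivFinOfCardEq (s := S₁ \ L) (n := a) (by
      rw [Finset.card_sdiff_of_subset hL₁]; omega)
    let e₂ := Finset.equivFinOfCardEq (s := S₂ \ L) (n := b) (by
      rw [Finset.card_sdiff_of_subset hL₂]; omega)
    have m₁ : ∀ x, (e₁.symm x : W) ∈ S₁ ∧ (e₁.symm x : W) ∉ L := fun x =>
      Finset.mem_sdiff.mp (e₁.symm x).2
    have m₂ : ∀ x, (e₂.symm x : W) ∈ S₂ ∧ (e₂.symm x : W) ∉ L := fun x =>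
      Finset.mem_sdiff.mp (e₂.symm x).2
    have mL : ∀ i, G.label i ∈ L := fun i => by simp [L]
    have hinj : Function.Injective (Sum.elim G.label
        (Sum.elim (fun x => (e₁.symm x : W)) (fun x => (e₂.symm x : W)))) := by
      refine G.label.injective.sumElim (Function.Injective.sumElim ?_ ?_ ?_) ?_
      · exact Subtype.val_injective.comp e₁.symm.injective
      · exact Subtype.val_injective.comp e₂.symm.injective
      · intro x y hxy
        obtain ⟨i, hi⟩ := hS _ (m₁ x).1 (hxy ▸ (m₂ y).1)
        exact (m₁ x).2 (hi ▸ mL i)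
      · rintro i (x | x) hx
        · exact (m₁ x).2 (by simp only [Sum.elim_inl] at hx; exact hx ▸ mL i)
        · exact (m₂ x).2 (by simp only [Sum.elim_inr] at hx; exact hx ▸ mL i)
    refine ⟨⟨⟨_, hinj⟩, fun i => rfl⟩, ?_⟩
    refine Subtype.ext (Prod.ext (Finset.eq_of_subset_of_card_le ?_ ?_)
      (Finset.eq_of_subset_of_card_le ?_ ?_))
    · intro w hw
      obtain ⟨v, rfl⟩ := (hmem₁ _ w).mp hw
      rcases v with i | x
      · exact hS₁ i
      · exact (m₁ x).1
    · simp [f, hc₁]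
    · intro w hw
      obtain ⟨v, rfl⟩ := (hmem₂ _ w).mp hw
      rcases v with i | x
      · exact hS₂ i
      · exact (m₂ x).1
    · simp [f, hc₂]
  · intro π hπ η θ h
    have h₁ : ∀ w, (∃ v, η.1 (petal₁ _ _ _ v) = w) ↔ ∃ v, θ.1 (petal₁ _ _ _ v) = w :=
      fun w => by rw [← hmem₁, ← hmem₁, h]
    have h₂ : ∀ w, (∃ v, η.1 (petal₂ _ _ _ v) = w) ↔ ∃ v, θ.1 (petal₂ _ _ _ v) = w :=
      fun w => by rw [← hmem₂, ← hmem₂, h]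
    refine Subtype.ext (Prod.ext (Finset.ext fun w => ?_) (Finset.ext fun w => ?_))
    · rw [hmem₁, hmem₁]
      simpa only [Rel.post_apply, ← Equiv.eq_symm_apply] using h₁ (π.symm w)
    · rw [hmem₂, hmem₂]
      simpa only [Rel.post_apply, ← Equiv.eq_symm_apply] using h₂ (π.symm w)

end

/-! ### The chain rule and asymptotic multiplicativity -/

section
variable {U V W : Type}

theorem LabelledTournament.avgOn_congr [Finite U] [Finite V] [Finite W]
    {G : LabelledTournament σ V} {H : LabelledTournament σ W} (h : G.Isomorphic H)
    (ι : Fin k ↪ U) (g : Tournament U → ℝ) : G.avgOn ι g = H.avgOn ι g := by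
  obtain ⟨e, he, hl⟩ := h
  let E : Rel ι G.label ≃ Rel ι H.label :=
    ⟨fun η => ⟨η.1.trans e.toEmbedding, fun i => by simp [η.2 i, hl]⟩,
      fun η => ⟨η.1.trans e.symm.toEmbedding, fun i => by simp [η.2 i, ← hl]⟩,
      fun η => Subtype.ext (by ext; simp), fun η => Subtype.ext (by ext; simp)⟩
  rw [LabelledTournament.avgOn, LabelledTournament.avgOn, ← avg_equiv E]
  refine congrArg avg (funext fun η => congrArg g (Tournament.ext fun u v => ?_))
  exact he _ _

/-- Total probability: embedding V into a random n-vertex subflag of G amounts to a uniform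
embedding into G. Both chain rules for densities are instances. -/
theorem sum_avgOn_mul_density [Finite V] [Fintype W] (G : LabelledTournament σ W)
    (ι : Fin k ↪ V) (g : Tournament V → ℝ) {n : ℕ} (hV : Nat.card V ≤ n)
    (hn : n ≤ Fintype.card W) :
    ∑ F : FlagOfSize σ n, F.rep.avgOn ι g * density F G = G.avgOn ι g := by
  have hk : k ≤ n := by
    have := Finite.card_le_of_embedding ι
    rw [Nat.card_fin] at this
    exact this.trans hV
  let κ : Fin k ↪ Fin n := Fin.castLEEmb hk
  have hκ : Nat.card (Fin n) ≤ Nat.card W := by simpa using hn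
  have := Rel.nonempty κ G.label hκ
  calc ∑ F : FlagOfSize σ n, F.rep.avgOn ι g * density F G
      = ∑ F : FlagOfSize σ n, avg (fun ζ : Rel κ G.label =>
          F.rep.avgOn ι g * ind ((G.pull ζ).Isomorphic F.rep)) := by
        refine Finset.sum_congr rfl fun F _ => ?_
        rw [density_eq_avgOn F G κ (Nat.card_fin n) hn, LabelledTournament.avgOn,
          LabelledTournament.avgOn, avg_const_mul]
        refine congrArg _ (congrArg avg (funext fun ζ => congrArg ind (propext ?_)))
        exact ind_iff F (G.pull ζ)
    _ = avg (fun ζ : Rel κ G.label => (G.pull ζ).avgOn ι g) := by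
        rw [← avg_sum]
        refine congrArg avg (funext fun ζ => ?_)
        exact sum_ind_isomorphic (Nat.card_fin n) (G.pull ζ) (fun F => F.rep.avgOn ι g)
          ((G.pull ζ).avgOn ι g) fun F hF => (avgOn_congr hF ι g).symm
    _ = avg (fun η : Rel ι κ => avg (fun ζ : Rel κ G.label =>
          g (G.tour.comap (η.comp ζ).1))) :=
        avg_comm fun (ζ : Rel κ G.label) (η : Rel ι κ) => g (G.tour.comap (η.comp ζ).1)
    _ = G.avgOn ι g := by
        have := Rel.nonempty ι κ (by simpa using hV)
        have hη : ∀ η : Rel ι κ, avg (fun ζ : Rel κ G.label =>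
            g (G.tour.comap (η.comp ζ).1)) = G.avgOn ι g := fun η =>
          avg_rel_comp hκ η fun θ : Rel ι G.label => g (G.tour.comap θ.1)
        simp only [hη]
        exact avg_const _

theorem density_nonneg [Fintype W] {n : ℕ} (F : FlagOfSize σ n) (G : LabelledTournament σ W) :
    0 ≤ density F G := by
  rw [density_eq_avg_sets]
  exact avg_nonneg fun _ => ind_nonneg _

theorem density_le_one [Fintype W] {n : ℕ} (F : FlagOfSize σ n) (G : LabelledTournament σ W) :
    density F G ≤ 1 := by
  rw [density_eq_avg_sets]
  exact avg_le_one fun _ => ind_le_one _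

theorem sum_density_mul_density [Fintype W] (G : LabelledTournament σ W) {n N : ℕ}
    (F : FlagOfSize σ n) (hnN : n ≤ N) (hN : N ≤ Fintype.card W) :
    ∑ H : FlagOfSize σ N, density F H.rep * density H G = density F G := by
  let ι : Fin k ↪ Fin n := Fin.castLEEmb F.le_size
  rw [density_eq_avgOn F G ι (Nat.card_fin n) (hnN.trans hN),
    ← sum_avgOn_mul_density G ι _ (by simpa using hnN) hN]
  refine Finset.sum_congr rfl fun H _ => ?_
  rw [density_eq_avgOn F H.rep ι (Nat.card_fin n) (by simpa using hnN)]

theorem sum_density₂_mul_density [Fintype W] (G : LabelledTournament σ W) {n₁ n₂ N : ℕ}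
    (F₁ : FlagOfSize σ n₁) (F₂ : FlagOfSize σ n₂) (hnN : n₁ + n₂ ≤ N + k)
    (hN : N ≤ Fintype.card W) :
    ∑ H : FlagOfSize σ N, density₂ F₁ F₂ H.rep * density H G = density₂ F₁ F₂ G := by
  have h₁ := F₁.le_size
  have h₂ := F₂.le_size
  obtain ⟨a, rfl⟩ := Nat.exists_eq_add_of_le h₁
  obtain ⟨b, rfl⟩ := Nat.exists_eq_add_of_le h₂
  rw [density₂_eq_avgOn F₁ F₂ G rfl rfl (by omega),
    ← sum_avgOn_mul_density G _ _ (n := N) (by simp; omega) hN]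
  refine Finset.sum_congr rfl fun H _ => ?_
  rw [density₂_eq_avgOn F₁ F₂ H.rep rfl rfl (by simp; omega)]

theorem density_unitFlag [Fintype W] (G : LabelledTournament σ W) :
    density (unitFlag σ) G = 1 := by
  have hk : k ≤ Fintype.card W := by simpa using Fintype.card_le_of_embedding G.label
  rw [density_eq_avgOn _ G (Function.Embedding.refl _) (Nat.card_fin k) hk]
  have := Rel.nonempty (Function.Embedding.refl (Fin k)) G.label (by simpa using hk)
  rw [← avg_const (α := Rel (Function.Embedding.refl (Fin k)) G.label) 1]
  refine congrArg avg (funext fun η => ind_true ?_)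
  refine (ind_iff _ (G.pull η)).mpr ((FlagOfSize.rep_isomorphic_iff (G.pull η) _).mpr ?_)
  unfold unitFlag
  congr 2
  refine Tournament.ext fun i j => ?_
  exact ((G.pull η).label_beats i j).symm

/-- How far joint densities in tournaments on `N` vertices can be from products. -/
def productError (k n₁ n₂ N : ℕ) : ℝ :=
  1 - ((N - n₁).choose (n₂ - k) : ℝ) / ((N - k).choose (n₂ - k) : ℝ)

/-- The product is an average over all pairs of labelled sets, the joint density an average over the
pairs meeting only in the labels. For functions with values in [0,1] these averages differ by at
most the proportion of excluded pairs, which is `productError`. -/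
theorem abs_density_mul_sub_density₂_le [Fintype W] {n₁ n₂ : ℕ} (F₁ : FlagOfSize σ n₁)
    (F₂ : FlagOfSize σ n₂) (G : LabelledTournament σ W) (h : n₁ + n₂ ≤ Fintype.card W) :
    |density F₁ G * density F₂ G - density₂ F₁ F₂ G| ≤ productError k n₁ n₂ (Fintype.card W) := by
  classical
  have h₁ := F₁.le_size
  have h₂ := F₂.le_size
  let f : LabelledPairs G.label n₁ n₂ → LabelledSets G.label n₁ × LabelledSets G.label n₂ :=
    fun S => (⟨S.1.1, S.2.1⟩, ⟨S.1.2, S.2.2.1⟩)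
  have hf : Function.Injective f := fun S T hST => by
    have := Prod.ext_iff.mp hST
    exact Subtype.ext (Prod.ext (congrArg Subtype.val this.1) (congrArg Subtype.val this.2))
  let _ := Fintype.ofFinite (LabelledPairs G.label n₁ n₂)
  let _ := Fintype.ofFinite (LabelledSets G.label n₁)
  let _ := Fintype.ofFinite (LabelledSets G.label n₂)
  let u : LabelledSets G.label n₁ × LabelledSets G.label n₂ → ℝ := fun S =>
    ind (Induces G S.1.1 F₁) * ind (Induces G S.2.1 F₂)
  have hu0 : ∀ S, 0 ≤ u S := fun S => mul_nonneg (ind_nonneg _) (ind_nonneg _)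
  have hu1 : ∀ S, u S ≤ 1 := fun S =>
    mul_le_one₀ (ind_le_one _) (ind_nonneg _) (ind_le_one _)
  set A : ℝ := ((Fintype.card W - k).choose (n₁ - k) : ℝ) with hA
  set B : ℝ := ((Fintype.card W - k).choose (n₂ - k) : ℝ) with hB
  set B' : ℝ := ((Fintype.card W - n₁).choose (n₂ - k) : ℝ) with hB'
  have hA0 : 0 < A := by
    rw [hA]; exact_mod_cast Nat.choose_pos (by omega)
  have hB0 : 0 < B := by
    rw [hB]; exact_mod_cast Nat.choose_pos (by omega)
  have hB'0 : 0 < B' := by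
    rw [hB']; exact_mod_cast Nat.choose_pos (by omega)
  have hBB' : B' ≤ B := by
    rw [hB, hB']; exact_mod_cast Nat.choose_le_choose _ (by omega)
  have hprod : density F₁ G * density F₂ G = (∑ S, u S) / (A * B) := by
    rw [density_eq_avg_sets, density_eq_avg_sets, avg_eq, avg_eq, card_labelledSets _ h₁,
      card_labelledSets _ h₂, div_mul_div_comm, Fintype.sum_prod_type, Finset.sum_mul_sum]
  have hpair : density₂ F₁ F₂ G = (∑ S, u (f S)) / (A * B') := by
    rw [density₂_eq_avg_sets, avg_eq, card_labelledPairs _ h₁ h₂]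
    push_cast
    congr 1
    exact Finset.sum_congr rfl fun S _ => ind_and _ _
  have hle : ∑ S, u (f S) ≤ ∑ S, u S := by
    exact (Finset.sum_map Finset.univ ⟨f, hf⟩ u).symm.le.trans
      (Finset.sum_le_univ_sum_of_nonneg hu0)
  have hle' : ∑ S, u S - ∑ S, u (f S) ≤ A * B - A * B' := by
    have h1 : A * B = ∑ _S : LabelledSets G.label n₁ × LabelledSets G.label n₂, (1 : ℝ) := by
      rw [Finset.sum_const, Finset.card_univ, Fintype.card_prod, ← Nat.card_eq_fintype_card,
        ← Nat.card_eq_fintype_card, card_labelledSets _ h₁, card_labelledSets _ h₂]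
      simp [hA, hB]
    have h2 : A * B' = ∑ _S : LabelledPairs G.label n₁ n₂, (1 : ℝ) := by
      rw [Finset.sum_const, Finset.card_univ, ← Nat.card_eq_fintype_card,
        card_labelledPairs _ h₁ h₂]
      simp [hA, hB']
    have h3 : ∑ S, (1 - u (f S)) ≤ ∑ S, (1 - u S) := by
      exact (Finset.sum_map Finset.univ ⟨f, hf⟩ (fun S => 1 - u S)).symm.le.trans
        (Finset.sum_le_univ_sum_of_nonneg fun S => sub_nonneg.mpr (hu1 S))
    rw [Finset.sum_sub_distrib, Finset.sum_sub_distrib, ← h1, ← h2] at h3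
    linarith
  have hpair1 : ∑ S, u (f S) ≤ A * B' := by
    have : density₂ F₁ F₂ G ≤ 1 := by
      rw [density₂_eq_avg_sets]
      exact avg_le_one fun _ => ind_le_one _
    rwa [hpair, div_le_one (mul_pos hA0 hB'0)] at this
  have hpair0 : 0 ≤ ∑ S, u (f S) := Finset.sum_nonneg fun S _ => hu0 _
  rw [hprod, hpair, productError, abs_le]
  generalize ∑ S, u (f S) = c at *
  generalize ∑ S, u S = d at *
  -- Here d - c is the contribution of the excluded pairs, between 0 and their number A*B - A*B'.
  -- The two identities split each bound into terms of known sign.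
  have hcd : d / (A * B) - c / (A * B') + (1 - B' / B) =
      (d - c) / (A * B) + (1 - B' / B) * (1 - c / (A * B')) := by
    field_simp; ring
  have hcd' : d / (A * B) - c / (A * B') - (1 - B' / B) =
      (d - c - (A * B - A * B')) / (A * B) - c / (A * B') * (1 - B' / B) := by
    field_simp; ring
  have hr : 0 ≤ 1 - B' / B := by
    rw [sub_nonneg, div_le_one hB0]; exact hBB'
  have hc1 : c / (A * B') ≤ 1 := (div_le_one (mul_pos hA0 hB'0)).mpr hpair1
  have hc0 : 0 ≤ c / (A * B') := div_nonneg hpair0 (mul_pos hA0 hB'0).le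
  constructor
  · have h4 : 0 ≤ (d - c) / (A * B) := div_nonneg (by linarith) (mul_pos hA0 hB0).le
    have h5 : 0 ≤ (1 - B' / B) * (1 - c / (A * B')) := mul_nonneg hr (by linarith)
    linarith
  · have h4 : (d - c - (A * B - A * B')) / (A * B) ≤ 0 :=
      div_nonpos_of_nonpos_of_nonneg (by linarith) (mul_pos hA0 hB0).le
    have h5 : 0 ≤ c / (A * B') * (1 - B' / B) := mul_nonneg hc0 hr
    linarith

/-- Both binomial coefficients are asymptotic to N^(n₂ - k) / (n₂ - k)!, so their ratio tends to 1.
-/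
theorem tendsto_productError (k n₁ n₂ : ℕ) :
    Tendsto (productError k n₁ n₂) atTop (𝓝 0) := by
  have h1 : Asymptotics.IsEquivalent atTop (fun N : ℕ => ((N - n₁).choose (n₂ - k) : ℝ))
      (fun N : ℕ => ((N - k).choose (n₂ - k) : ℝ)) := by
    have hsub : ∀ c : ℕ, Asymptotics.IsEquivalent atTop
        (fun N : ℕ => ((N - c).choose (n₂ - k) : ℝ))
        (fun N : ℕ => (N : ℝ) ^ (n₂ - k) / ((n₂ - k).factorial : ℝ)) := by
      intro c
      have hc := (isEquivalent_choose (n₂ - k)).comp_tendsto (tendsto_sub_atTop_nat c)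
      refine hc.trans ?_
      refine Asymptotics.IsEquivalent.div (Asymptotics.IsEquivalent.pow ?_ _)
        Asymptotics.IsEquivalent.refl
      have hlin : Asymptotics.IsEquivalent atTop (fun N : ℕ => (N : ℝ) + (-(c : ℝ)))
          (fun N : ℕ => (N : ℝ)) := by
        refine Asymptotics.IsEquivalent.add_isLittleO Asymptotics.IsEquivalent.refl ?_
        refine Asymptotics.isLittleO_const_left.mpr (Or.inr ?_)
        exact tendsto_norm_atTop_atTop.comp (tendsto_natCast_atTop_atTop (R := ℝ))
      refine hlin.congr_left ?_
      filter_upwards [eventually_ge_atTop c] with N hN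
      simp [Nat.cast_sub hN, sub_eq_add_neg]
    exact (hsub n₁).trans (hsub k).symm
  have h2 := (Asymptotics.isEquivalent_iff_tendsto_one (by
    filter_upwards [eventually_ge_atTop (n₂ + k)] with N hN
    have : 0 < (N - k).choose (n₂ - k) := Nat.choose_pos (by omega)
    exact_mod_cast this.ne')).mp h1
  have h3 := h2.const_sub 1
  rw [sub_self] at h3
  exact h3

end

/-! ### Homomorphisms as families of values on flags -/

instance : Countable (Flag σ) := inferInstanceAs (Countable (Σ n : ℕ, FlagOfSize σ n))

theorem eval_gen (x : Flag σ → ℝ) {n : ℕ} (F : FlagOfSize σ n) :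
    MvPolynomial.eval x (gen F) = x ⟨n, F⟩ :=
  MvPolynomial.eval_X (⟨n, F⟩ : Flag σ)

theorem mk_relation {p : MvPolynomial (Flag σ) ℝ} (hp : Relation σ p) :
    (Ideal.Quotient.mk _ p : FlagAlgebra σ) = 0 :=
  Ideal.Quotient.eq_zero_iff_mem.mpr (Ideal.subset_span (s := {r | Relation σ r}) hp)

theorem mk_C_mul (c : ℝ) (p : MvPolynomial (Flag σ) ℝ) :
    (Ideal.Quotient.mk _ (MvPolynomial.C c * p) : FlagAlgebra σ) =
      c • (Ideal.Quotient.mk _ p : FlagAlgebra σ) := by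
  rw [MvPolynomial.C_mul']
  rfl

/-- The values of a homomorphism on flags. -/
def HomPlus.values (ψ : HomPlus σ) : Flag σ → ℝ := fun F => ψ.toHom F.2.toAlgebra

theorem HomPlus.toHom_mk (ψ : HomPlus σ) (p : MvPolynomial (Flag σ) ℝ) :
    ψ.toHom (Ideal.Quotient.mk _ p) = MvPolynomial.eval ψ.values p := by
  have h : ψ.toHom.comp (Ideal.Quotient.mkₐ ℝ (Ideal.span {r | Relation σ r})) =
      MvPolynomial.aeval ψ.values := by
    refine MvPolynomial.algHom_ext fun F => ?_
    rw [MvPolynomial.aeval_X]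
    rfl
  have h' := DFunLike.congr_fun h p
  rw [MvPolynomial.aeval_eq_eval] at h'
  exact h'

theorem HomPlus.values_injective : Function.Injective (HomPlus.values (σ := σ)) := by
  rintro ⟨f, hf⟩ ⟨g, hg⟩ h
  have : f = g := by
    refine AlgHom.ext fun a => ?_
    obtain ⟨p, rfl⟩ := Ideal.Quotient.mk_surjective a
    have h₁ := HomPlus.toHom_mk ⟨f, hf⟩ p
    have h₂ := HomPlus.toHom_mk ⟨g, hg⟩ p
    rw [h] at h₁
    exact h₁.trans h₂.symm
  subst this
  rfl

theorem HomPlus.eval_values (ψ : HomPlus σ) {p : MvPolynomial (Flag σ) ℝ} (hp : Relation σ p) :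
    MvPolynomial.eval ψ.values p = 0 := by
  rw [← ψ.toHom_mk, mk_relation hp, map_zero]

/-- The universal property of the presentation: evaluation at x kills the relations, hence factors
through the quotient. -/
theorem exists_homPlus (x : Flag σ → ℝ) (h0 : ∀ F, 0 ≤ x F)
    (h : ∀ p, Relation σ p → MvPolynomial.eval x p = 0) : ∃ ψ : HomPlus σ, ψ.values = x := by
  have hker : ∀ a ∈ Ideal.span {r | Relation σ r}, MvPolynomial.aeval x a = 0 := by
    intro a ha
    have : Ideal.span {r | Relation σ r} ≤
        RingHom.ker (MvPolynomial.aeval x : MvPolynomial (Flag σ) ℝ →ₐ[ℝ] ℝ) := by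
      refine Ideal.span_le.mpr fun p hp => ?_
      change MvPolynomial.aeval x p = 0
      rw [MvPolynomial.aeval_eq_eval]
      exact h p hp
    exact this ha
  have hval : ∀ F : Flag σ, Ideal.Quotient.liftₐ _ (MvPolynomial.aeval x) hker F.2.toAlgebra =
      x F := fun F => by
    change MvPolynomial.aeval x (MvPolynomial.X F) = x F
    rw [MvPolynomial.aeval_X]
  refine ⟨⟨Ideal.Quotient.liftₐ _ (MvPolynomial.aeval x) hker, fun n F => ?_⟩, ?_⟩
  · rw [hval ⟨n, F⟩]
    exact h0 _
  · exact funext hval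

/-- A function on flags that satisfies the averaging relations. -/
def IsAveraging (x : Flag σ → ℝ) : Prop :=
  ∀ (n N : ℕ) (F : FlagOfSize σ n), n ≤ N →
    x ⟨n, F⟩ = ∑ G : FlagOfSize σ N, density F G.rep * x ⟨N, G⟩

theorem HomPlus.isAveraging (ψ : HomPlus σ) : IsAveraging ψ.values := by
  intro n N F h
  have := ψ.eval_values (Relation.average F h)
  simpa [eval_gen, sub_eq_zero] using this

theorem HomPlus.values_mul (ψ : HomPlus σ) {n₁ n₂ N : ℕ} (F₁ : FlagOfSize σ n₁)
    (F₂ : FlagOfSize σ n₂) (h : n₁ + n₂ ≤ N + k) :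
    ψ.values ⟨n₁, F₁⟩ * ψ.values ⟨n₂, F₂⟩ =
      ∑ G : FlagOfSize σ N, density₂ F₁ F₂ G.rep * ψ.values ⟨N, G⟩ := by
  have := ψ.eval_values (Relation.product F₁ F₂ h)
  simpa [eval_gen, sub_eq_zero] using this

theorem HomPlus.values_unit (ψ : HomPlus σ) : ψ.values ⟨k, unitFlag σ⟩ = 1 := by
  have := ψ.eval_values Relation.unit
  simpa [eval_gen, sub_eq_zero] using this

theorem HomPlus.values_nonneg (ψ : HomPlus σ) (F : Flag σ) : 0 ≤ ψ.values F := ψ.nonneg F.1 F.2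

/-- The unit flag has density 1 in every flag, so averaging it over size N gives the total mass.
Hence a nonnegative x is a probability distribution on flags of each size. -/
theorem IsAveraging.sum_eq {x : Flag σ → ℝ} (hx : IsAveraging x)
    (h1 : x ⟨k, unitFlag σ⟩ = 1) {N : ℕ} (hN : k ≤ N) :
    ∑ G : FlagOfSize σ N, x ⟨N, G⟩ = 1 := by
  rw [← h1, hx k N (unitFlag σ) hN]
  refine Finset.sum_congr rfl fun G _ => ?_
  rw [density_unitFlag, one_mul]

theorem HomPlus.values_le_one (ψ : HomPlus σ) (F : Flag σ) : ψ.values F ≤ 1 := by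
  rw [← ψ.isAveraging.sum_eq ψ.values_unit F.2.le_size]
  exact Finset.single_le_sum (f := fun G => ψ.values ⟨F.1, G⟩)
    (fun G _ => ψ.values_nonneg _) (Finset.mem_univ F.2)

/-- The densities of all flags in a labelled tournament. -/
def densities {W : Type} [Fintype W] (G : LabelledTournament σ W) : Flag σ → ℝ :=
  fun F => density F.2 G

/-- Finite labelled tournaments satisfy the relations up to an error that tends to zero. -/
theorem exists_relation_error {p : MvPolynomial (Flag σ) ℝ} (hp : Relation σ p) :
    ∃ ε : ℕ → ℝ, Tendsto ε atTop (𝓝 0) ∧ ∀ᶠ N in atTop, ∀ G : LabelledTournament σ (Fin N),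
      |MvPolynomial.eval (densities G) p| ≤ ε N := by
  cases hp with
  | @average n N F h =>
    refine ⟨0, tendsto_const_nhds, ?_⟩
    filter_upwards [eventually_ge_atTop N] with M hM G
    have := sum_density_mul_density G F h (by simpa using hM)
    simp [eval_gen, densities, this]
  | @product n₁ n₂ N F₁ F₂ h =>
    -- The averaging and unit relations hold exactly in large finite tournaments; only products
    -- leave an error.
    refine ⟨_, tendsto_productError k n₁ n₂, ?_⟩
    filter_upwards [eventually_ge_atTop N, eventually_ge_atTop (n₁ + n₂)] with M hM hM' G
    have h1 := sum_density₂_mul_density G F₁ F₂ h (by simpa using hM)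
    have h2 := abs_density_mul_sub_density₂_le F₁ F₂ G (by simpa using hM')
    simpa [eval_gen, densities, h1] using h2
  | unit =>
    refine ⟨0, tendsto_const_nhds, Eventually.of_forall fun M G => ?_⟩
    simp [eval_gen, densities, density_unitFlag]

theorem exists_homPlus_of_tendsto (G : ∀ N, LabelledTournament σ (Fin N)) (x : Flag σ → ℝ)
    (h : ∀ F : Flag σ, Tendsto (fun N => density F.2 (G N)) atTop (𝓝 (x F))) :
    ∃ ψ : HomPlus σ, ψ.values = x := by
  have hx : Tendsto (fun N => densities (G N)) atTop (𝓝 x) := tendsto_pi_nhds.mpr h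
  refine exists_homPlus x (fun F => ge_of_tendsto' (h F) fun N => density_nonneg _ _) ?_
  intro p hp
  obtain ⟨ε, hε, hle⟩ := exists_relation_error hp
  have h1 := ((MvPolynomial.continuous_eval p).tendsto x).comp hx
  refine tendsto_nhds_unique h1 (squeeze_zero_norm' ?_ hε)
  filter_upwards [hle] with N hN
  exact hN (G N)

/-! ### Random homomorphisms -/

/-- The cube in which the values of homomorphisms lie. -/
abbrev Cube (σ : Tournament (Fin k)) : Type := Flag σ → Set.Icc (0 : ℝ) 1

/-- The values on flags of a point of the cube. -/
def Cube.val (x : Cube σ) : Flag σ → ℝ := fun F => x F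

theorem Cube.continuous_val : Continuous (Cube.val (σ := σ)) :=
  continuous_pi fun F => continuous_subtype_val.comp (continuous_apply F)

/-- The point of the cube given by a homomorphism. -/
def HomPlus.point (ψ : HomPlus σ) : Cube σ :=
  fun F => ⟨ψ.values F, ψ.values_nonneg F, ψ.values_le_one F⟩

theorem HomPlus.point_injective : Function.Injective (HomPlus.point (σ := σ)) := fun _ _ h =>
  HomPlus.values_injective (congrArg Cube.val h)

theorem HomPlus.measurable_values : Measurable (HomPlus.values (σ := σ)) :=
  comap_measurable _

theorem HomPlus.measurable_point : Measurable (HomPlus.point (σ := σ)) :=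
  measurable_pi_lambda _ fun F =>
    ((measurable_pi_apply F).comp HomPlus.measurable_values).subtype_mk

/-- Homomorphisms form a closed subset of the compact cube, cut out by polynomial equations. This
gives measurability of the range and a criterion for a law on the cube to live on it. -/
theorem HomPlus.range_point : Set.range (HomPlus.point (σ := σ)) =
    ⋂ p ∈ {p | Relation σ p}, {x : Cube σ | MvPolynomial.eval x.val p = 0} := by
  ext x
  simp only [Set.mem_range, Set.mem_iInter, Set.mem_ofPred_eq]
  constructor
  · rintro ⟨ψ, rfl⟩ p hp
    exact ψ.eval_values hp
  · intro h
    obtain ⟨ψ, hψ⟩ := exists_homPlus x.val (fun F => (x F).2.1) h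
    exact ⟨ψ, funext fun F => Subtype.ext (congrFun hψ F)⟩

theorem Cube.continuous_eval (p : MvPolynomial (Flag σ) ℝ) :
    Continuous fun x : Cube σ => MvPolynomial.eval x.val p :=
  (MvPolynomial.continuous_eval p).comp Cube.continuous_val

theorem HomPlus.measurableEmbedding_point : MeasurableEmbedding (HomPlus.point (σ := σ)) where
  injective := HomPlus.point_injective
  measurable := HomPlus.measurable_point
  measurableSet_image' := by
    rintro s ⟨t, ht, rfl⟩
    have hrange : MeasurableSet (Set.range (HomPlus.point (σ := σ))) := by
      rw [HomPlus.range_point]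
      exact (isClosed_biInter fun p _ =>
        isClosed_singleton.preimage (Cube.continuous_eval p)).measurableSet
    have : HomPlus.point (σ := σ) '' (HomPlus.values ⁻¹' t) =
        Set.range (HomPlus.point (σ := σ)) ∩ Cube.val ⁻¹' t := by
      ext x
      constructor
      · rintro ⟨ψ, hψ, rfl⟩
        exact ⟨⟨ψ, rfl⟩, hψ⟩
      · rintro ⟨⟨ψ, rfl⟩, hψ⟩
        exact ⟨ψ, hψ, rfl⟩
    change MeasurableSet (HomPlus.point (σ := σ) '' (HomPlus.values ⁻¹' t))
    rw [this]
    exact hrange.inter (Cube.continuous_val.measurable ht)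

/-- Countability allows relations that hold almost surely one by one to hold almost surely all at
once. -/
theorem countable_relation : {p | Relation σ p}.Countable := by
  let f₁ : Flag σ × ℕ → MvPolynomial (Flag σ) ℝ := fun F =>
    gen F.1.2 - ∑ G : FlagOfSize σ F.2, MvPolynomial.C (density F.1.2 G.rep) * gen G
  let f₂ : Flag σ × Flag σ × ℕ → MvPolynomial (Flag σ) ℝ := fun F =>
    gen F.1.2 * gen F.2.1.2 -
      ∑ G : FlagOfSize σ F.2.2, MvPolynomial.C (density₂ F.1.2 F.2.1.2 G.rep) * gen G
  refine (((Set.countable_range f₁).union (Set.countable_range f₂)).union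
    (Set.countable_singleton (gen (unitFlag σ) - 1))).mono ?_
  intro p hp
  cases hp with
  | @average n N F h => exact Or.inl (Or.inl ⟨(⟨n, F⟩, N), rfl⟩)
  | @product n₁ n₂ N F₁ F₂ h => exact Or.inl (Or.inr ⟨(⟨n₁, F₁⟩, ⟨n₂, F₂⟩, N), rfl⟩)
  | unit => exact Or.inr rfl

theorem HomPlus.integrable_eval (P : Measure (HomPlus σ)) [IsProbabilityMeasure P]
    (a : FlagAlgebra σ) : Integrable (fun ψ : HomPlus σ => ψ.toHom a) P := by
  obtain ⟨p, rfl⟩ := Ideal.Quotient.mk_surjective a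
  have hc := Cube.continuous_eval p
  obtain ⟨C, hC⟩ := isCompact_univ.exists_bound_of_continuousOn (hc.continuousOn (s := Set.univ))
  refine Integrable.of_bound (C := C) ?_ (Eventually.of_forall fun ψ => ?_)
  · simp only [HomPlus.toHom_mk]
    exact (hc.measurable.comp HomPlus.measurable_point).aestronglyMeasurable
  · rw [HomPlus.toHom_mk]
    exact hC ψ.point trivial

/-- The unit relation puts 1 into the span and the product relation makes the span stable under
multiplication by flags. Hence expectations of single flags determine all mixed moments. -/
theorem span_toAlgebra :
    Submodule.span ℝ (Set.range fun F : Flag σ => F.2.toAlgebra) = ⊤ := by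
  set M := Submodule.span ℝ (Set.range fun F : Flag σ => F.2.toAlgebra) with hM
  have hflag : ∀ F : Flag σ, F.2.toAlgebra ∈ M := fun F => Submodule.subset_span ⟨F, rfl⟩
  have hone : (1 : FlagAlgebra σ) ∈ M := by
    have h := mk_relation (σ := σ) Relation.unit
    rw [map_sub, map_one, sub_eq_zero] at h
    rw [← h]
    exact hflag ⟨k, unitFlag σ⟩
  have hmul : ∀ a ∈ M, ∀ F : Flag σ, a * F.2.toAlgebra ∈ M := by
    intro a ha F
    induction ha using Submodule.span_induction with
    | mem a h =>
      obtain ⟨E, rfl⟩ := h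
      have h := mk_relation (Relation.product E.2 F.2 (Nat.le_add_right (E.1 + F.1) k))
      rw [map_sub, sub_eq_zero, map_mul, map_sum] at h
      change E.2.toAlgebra * F.2.toAlgebra = _ at h
      change E.2.toAlgebra * F.2.toAlgebra ∈ M
      rw [h]
      refine Submodule.sum_mem _ fun G _ => ?_
      rw [mk_C_mul]
      exact Submodule.smul_mem _ _ (hflag ⟨_, G⟩)
    | zero => rw [zero_mul]; exact zero_mem _
    | add a b _ _ ha hb => rw [add_mul]; exact add_mem ha hb
    | smul c a _ ha => rw [smul_mul_assoc]; exact Submodule.smul_mem _ _ ha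
  refine eq_top_iff.mpr fun a _ => ?_
  obtain ⟨p, rfl⟩ := Ideal.Quotient.mk_surjective a
  induction p using MvPolynomial.induction_on with
  | C c =>
    have := mk_C_mul (σ := σ) c 1
    rw [mul_one, map_one] at this
    rw [this]
    exact Submodule.smul_mem _ _ hone
  | add p q hp hq => rw [map_add]; exact add_mem (hp trivial) (hq trivial)
  | mul_X p F hp => rw [map_mul]; exact hmul _ (hp trivial) F

/-- The law of a random homomorphism is determined by the expectations of flags. -/
theorem HomPlus.measure_ext {P Q : Measure (HomPlus σ)} [IsProbabilityMeasure P]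
    [IsProbabilityMeasure Q]
    (h : ∀ (n : ℕ) (F : FlagOfSize σ n),
      ∫ ψ, ψ.toHom F.toAlgebra ∂P = ∫ ψ, ψ.toHom F.toAlgebra ∂Q) : P = Q := by
  have hall : ∀ a : FlagAlgebra σ, ∫ ψ, ψ.toHom a ∂P = ∫ ψ, ψ.toHom a ∂Q := by
    intro a
    have ha : a ∈ Submodule.span ℝ (Set.range fun F : Flag σ => F.2.toAlgebra) := by
      rw [span_toAlgebra]; trivial
    induction ha using Submodule.span_induction with
    | mem a ha =>
      obtain ⟨F, rfl⟩ := ha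
      exact h F.1 F.2
    | zero => simp
    | add a b _ _ ha hb =>
      simp only [map_add]
      rw [integral_add (integrable_eval P a) (integrable_eval P b),
        integral_add (integrable_eval Q a) (integrable_eval Q b), ha, hb]
    | smul c a _ ha =>
      simp only [map_smul, smul_eq_mul]
      rw [integral_const_mul, integral_const_mul, ha]
  have hmap : P.map HomPlus.point = Q.map HomPlus.point := by
    have hP : IsProbabilityMeasure (P.map (HomPlus.point (σ := σ))) :=
      Measure.isProbabilityMeasure_map HomPlus.measurable_point.aemeasurable
    have hQ : IsProbabilityMeasure (Q.map (HomPlus.point (σ := σ))) :=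
      Measure.isProbabilityMeasure_map HomPlus.measurable_point.aemeasurable
    -- Polynomial functions form an algebra on the cube that separates points through the
    -- coordinates, so their integrals determine the measure.
    let A : StarSubalgebra ℝ (BoundedContinuousFunction (Cube σ) ℝ) :=
      { carrier := {g | ∃ p : MvPolynomial (Flag σ) ℝ, ∀ x, g x = MvPolynomial.eval x.val p}
        mul_mem' := by
          rintro f g ⟨p, hp⟩ ⟨q, hq⟩
          exact ⟨p * q, fun x => by rw [BoundedContinuousFunction.mul_apply, hp, hq, map_mul]⟩
        add_mem' := by
          rintro f g ⟨p, hp⟩ ⟨q, hq⟩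
          exact ⟨p + q, fun x => by rw [BoundedContinuousFunction.add_apply, hp, hq, map_add]⟩
        algebraMap_mem' := fun c => ⟨MvPolynomial.C c, fun x => by simp⟩
        star_mem' := by
          rintro f ⟨p, hp⟩
          exact ⟨p, fun x => by simpa using hp x⟩ }
    refine ext_of_forall_mem_subalgebra_integral_eq_of_polish (A := A) ?_ ?_
    · intro x y hxy
      obtain ⟨F, hF⟩ := Function.ne_iff.mp hxy
      let g : BoundedContinuousFunction (Cube σ) ℝ :=
        BoundedContinuousFunction.mkOfCompact ⟨fun x => x F,
          continuous_subtype_val.comp (continuous_apply F)⟩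
      refine ⟨_, ⟨g.toContinuousMap, ⟨g, ⟨MvPolynomial.X F, fun x => by simp [g, Cube.val]⟩, rfl⟩,
        rfl⟩, ?_⟩
      exact fun h => hF (Subtype.ext h)
    · rintro g ⟨p, hp⟩
      rw [integral_map HomPlus.measurable_point.aemeasurable
        g.continuous.aestronglyMeasurable, integral_map HomPlus.measurable_point.aemeasurable
        g.continuous.aestronglyMeasurable]
      have := hall (Ideal.Quotient.mk _ p)
      simp only [HomPlus.toHom_mk] at this
      simp only [hp]
      exact this
  rw [← HomPlus.measurableEmbedding_point.comap_map P, hmap,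
    HomPlus.measurableEmbedding_point.comap_map]

/-- The densities of all flags in a labelled tournament, as a point of the cube. -/
def densityPoint {W : Type} [Fintype W] (G : LabelledTournament σ W) : Cube σ :=
  fun F => ⟨density F.2 G, density_nonneg _ _, density_le_one _ _⟩

/-- The law of the densities in a random flag of size `N` with distribution `x`. -/
def densityLaw (x : Flag σ → ℝ) (N : ℕ) : Measure (Cube σ) :=
  ∑ G : FlagOfSize σ N, ENNReal.ofReal (x ⟨N, G⟩) • Measure.dirac (densityPoint G.rep)

theorem isProbabilityMeasure_densityLaw {x : Flag σ → ℝ} (h0 : ∀ F, 0 ≤ x F)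
    (h1 : x ⟨k, unitFlag σ⟩ = 1) (hx : IsAveraging x) {N : ℕ} (hN : k ≤ N) :
    IsProbabilityMeasure (densityLaw x N) := by
  constructor
  rw [densityLaw, Measure.finsetSum_apply]
  simp only [Measure.smul_apply, measure_univ, smul_eq_mul, mul_one]
  refine (ENNReal.ofReal_sum_of_nonneg (f := fun G : FlagOfSize σ N => x ⟨N, G⟩)
    fun G _ => h0 _).symm.trans ?_
  rw [hx.sum_eq h1 hN, ENNReal.ofReal_one]

theorem integral_densityLaw {x : Flag σ → ℝ} (h0 : ∀ F, 0 ≤ x F) (N : ℕ) {f : Cube σ → ℝ}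
    (hf : Continuous f) :
    ∫ y, f y ∂densityLaw x N = ∑ G : FlagOfSize σ N, x ⟨N, G⟩ * f (densityPoint G.rep) := by
  rw [densityLaw, integral_finsetSum_measure]
  · refine Finset.sum_congr rfl fun G _ => ?_
    rw [integral_smul_measure, integral_dirac, smul_eq_mul]
    exact congrArg (· * _) (ENNReal.toReal_ofReal (h0 _))
  · intro G _
    exact (integrable_dirac' hf.measurable.stronglyMeasurable (by simp)).smul_measure
      ENNReal.ofReal_ne_top

/-- A normalized nonnegative functional satisfying the averaging relations is the expectation
of a random homomorphism. -/
theorem exists_randomHom {x : Flag σ → ℝ} (h0 : ∀ F, 0 ≤ x F)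
    (h1 : x ⟨k, unitFlag σ⟩ = 1) (hx : IsAveraging x) :
    ∃ P : Measure (HomPlus σ), IsProbabilityMeasure P ∧ ∀ F, ∫ ψ, ψ.values F ∂P = x F := by
  -- Sizes start at k, where the flags of each size carry total mass 1. Probability measures on the
  -- compact cube form a compact space, so the laws converge along an ultrafilter.
  let P : ℕ → ProbabilityMeasure (Cube σ) := fun N =>
    ⟨densityLaw x (k + N), isProbabilityMeasure_densityLaw h0 h1 hx (Nat.le_add_right k N)⟩
  let 𝒰 : Ultrafilter ℕ := hyperfilter ℕ
  have h𝒰 : (𝒰 : Filter ℕ) ≤ atTop := Nat.hyperfilter_le_atTop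
  obtain ⟨Q, -, hQ⟩ := isCompact_univ.ultrafilter_le_nhds (𝒰.map P) (by simp)
  have hlim : ∀ f : Cube σ → ℝ, Continuous f → Tendsto
      (fun N => ∑ G : FlagOfSize σ (k + N), x ⟨k + N, G⟩ * f (densityPoint G.rep)) 𝒰
      (𝓝 (∫ y, f y ∂(Q : Measure (Cube σ)))) := by
    intro f hf
    have := (ProbabilityMeasure.tendsto_iff_forall_integral_tendsto.mp (show Tendsto P 𝒰 (𝓝 Q)
      from hQ)) (BoundedContinuousFunction.mkOfCompact ⟨f, hf⟩)
    refine this.congr fun N => ?_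
    exact integral_densityLaw h0 (k + N) hf
  have htop : Tendsto (fun N => k + N) (𝒰 : Filter ℕ) atTop :=
    (tendsto_atTop_mono (fun N => Nat.le_add_left N k) tendsto_id).mono_left h𝒰
  -- By averaging, the mean density of F equals x F at every size at least |F|, so the limit has the
  -- same mean.
  have hflag : ∀ F : Flag σ, ∫ y, (y F : ℝ) ∂(Q : Measure (Cube σ)) = x F := by
    intro F
    refine tendsto_nhds_unique (hlim (fun y => y F)
      (continuous_subtype_val.comp (continuous_apply F))) ?_
    refine tendsto_const_nhds.congr' ?_
    filter_upwards [htop.eventually (eventually_ge_atTop F.1)] with N hN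
    rw [show x F = x ⟨F.1, F.2⟩ from rfl, hx F.1 (k + N) F.2 hN]
    exact Finset.sum_congr rfl fun G _ => mul_comm _ _
  -- The mean of |p| under the N-th law is at most the relation error, which tends to 0. A
  -- nonnegative function with integral 0 vanishes almost everywhere.
  have hrel : ∀ p, Relation σ p → ∀ᵐ y ∂(Q : Measure (Cube σ)),
      MvPolynomial.eval (Cube.val y) p = 0 := by
    intro p hp
    obtain ⟨ε, hε, hle⟩ := exists_relation_error hp
    have hc : Continuous fun y : Cube σ => |MvPolynomial.eval y.val p| :=
      (Cube.continuous_eval p).abs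
    have hint : Integrable (fun y : Cube σ => |MvPolynomial.eval y.val p|)
        (Q : Measure (Cube σ)) :=
      (BoundedContinuousFunction.mkOfCompact ⟨_, hc⟩).integrable _
    have hzero : ∫ y, |MvPolynomial.eval (Cube.val y) p| ∂(Q : Measure (Cube σ)) = 0 := by
      refine le_antisymm ?_ (integral_nonneg fun _ => abs_nonneg _)
      refine le_of_tendsto_of_tendsto (hlim _ hc) (hε.comp htop) ?_
      filter_upwards [htop.eventually hle] with N hN
      calc ∑ G : FlagOfSize σ (k + N), x ⟨k + N, G⟩ *
            |MvPolynomial.eval (densityPoint G.rep).val p|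
          ≤ ∑ G : FlagOfSize σ (k + N), x ⟨k + N, G⟩ * ε (k + N) :=
            Finset.sum_le_sum fun G _ => mul_le_mul_of_nonneg_left (hN G.rep) (h0 _)
        _ = ε (k + N) := by
            rw [← Finset.sum_mul, hx.sum_eq h1 (Nat.le_add_right k N), one_mul]
    rw [integral_eq_zero_iff_of_nonneg (fun _ => abs_nonneg _) hint] at hzero
    filter_upwards [hzero] with y hy
    simpa using hy
  have hrange : ∀ᵐ y ∂(Q : Measure (Cube σ)), y ∈ Set.range (HomPlus.point (σ := σ)) := by
    rw [HomPlus.range_point]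
    have := (ae_ball_iff countable_relation).mpr hrel
    filter_upwards [this] with y hy
    simpa using hy
  have hmap : ((Q : Measure (Cube σ)).comap HomPlus.point).map HomPlus.point =
      (Q : Measure (Cube σ)) := by
    rw [HomPlus.measurableEmbedding_point.map_comap, Measure.restrict_eq_self_of_ae_mem hrange]
  refine ⟨(Q : Measure (Cube σ)).comap HomPlus.point, ⟨?_⟩, fun F => ?_⟩
  · have := congrArg (fun μ : Measure (Cube σ) => μ Set.univ) hmap
    simp only [measure_univ] at this
    rwa [Measure.map_apply HomPlus.measurable_point MeasurableSet.univ, Set.preimage_univ] at this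
  · rw [← hflag F]
    conv_rhs => rw [← hmap]
    rw [HomPlus.measurableEmbedding_point.integral_map]
    rfl

/-! ### The random tournament of an averaging functional -/

/-- The empty labelling. -/
def noLabels (V : Type) : Fin 0 ↪ V := Function.Embedding.ofIsEmpty

/-- The expectation of `g` over the random tournament on `V` sampled from a random tournament
on `N` vertices with distribution `x`. -/
def sampleMean {V : Type} [Finite V] (x : Flag emptyType → ℝ) (N : ℕ) (g : Tournament V → ℝ) : ℝ :=
  ∑ T : FlagOfSize emptyType N, x ⟨N, T⟩ * T.rep.avgOn (noLabels V) g

/-- The expectation of `g` over the random tournament on `V` with distribution `x`. -/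
def expect {V : Type} [Finite V] (x : Flag emptyType → ℝ) (g : Tournament V → ℝ) : ℝ :=
  sampleMean x (Nat.card V) g

section
variable {U V W : Type} [Finite U] [Finite V] [Finite W] {x : Flag emptyType → ℝ}

/-- Consistency of the family: by the chain rule and averaging, the size of the tournament sampled
from does not matter. -/
theorem sampleMean_eq (hx : IsAveraging x) {N : ℕ} (hN : Nat.card V ≤ N) (g : Tournament V → ℝ) :
    sampleMean x N g = expect x g := by
  calc ∑ T : FlagOfSize emptyType N, x ⟨N, T⟩ * T.rep.avgOn (noLabels V) g
      = ∑ T : FlagOfSize emptyType N, ∑ S : FlagOfSize emptyType (Nat.card V),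
          x ⟨N, T⟩ * (S.rep.avgOn (noLabels V) g * density S T.rep) := by
        refine Finset.sum_congr rfl fun T _ => ?_
        rw [← Finset.mul_sum, sum_avgOn_mul_density T.rep (noLabels V) g le_rfl (by simpa using hN)]
    _ = ∑ S : FlagOfSize emptyType (Nat.card V),
          x ⟨Nat.card V, S⟩ * S.rep.avgOn (noLabels V) g := by
        rw [Finset.sum_comm]
        refine Finset.sum_congr rfl fun S _ => ?_
        rw [hx _ N S hN, Finset.sum_mul]
        exact Finset.sum_congr rfl fun T _ => by ring

/-- Compute both sides by sampling from |W| vertices, where a uniform embedding of W restricts to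
one of V. With V = W this is exchangeability. -/
theorem expect_comap (hx : IsAveraging x) (κ : V ↪ W) (g : Tournament V → ℝ) :
    expect x (fun T : Tournament W => g (T.comap κ)) = expect x g := by
  rw [← sampleMean_eq hx (Finite.card_le_of_embedding κ) g]
  refine Finset.sum_congr rfl fun T _ => congrArg _ ?_
  exact avg_rel_comp (by simp)
    (⟨κ, fun i => i.elim0⟩ : Rel (noLabels V) (noLabels W))
    (fun θ : Rel (noLabels V) T.rep.label => g (T.rep.tour.comap θ.1))

theorem expect_add (f g : Tournament V → ℝ) :
    expect x (fun T => f T + g T) = expect x f + expect x g := by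
  simp only [expect, sampleMean, LabelledTournament.avgOn, avg_add, mul_add,
    Finset.sum_add_distrib]

theorem expect_const_mul (c : ℝ) (f : Tournament V → ℝ) :
    expect x (fun T => c * f T) = c * expect x f := by
  simp only [expect, sampleMean, LabelledTournament.avgOn, avg_const_mul, Finset.mul_sum]
  exact Finset.sum_congr rfl fun T _ => by ring

theorem expect_neg (f : Tournament V → ℝ) : expect x (fun T => -f T) = -expect x f := by
  have := expect_const_mul (x := x) (-1) f
  simpa using this

theorem expect_sub (f g : Tournament V → ℝ) :
    expect x (fun T => f T - g T) = expect x f - expect x g := by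
  simp only [sub_eq_add_neg, expect_add, expect_neg]

theorem expect_sum {ι : Type*} (s : Finset ι) (f : ι → Tournament V → ℝ) :
    expect x (fun T => ∑ i ∈ s, f i T) = ∑ i ∈ s, expect x (f i) := by
  simp only [expect, sampleMean, LabelledTournament.avgOn, avg_sum, Finset.mul_sum]
  exact Finset.sum_comm

theorem expect_avg {α : Type*} [Finite α] (f : α → Tournament V → ℝ) :
    expect x (fun T => avg (fun a => f a T)) = avg (fun a => expect x (f a)) := by
  let _ := Fintype.ofFinite α
  simp only [avg_eq (α := α), div_eq_inv_mul, expect_const_mul, expect_sum]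

theorem expect_nonneg (h0 : ∀ F, 0 ≤ x F) {g : Tournament V → ℝ} (hg : ∀ T, 0 ≤ g T) :
    0 ≤ expect x g :=
  Finset.sum_nonneg fun _ _ => mul_nonneg (h0 _) (avg_nonneg fun _ => hg _)

theorem expect_mono (h0 : ∀ F, 0 ≤ x F) {f g : Tournament V → ℝ} (h : ∀ T, f T ≤ g T) :
    expect x f ≤ expect x g := by
  rw [← sub_nonneg, ← expect_sub]
  exact expect_nonneg h0 fun T => sub_nonneg.mpr (h T)

theorem expect_const (hx : IsAveraging x) (h1 : x ⟨0, unitFlag emptyType⟩ = 1) (c : ℝ) :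
    expect x (fun _ : Tournament V => c) = c := by
  have h : ∀ T : FlagOfSize emptyType (Nat.card V),
      T.rep.avgOn (noLabels V) (fun _ => c) = c := fun T => by
    have := Rel.nonempty (noLabels V) T.rep.label (by simp)
    exact avg_const c
  simp only [expect, sampleMean, h]
  rw [← Finset.sum_mul, hx.sum_eq h1 (Nat.zero_le _), one_mul]

/-- The labels `ℓ` span a copy of the type `σ` in `T`. -/
def IsType (σ : Tournament (Fin k)) (ℓ : Fin k ↪ V) (T : Tournament V) : Prop :=
  ∀ i j, T.Beats (ℓ i) (ℓ j) ↔ σ.Beats i j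

omit [Finite V] [Finite W] in
theorem ind_comap_equiv {n : ℕ} (F : FlagOfSize σ n) (e : V ≃ W) (ℓ : Fin k ↪ V)
    (T : Tournament W) : Ind F ℓ (T.comap e.toEmbedding) ↔ Ind F (ℓ.trans e.toEmbedding) T := by
  refine exists_congr fun h => ?_
  have hiso : (⟨T.comap e.toEmbedding, ℓ, h⟩ : LabelledTournament σ V).Isomorphic
      (⟨T, ℓ.trans e.toEmbedding, h⟩ : LabelledTournament σ W) :=
    ⟨e, fun u v => Iff.rfl, fun i => rfl⟩
  exact ⟨fun h' => hiso.symm.trans h', fun h' => hiso.trans h'⟩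

/-- The downward operator in terms of random tournaments. -/
theorem labellingProb_mul_eq_expect (hx : IsAveraging x) {n : ℕ} (F : FlagOfSize σ n)
    (ℓ : Fin k ↪ V) (hV : Nat.card V = n) :
    labellingProb F * x ⟨n, F.rep.unlabel.toFlag⟩ =
      expect x (fun T : Tournament V => ind (Ind F ℓ T)) := by
  rw [← sampleMean_eq hx hV.le]
  -- As |V| = n, embeddings of V are bijections, and only the position of the labels affects the
  -- indicator.
  have havg : ∀ T : FlagOfSize emptyType n,
      T.rep.avgOn (noLabels V) (fun T : Tournament V => ind (Ind F ℓ T)) =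
        avg (fun θ : Fin k ↪ Fin n => ind (Ind F θ T.rep.tour)) := by
    intro T
    let e : Rel (noLabels (Fin k)) T.rep.label ≃ (Fin k ↪ Fin n) :=
      ⟨fun θ => θ.1, fun θ => ⟨θ, fun i => i.elim0⟩, fun _ => rfl, fun _ => rfl⟩
    rw [← avg_equiv e, ← avg_rel_comp (κ := noLabels V) (by simp [hV])
      (⟨ℓ, fun i => i.elim0⟩ : Rel (noLabels (Fin k)) (noLabels V))]
    refine congrArg avg (funext fun η => congrArg ind (propext ?_))
    have hbij : Function.Bijective η.1 :=
      η.1.injective.bijective_of_nat_card_le (by simp [hV])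
    exact ind_comap_equiv F (Equiv.ofBijective η.1 hbij) ℓ T.rep.tour
  have hmain : (F.rep.unlabel.toFlag).rep.avgOn (noLabels V)
      (fun T : Tournament V => ind (Ind F ℓ T)) = labellingProb F := by
    obtain ⟨e, he, -⟩ := ((FlagOfSize.rep_isomorphic_iff F.rep.unlabel _).mpr rfl)
    rw [havg, labellingProb, ← avg_ind]
    let E : (Fin k ↪ Fin n) ≃ (Fin k ↪ Fin n) := Equiv.embeddingCongr (Equiv.refl _) e
    rw [← avg_equiv E]
    refine congrArg avg (funext fun θ => congrArg ind (propext ?_))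
    change Ind F (θ.trans e.toEmbedding) _ ↔ Ind F θ F.rep.tour
    rw [← ind_comap_equiv]
    have : F.rep.unlabel.toFlag.rep.tour.comap e.toEmbedding = F.rep.tour :=
      Tournament.ext fun u v => (he u v).symm
    rw [this]
  rw [sampleMean, Finset.sum_eq_single F.rep.unlabel.toFlag, hmain, mul_comm]
  · intro T _ hT
    rw [havg]
    refine mul_eq_zero_of_right _ ?_
    have h : ∀ θ : Fin k ↪ Fin n, ind (Ind F θ T.rep.tour) = 0 := by
      refine fun θ => ind_false fun ⟨h, e, he, _⟩ => hT ?_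
      have hiso : F.rep.unlabel.Isomorphic T.rep :=
        Isomorphic.symm ⟨e, he, fun i => i.elim0⟩
      exact (FlagOfSize.rep_isomorphic_iff _ _).mp hiso
    simp [h, avg]
  · simp

/-- If κ spans a copy of σ in T, exactly one flag G is induced and contributes the average of g;
otherwise both sides vanish. -/
theorem sum_avgOn_mul_ind {N : ℕ} (κ : Fin k ↪ W) (hW : Nat.card W = N)
    (ι : Fin k ↪ V) (g : Tournament V → ℝ) (T : Tournament W) :
    ∑ G : FlagOfSize σ N, G.rep.avgOn ι g * ind (Ind G κ T) =
      avg (fun η : Rel ι κ => ind (IsType σ ι (T.comap η.1)) * g (T.comap η.1)) := by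
  have hι : ∀ η : Rel ι κ, IsType σ ι (T.comap η.1) ↔ IsType σ κ T := fun η => by
    refine forall_congr' fun i => forall_congr' fun j => ?_
    change (T.Beats (η.1 (ι i)) (η.1 (ι j)) ↔ _) ↔ _
    rw [η.2, η.2]
  simp only [hι]
  by_cases h : IsType σ κ T
  · simp only [ind_true h, one_mul]
    have hI : ∀ G : FlagOfSize σ N, Ind G κ T ↔
        (⟨T, κ, h⟩ : LabelledTournament σ W).Isomorphic G.rep :=
      fun G => ⟨fun ⟨_, h'⟩ => h', fun h' => ⟨h, h'⟩⟩
    simp only [hI]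
    exact sum_ind_isomorphic hW (⟨T, κ, h⟩ : LabelledTournament σ W)
      (fun G => G.rep.avgOn ι g) _ fun F hF => (avgOn_congr hF ι g).symm
  · simp only [ind_false h, zero_mul]
    have hI : ∀ G : FlagOfSize σ N, ¬ Ind G κ T := fun G ⟨h', _⟩ => h h'
    simp [ind_false (hI _), avg]

theorem sum_avgOn_mul_expect (hx : IsAveraging x) {N : ℕ} (κ : Fin k ↪ W) (hW : Nat.card W = N)
    (ι : Fin k ↪ V) (hV : Nat.card V ≤ N) (g : Tournament V → ℝ) :
    ∑ G : FlagOfSize σ N, G.rep.avgOn ι g * expect x (fun T : Tournament W => ind (Ind G κ T)) =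
      expect x (fun T : Tournament V => ind (IsType σ ι T) * g T) := by
  have hne := Rel.nonempty ι κ (by rw [hW]; exact hV)
  simp only [← expect_const_mul]
  rw [← expect_sum]
  simp only [sum_avgOn_mul_ind κ hW ι g]
  rw [expect_avg]
  have : ∀ η : Rel ι κ, expect x (fun T : Tournament W =>
      ind (IsType σ ι (T.comap η.1)) * g (T.comap η.1)) =
      expect x (fun T : Tournament V => ind (IsType σ ι T) * g T) := fun η =>
    expect_comap hx η.1 fun T : Tournament V => ind (IsType σ ι T) * g T
  simp only [this]
  exact avg_const _

end

/-! ### Signs of arcs -/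

/-- The sign of the arc between `u` and `v`: `1` if `u` beats `v`, `-1` if `v` beats `u`. -/
def Tournament.sgn {V : Type} (T : Tournament V) (u v : V) : ℝ :=
  ind (T.Beats u v) - ind (T.Beats v u)

section
variable {V W : Type}

theorem Tournament.sgn_swap (T : Tournament V) (u v : V) : T.sgn v u = -T.sgn u v := by
  unfold Tournament.sgn; ring

theorem Tournament.sgn_comap (T : Tournament W) (κ : V ↪ W) (u v : V) :
    (T.comap κ).sgn u v = T.sgn (κ u) (κ v) := rfl

theorem Tournament.sgn_of_beats {T : Tournament V} {u v : V} (h : T.Beats u v) :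
    T.sgn u v = 1 := by
  rw [Tournament.sgn, ind_true h, ind_false (T.asymm u v h), sub_zero]

theorem Tournament.sgn_of_beats' {T : Tournament V} {u v : V} (h : T.Beats v u) :
    T.sgn u v = -1 := by
  rw [Tournament.sgn_swap, Tournament.sgn_of_beats h]

theorem Tournament.ind_beats (T : Tournament V) {u v : V} (h : u ≠ v) :
    ind (T.Beats u v) = (1 + T.sgn u v) / 2 := by
  rcases T.total u v h with h | h
  · rw [Tournament.sgn_of_beats h, ind_true h]; norm_num
  · rw [Tournament.sgn_of_beats' h, ind_false (T.asymm _ _ h)]; norm_num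

theorem Tournament.abs_sgn_le_one (T : Tournament V) (u v : V) : |T.sgn u v| ≤ 1 := by
  rw [Tournament.sgn, abs_le]
  have := ind_nonneg (T.Beats u v)
  have := ind_nonneg (T.Beats v u)
  have := ind_le_one (T.Beats u v)
  have := ind_le_one (T.Beats v u)
  constructor <;> linarith

theorem Tournament.abs_prod_sgn_le_one (T : Tournament V) {ι : Type*} (s : Finset ι)
    (a b : ι → V) : |∏ i ∈ s, T.sgn (a i) (b i)| ≤ 1 := by
  rw [Finset.abs_prod]
  exact Finset.prod_le_one (fun _ _ => abs_nonneg _) fun i _ => T.abs_sgn_le_one _ _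

/-- The tournament obtained by adding a vertex that is beaten exactly by the vertices in `B`. -/
def Tournament.addVertex (T : Tournament V) (B : Finset V) : Tournament (Option V) where
  Beats
    | some u, some v => T.Beats u v
    | some u, none => u ∈ B
    | none, some v => v ∉ B
    | none, none => False
  asymm u v := by
    rcases u with _ | u <;> rcases v with _ | v <;> simp only [not_not, imp_self,
      IsEmpty.forall_iff]
    · exact T.asymm u v
  total u v h := by
    rcases u with _ | u <;> rcases v with _ | v
    · exact absurd rfl h
    · exact (em' (v ∈ B))
    · exact em (u ∈ B)
    · exact T.total u v fun h' => h (congrArg some h')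

/-- The sign of a vertex relative to a set. -/
def memSign (B : Finset V) (w : V) : ℝ := ind (w ∈ B) - ind (w ∉ B)

/-- Each factor is the 0/1 indicator that one arc at the new vertex has the direction prescribed by
B. -/
theorem ind_beatsSet_eq [Fintype V] (T : Tournament (Option V)) (B : Finset V) :
    ind (∀ w, T.Beats (some w) none ↔ w ∈ B) =
      ∏ w, ((1 : ℝ) + memSign B w * T.sgn (some w) none) / 2 := by
  classical
  have key : ∀ w, ((1 : ℝ) + memSign B w * T.sgn (some w) none) / 2 =
      ind (T.Beats (some w) none ↔ w ∈ B) := by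
    intro w
    rcases T.total (some w) none (by simp) with h | h
    · by_cases hw : w ∈ B
      · rw [Tournament.sgn_of_beats h, memSign, ind_true hw, ind_false (not_not.mpr hw),
          ind_true (by simp [h, hw])]
        norm_num
      · rw [Tournament.sgn_of_beats h, memSign, ind_false hw, ind_true hw,
          ind_false (by simp [h, hw])]
        norm_num
    · have h' := T.asymm _ _ h
      by_cases hw : w ∈ B
      · rw [Tournament.sgn_of_beats' h, memSign, ind_true hw, ind_false (not_not.mpr hw),
          ind_false (by simp [h', hw])]
        norm_num
      · rw [Tournament.sgn_of_beats' h, memSign, ind_false hw, ind_true hw,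
          ind_true (by simp [h', hw])]
        norm_num
  simp only [key]
  by_cases h : ∀ w, T.Beats (some w) none ↔ w ∈ B
  · rw [ind_true h]
    exact (Finset.prod_eq_one fun w _ => ind_true (h w)).symm
  · rw [ind_false h]
    obtain ⟨w, hw⟩ := not_forall.mp h
    exact (Finset.prod_eq_zero (Finset.mem_univ w) (ind_false hw)).symm

/-- Every function of a tournament is a combination of products of the signs at a vertex, with
coefficients depending on the rest of the tournament. -/
theorem exists_sgn_expansion [Fintype V] (g : Tournament (Option V) → ℝ) :
    ∃ c : Finset V → Tournament V → ℝ, ∀ T : Tournament (Option V),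
      g T = ∑ A : Finset V, (∏ w ∈ A, T.sgn (some w) none) *
        c A (T.comap Function.Embedding.some) := by
  classical
  -- These are the Fourier coefficients in the signs at `none`: write g as a sum over the possible
  -- sets B of vertices beating `none`, expand each indicator into sign products, and collect the
  -- terms of A.
  refine ⟨fun A S => ∑ B : Finset V, (∏ w ∈ A, memSign B w) * (1 / 2) ^ Fintype.card V *
    g (S.addVertex B), fun T => ?_⟩
  have h1 : g T = ∑ B : Finset V, ind (∀ w, T.Beats (some w) none ↔ w ∈ B) *
      g ((T.comap Function.Embedding.some).addVertex B) := by
    rw [Finset.sum_eq_single (Finset.univ.filter fun w => T.Beats (some w) none)]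
    · rw [ind_true (by simp), one_mul]
      congr 1
      refine Tournament.ext fun u v => ?_
      rcases u with _ | u <;> rcases v with _ | v
      · exact iff_of_false (T.irrefl _) id
      · simp only [Tournament.addVertex, Finset.mem_filter, Finset.mem_univ, true_and]
        exact ⟨T.asymm _ _, fun h => (T.total _ _ (by simp)).resolve_right h⟩
      · simp [Tournament.addVertex]
      · rfl
    · intro B _ hB
      rw [ind_false, zero_mul]
      intro h
      exact hB (Finset.ext fun w => by simp [h])
    · simp
  rw [h1]
  simp only [ind_beatsSet_eq, Finset.mul_sum]
  rw [Finset.sum_comm]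
  refine Finset.sum_congr rfl fun B _ => ?_
  rw [Finset.prod_div_distrib, Finset.prod_const, Finset.card_univ, Finset.prod_one_add,
    Finset.powerset_univ, div_eq_mul_inv, Finset.sum_mul, Finset.sum_mul]
  refine Finset.sum_congr rfl fun A _ => ?_
  rw [Finset.prod_mul_distrib, one_div, inv_pow]
  ring

end

/-! ### Quasirandomness -/

/-- The random tournament with distribution `x` has independent unbiased arcs. -/
def Uniform (x : Flag emptyType → ℝ) : Prop :=
  ∀ (V : Type) [Finite V] (A : Finset V) (_ : A.Nonempty) (b : Tournament V → ℝ),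
    expect x (fun T : Tournament (Option V) => (∏ w ∈ A, T.sgn (some w) none) *
      b (T.comap Function.Embedding.some)) = 0

/-- In the random tournament with distribution `x`, conditionally on the rest, a new vertex closes
a directed triangle with every given arc with probability `1/4`. -/
def Balanced (x : Flag emptyType → ℝ) : Prop :=
  ∀ (V : Type) [Finite V] (u v : V) (_ : u ≠ v) (g : Tournament V → ℝ),
    expect x (fun T : Tournament (Option V) => ind (T.Beats (some u) (some v)) *
      (ind (T.Beats (some v) none) * ind (T.Beats none (some u)) - 1 / 4) *
      g (T.comap Function.Embedding.some)) = 0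

section
variable {V W : Type} [Finite V] [Finite W] {x y : Flag emptyType → ℝ}

theorem expect_expansion [Fintype W] (c : Finset W → Tournament W → ℝ)
    (hx : IsAveraging x) (hxu : Uniform x) :
    expect x (fun T : Tournament (Option W) => ∑ A : Finset W,
      (∏ w ∈ A, T.sgn (some w) none) * c A (T.comap Function.Embedding.some)) =
      expect x (c ∅) := by
  rw [expect_sum, Finset.sum_eq_single ∅]
  · simp only [Finset.prod_empty, one_mul]
    exact expect_comap hx Function.Embedding.some (c ∅)
  · intro A _ hA
    exact hxu W A (Finset.nonempty_iff_ne_empty.mpr hA) (c A)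
  · simp

/-- Expanding in signs at one vertex leaves only the term of the empty set, a function on one vertex
fewer; induction ends at the empty tournament. -/
theorem expect_eq_of_uniform (hx : IsAveraging x) (hx1 : x ⟨0, unitFlag emptyType⟩ = 1)
    (hxu : Uniform x) (hy : IsAveraging y) (hy1 : y ⟨0, unitFlag emptyType⟩ = 1)
    (hyu : Uniform y) (g : Tournament V → ℝ) : expect x g = expect y g := by
  suffices h : ∀ (V : Type) [Finite V], ∀ [Finite V] (g : Tournament V → ℝ),
      expect x g = expect y g from h V g
  intro V _
  refine Finite.induction_empty_option (P := fun V => ∀ [Finite V] (g : Tournament V → ℝ),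
    expect x g = expect y g) ?_ ?_ ?_ V
  · intro V₁ V₂ e ih _ g
    have := Finite.of_equiv V₂ e.symm
    rw [← expect_comap hx e.symm.toEmbedding g, ← expect_comap hy e.symm.toEmbedding g]
    exact ih _
  · intro _ g
    have hg : ∀ T S : Tournament PEmpty, T = S := fun T S => Tournament.ext fun u => u.elim
    let T₀ : Tournament PEmpty := ⟨fun u => u.elim, fun u => u.elim, fun u => u.elim⟩
    have : g = fun _ => g T₀ := funext fun T => by rw [hg T T₀]
    rw [this, expect_const hx hx1, expect_const hy hy1]
  · intro W _ ih _ g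
    obtain ⟨c, hc⟩ := exists_sgn_expansion g
    rw [funext hc, expect_expansion c hx hxu, expect_expansion c hy hyu]
    exact ih _

/-- The Cauchy-Schwarz inequality. -/
theorem expect_mul_sq_le (h0 : ∀ F, 0 ≤ x F) (f g : Tournament V → ℝ) :
    expect x (fun T => f T * g T) ^ 2 ≤
      expect x (fun T => f T * f T) * expect x (fun T => g T * g T) := by
  -- The quadratic E[(t f + g)²] in t is nonnegative, so its discriminant is at most 0.
  have h : ∀ t : ℝ, 0 ≤ expect x (fun T => f T * f T) * (t * t) +
      2 * expect x (fun T => f T * g T) * t + expect x (fun T => g T * g T) := by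
    intro t
    have h1 : 0 ≤ expect x (fun T => (t * f T + g T) * (t * f T + g T)) :=
      expect_nonneg h0 fun T => mul_self_nonneg _
    have h2 : (fun T => (t * f T + g T) * (t * f T + g T)) = fun T : Tournament V =>
        (t * t) * (f T * f T) + ((2 * t) * (f T * g T) + g T * g T) := funext fun T => by ring
    rw [h2, expect_add, expect_add, expect_const_mul, expect_const_mul] at h1
    linarith
  have := discrim_le_zero h
  rw [discrim] at this
  nlinarith

/-- The embedding of `Option V` that sends the new vertex to `j`. -/
def newVertex (N : ℕ) (j : Fin N) : Option V ↪ V ⊕ Fin N where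
  toFun
    | some v => Sum.inl v
    | none => Sum.inr j
  inj' a b h := by rcases a with _ | a <;> rcases b with _ | b <;> simp_all

/-- The embedding of `V` with two additional vertices sending them to `i` and `j`. -/
def newVertices (N : ℕ) {i j : Fin N} (hij : i ≠ j) : Option (Option V) ↪ V ⊕ Fin N where
  toFun
    | some (some v) => Sum.inl v
    | some none => Sum.inr j
    | none => Sum.inr i
  inj' a b h := by
    rcases a with _ | _ | a <;> rcases b with _ | _ | b <;> simp_all [eq_comm]

/-- Let F be the sum of f over N copies of the new vertex. By `hf` distinct copies are uncorrelated,
so E[F²] ≤ N, while E[F h] = N e. Cauchy-Schwarz gives N e² ≤ E[h²] for every N, hence e = 0. -/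
theorem expect_eq_zero_of_copies (hx : IsAveraging x) (hx1 : x ⟨0, unitFlag emptyType⟩ = 1)
    (h0 : ∀ F, 0 ≤ x F) (f : Tournament (Option V) → ℝ) (hf1 : ∀ T, |f T| ≤ 1)
    (hf : expect x (fun T : Tournament (Option (Option V)) =>
      f (T.comap Function.Embedding.some.optionMap) * f (T.comap Function.Embedding.some)) = 0)
    (h : Tournament V → ℝ) :
    expect x (fun T : Tournament (Option V) => f T * h (T.comap Function.Embedding.some)) = 0 := by
  set e := expect x (fun T : Tournament (Option V) =>
    f T * h (T.comap Function.Embedding.some)) with he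
  set M := expect x (fun T : Tournament V => h T * h T) with hM
  have key : ∀ N : ℕ, N * e ^ 2 ≤ M := by
    intro N
    rcases Nat.eq_zero_or_pos N with rfl | hN
    · simpa using expect_nonneg h0 fun T => mul_self_nonneg (h T)
    let F : Tournament (V ⊕ Fin N) → ℝ := fun T => ∑ j : Fin N, f (T.comap (newVertex N j))
    let H : Tournament (V ⊕ Fin N) → ℝ := fun T => h (T.comap Function.Embedding.inl)
    have h1 : expect x (fun T => F T * H T) = N * e := by
      simp only [F, Finset.sum_mul, expect_sum]
      rw [Finset.sum_congr rfl (g := fun _ => e)]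
      · simp
      · intro j _
        exact expect_comap hx (newVertex N j) fun T : Tournament (Option V) =>
          f T * h (T.comap Function.Embedding.some)
    have h2 : expect x (fun T => H T * H T) = M :=
      expect_comap hx Function.Embedding.inl fun T : Tournament V => h T * h T
    have h3 : expect x (fun T => F T * F T) ≤ N := by
      simp only [F, Finset.sum_mul_sum, expect_sum]
      calc ∑ i : Fin N, ∑ j : Fin N, expect x (fun T : Tournament (V ⊕ Fin N) =>
            f (T.comap (newVertex N i)) * f (T.comap (newVertex N j)))
          ≤ ∑ i : Fin N, ∑ j : Fin N, if i = j then (1 : ℝ) else 0 := by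
            refine Finset.sum_le_sum fun i _ => Finset.sum_le_sum fun j _ => ?_
            split_ifs with hij
            · subst hij
              calc _ ≤ expect x (fun _ : Tournament (V ⊕ Fin N) => (1 : ℝ)) := by
                    refine expect_mono h0 fun T => ?_
                    rw [← abs_mul_abs_self]
                    exact mul_le_one₀ (hf1 _) (abs_nonneg _) (hf1 _)
                _ = 1 := expect_const hx hx1 1
            · refine le_of_eq ?_
              rw [← hf]
              have e₁ : Function.Embedding.some.optionMap.trans (newVertices (V := V) N hij) =
                  newVertex N i := by
                ext a
                rcases a with _ | a <;> rfl
              have e₂ : Function.Embedding.some.trans (newVertices (V := V) N hij) =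
                  newVertex N j := by
                ext a
                rcases a with _ | a <;> rfl
              rw [← e₁, ← e₂]
              exact expect_comap hx (newVertices N hij)
                fun T : Tournament (Option (Option V)) =>
                  f (T.comap Function.Embedding.some.optionMap) *
                    f (T.comap Function.Embedding.some)
        _ = N := by simp
    have h4 := expect_mul_sq_le h0 F H
    rw [h1, h2] at h4
    have hM0 : 0 ≤ M := expect_nonneg h0 fun T => mul_self_nonneg (h T)
    have h5 : (N : ℝ) * (N * e ^ 2) ≤ N * M := by
      calc (N : ℝ) * (N * e ^ 2) = (N * e) ^ 2 := by ring
        _ ≤ _ := h4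
        _ ≤ N * M := mul_le_mul_of_nonneg_right h3 hM0
    exact le_of_mul_le_mul_left h5 (by exact_mod_cast hN)
  by_contra hne
  have hpos : 0 < e ^ 2 := by positivity
  obtain ⟨N, hN⟩ := exists_nat_gt (M / e ^ 2)
  have := key N
  rw [div_lt_iff₀ hpos] at hN
  linarith

/-- The embedding of three distinct vertices. -/
def tripleEmb (a b c : V) (hab : a ≠ b) (hac : a ≠ c) (hbc : b ≠ c) : Fin 3 ↪ V where
  toFun := ![a, b, c]
  inj' i j h := by fin_cases i <;> fin_cases j <;> simp_all

theorem expect_cherry (hx : IsAveraging x) {a b c : V} (hab : a ≠ b) (hac : a ≠ c) (hbc : b ≠ c) :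
    expect x (fun T : Tournament V => T.sgn a b * T.sgn a c) =
      expect x (fun T : Tournament (Fin 3) => T.sgn 0 1 * T.sgn 0 2) :=
  expect_comap hx (tripleEmb a b c hab hac hbc)
    fun T : Tournament (Fin 3) => T.sgn 0 1 * T.sgn 0 2

/-- In signs, the balance condition concerns (1 + s(u,v))(s(v,w) + s(w,u) + s(v,w)s(w,u)) / 8.
Adding the one with u and v exchanged cancels the products of one or three signs and doubles those
of two. -/
theorem Balanced.expect_sum_eq_zero (h : Balanced x) {u v : V} (huv : u ≠ v)
    (g : Tournament V → ℝ) :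
    expect x (fun T : Tournament (Option V) =>
      (T.sgn (some v) none * T.sgn none (some u) + T.sgn (some u) (some v) * T.sgn (some v) none +
        T.sgn (some u) (some v) * T.sgn none (some u)) *
      g (T.comap Function.Embedding.some)) = 0 := by
  have h1 := h V u v huv g
  have h2 := h V v u huv.symm g
  have h3 : ∀ T : Tournament (Option V),
      (T.sgn (some v) none * T.sgn none (some u) + T.sgn (some u) (some v) * T.sgn (some v) none +
        T.sgn (some u) (some v) * T.sgn none (some u)) * g (T.comap Function.Embedding.some) =
      4 * (ind (T.Beats (some u) (some v)) *
        (ind (T.Beats (some v) none) * ind (T.Beats none (some u)) - 1 / 4) *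
        g (T.comap Function.Embedding.some)) +
      4 * (ind (T.Beats (some v) (some u)) *
        (ind (T.Beats (some u) none) * ind (T.Beats none (some v)) - 1 / 4) *
        g (T.comap Function.Embedding.some)) := by
    intro T
    have huv' : some u ≠ some v := fun h => huv (Option.some_injective _ h)
    rw [T.ind_beats huv', T.ind_beats huv'.symm, T.ind_beats (Option.some_ne_none v),
      T.ind_beats (Option.some_ne_none u), T.ind_beats (Option.some_ne_none v).symm,
      T.ind_beats (Option.some_ne_none u).symm, T.sgn_swap (some u) (some v),
      T.sgn_swap none (some u), T.sgn_swap (some v) none]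
    ring
  rw [funext h3, expect_add, expect_const_mul, expect_const_mul, h1, h2]
  norm_num

/-- Taking g = 1, the three terms are minus the cherries at the three vertices, which have equal
means by exchangeability. -/
theorem Balanced.expect_cherry_eq_zero (h : Balanced x) (hx : IsAveraging x) :
    expect x (fun T : Tournament (Fin 3) => T.sgn 0 1 * T.sgn 0 2) = 0 := by
  set c := expect x (fun T : Tournament (Fin 3) => T.sgn 0 1 * T.sgn 0 2) with hc
  have h1 := h.expect_sum_eq_zero (u := (0 : Fin 2)) (v := 1) (by decide) (fun _ => 1)
  have h2 : ∀ T : Tournament (Option (Fin 2)),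
      (T.sgn (some 1) none * T.sgn none (some 0) + T.sgn (some 0) (some 1) * T.sgn (some 1) none +
        T.sgn (some 0) (some 1) * T.sgn none (some 0)) * 1 =
      -(T.sgn none (some 0) * T.sgn none (some 1) + (T.sgn (some 1) (some 0) * T.sgn (some 1) none +
        T.sgn (some 0) (some 1) * T.sgn (some 0) none)) := by
    intro T
    rw [T.sgn_swap none (some 1), T.sgn_swap (some 0) (some 1), T.sgn_swap none (some 0)]
    ring
  rw [funext h2, expect_neg, expect_add, expect_add,
    expect_cherry hx (a := none) (b := some (0 : Fin 2)) (c := some 1) (by decide) (by decide)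
      (by decide),
    expect_cherry hx (a := some (1 : Fin 2)) (b := some 0) (c := none) (by decide) (by decide)
      (by decide),
    expect_cherry hx (a := some (0 : Fin 2)) (b := some 1) (c := none) (by decide) (by decide)
      (by decide), ← hc] at h1
  linarith

section
variable (h : Balanced x) (hx : IsAveraging x) (hx1 : x ⟨0, unitFlag emptyType⟩ = 1)
  (h0 : ∀ F, 0 ≤ x F)
include h hx hx1 h0

/-- Two copies of the sign s(u,w) form a cherry at u, of mean zero. -/
theorem Balanced.expect_sgn_mul (u : V) (g : Tournament V → ℝ) :
    expect x (fun T : Tournament (Option V) =>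
      T.sgn (some u) none * g (T.comap Function.Embedding.some)) = 0 := by
  refine expect_eq_zero_of_copies hx hx1 h0 (fun T => T.sgn (some u) none)
    (fun T => T.abs_sgn_le_one _ _) ?_ g
  rw [← h.expect_cherry_eq_zero hx]
  exact expect_cherry hx (a := some (some u)) (b := none) (c := some none) (by simp) (by simp)
    (by simp)

/-- In the three-term identity, two terms have a single sign at the new vertex once s(u,v) is
absorbed into g, so they vanish and the third must vanish too. -/
theorem Balanced.expect_sgn_mul_sgn_mul {u v : V} (huv : u ≠ v) (g : Tournament V → ℝ) :
    expect x (fun T : Tournament (Option V) =>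
      T.sgn (some u) none * T.sgn (some v) none * g (T.comap Function.Embedding.some)) = 0 := by
  have h1 := h.expect_sum_eq_zero huv g
  have h2 := h.expect_sgn_mul hx hx1 h0 u fun T => T.sgn u v * g T
  have h3 := h.expect_sgn_mul hx hx1 h0 v fun T => T.sgn u v * g T
  have h4 : ∀ T : Tournament (Option V),
      T.sgn (some u) none * T.sgn (some v) none * g (T.comap Function.Embedding.some) =
      T.sgn (some v) none * ((T.comap Function.Embedding.some).sgn u v *
        g (T.comap Function.Embedding.some)) -
      T.sgn (some u) none * ((T.comap Function.Embedding.some).sgn u v *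
        g (T.comap Function.Embedding.some)) -
      (T.sgn (some v) none * T.sgn none (some u) + T.sgn (some u) (some v) * T.sgn (some v) none +
        T.sgn (some u) (some v) * T.sgn none (some u)) *
      g (T.comap Function.Embedding.some) := by
    intro T
    rw [T.sgn_swap (some u) none, Tournament.sgn_comap]
    simp only [Function.Embedding.some_apply]
    ring
  rw [funext h4, expect_sub, expect_sub, h1, h2, h3]
  norm_num

theorem Balanced.expect_sgn_mul_sgn_mul_comap {z p q : V} (hp : p ≠ z) (hq : q ≠ z) (hpq : p ≠ q)
    (g : Tournament {w // w ≠ z} → ℝ) :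
    expect x (fun T : Tournament V =>
      T.sgn p z * T.sgn q z * g (T.comap (Function.Embedding.subtype _))) = 0 := by
  classical
  rw [← h.expect_sgn_mul_sgn_mul hx hx1 h0 (u := (⟨p, hp⟩ : {w // w ≠ z})) (v := ⟨q, hq⟩)
    (fun h => hpq (congrArg Subtype.val h)) g,
    ← expect_comap hx (Equiv.optionSubtypeNe z).toEmbedding]
  refine congrArg _ (funext fun T => ?_)
  simp only [Tournament.sgn_comap, Equiv.coe_toEmbedding, Equiv.optionSubtypeNe_some,
    Equiv.optionSubtypeNe_none, Tournament.comap_comap]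
  congr 2

/-- For two copies p, q of the new vertex, the product is that of s(w,p)s(w,q) over w in A. Fix v in
A and let it play the new vertex: only its two signs to p and q involve it, so the two-sign
orthogonality applies. -/
theorem Balanced.uniform : Uniform x := by
  classical
  intro V _ A hA b
  refine expect_eq_zero_of_copies hx hx1 h0 (fun T => ∏ w ∈ A, T.sgn (some w) none)
    (fun T => T.abs_prod_sgn_le_one _ _ _) ?_ b
  obtain ⟨v, hv⟩ := hA
  let z : Option (Option V) := some (some v)
  have hsome : ∀ w, w ≠ v → some (some w) ≠ z := fun w hw h =>
    hw (Option.some_injective _ (Option.some_injective _ h))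
  -- The factors other than that of v live on the tournament without z. The default 1 never occurs
  -- on `A.erase v`.
  let g : Tournament {w // w ≠ z} → ℝ := fun S => ∏ w ∈ A.erase v, if hw : w ≠ v then
    S.sgn ⟨some (some w), hsome w hw⟩ ⟨none, by simp [z]⟩ *
      S.sgn ⟨some (some w), hsome w hw⟩ ⟨some none, by simp [z]⟩ else 1
  rw [← h.expect_sgn_mul_sgn_mul_comap hx hx1 h0 (z := z) (p := none) (q := some none) (by simp [z])
    (by simp [z]) (by simp) g]
  refine congrArg _ (funext fun T => ?_)
  rw [← Finset.prod_mul_distrib, ← Finset.mul_prod_erase A _ hv]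
  congr 1
  · rw [T.sgn_swap z none, T.sgn_swap z (some none), neg_mul_neg]
    rfl
  · refine Finset.prod_congr rfl fun w hw => ?_
    rw [dif_pos (Finset.ne_of_mem_erase hw)]
    rfl

end

end

/-! ### Random tournaments -/

instance : IsProbabilityMeasure coins := by
  unfold coins
  infer_instance

/-- Turning over the coin at `e`. -/
def flipCoin (e : ℕ × ℕ) (ω : ℕ × ℕ → Bool) : ℕ × ℕ → Bool :=
  fun i => (if i = e then not else id) (ω i)

theorem measurable_flipCoin (e : ℕ × ℕ) : Measurable (flipCoin e) :=
  measurable_pi_lambda _ fun i => (measurable_of_countable _).comp (measurable_pi_apply i)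

theorem map_flipCoin (e : ℕ × ℕ) : coins.map (flipCoin e) = coins := by
  unfold coins
  have hnot : ((PMF.uniformOfFintype Bool).toMeasure).map not =
      (PMF.uniformOfFintype Bool).toMeasure := by
    refine Measure.ext_of_singleton fun b => ?_
    rw [Measure.map_apply (measurable_of_countable _) (measurableSet_singleton b)]
    have : not ⁻¹' {b} = {!b} := by
      ext a
      cases a <;> cases b <;> simp
    rw [this, PMF.toMeasure_apply_singleton _ _ (measurableSet_singleton _),
      PMF.toMeasure_apply_singleton _ _ (measurableSet_singleton _)]
    simp
  refine (Measure.infinitePi_map_pi (μ := fun _ : ℕ × ℕ =>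
    (PMF.uniformOfFintype Bool).toMeasure) (f := fun i => if i = e then not else id)
    fun i => measurable_of_countable _).trans ?_
  congr 1
  funext i
  split_ifs with h
  · exact hnot
  · exact Measure.map_id

/-- The tournament on n vertices depends on finitely many coins only, so any function of it is
measurable. -/
theorem measurable_randomTournament {β : Type*} [MeasurableSpace β] (n : ℕ)
    (g : Tournament (Fin n) → β) : Measurable fun ω => g (randomTournament ω n).tour := by
  classical
  let ext : (Fin n × Fin n → Bool) → ℕ × ℕ → Bool := fun η e =>
    if h : e.1 < n ∧ e.2 < n then η (⟨e.1, h.1⟩, ⟨e.2, h.2⟩) else false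
  let res : (ℕ × ℕ → Bool) → Fin n × Fin n → Bool := fun ω e => ω (e.1, e.2)
  have hres : Measurable res := measurable_pi_lambda _ fun e => measurable_pi_apply _
  have h : ∀ ω, (randomTournament ω n).tour = (randomTournament (ext (res ω)) n).tour := by
    intro ω
    refine Tournament.ext fun u v => ?_
    simp [randomTournament, ext, res]
  rw [funext fun ω => congrArg g (h ω)]
  exact (measurable_of_countable fun η => g (randomTournament (ext η) n).tour).comp hres

theorem beats_flipCoin_of_ne {n : ℕ} (ω : ℕ × ℕ → Bool) {i j u v : Fin n}
    (h : ¬ (u = i ∧ v = j)) (h' : ¬ (u = j ∧ v = i)) :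
    (randomTournament (flipCoin (i, j) ω) n).tour.Beats u v ↔
      (randomTournament ω n).tour.Beats u v := by
  have h1 : ((u : ℕ), (v : ℕ)) ≠ ((i : ℕ), (j : ℕ)) := fun he =>
    h ⟨Fin.ext (Prod.ext_iff.mp he).1, Fin.ext (Prod.ext_iff.mp he).2⟩
  have h2 : ((v : ℕ), (u : ℕ)) ≠ ((i : ℕ), (j : ℕ)) := fun he =>
    h' ⟨Fin.ext (Prod.ext_iff.mp he).2, Fin.ext (Prod.ext_iff.mp he).1⟩
  simp only [randomTournament, flipCoin, if_neg h1, if_neg h2, id]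

theorem beats_flipCoin_self {n : ℕ} (ω : ℕ × ℕ → Bool) {i j : Fin n} (hij : i < j) :
    ((randomTournament (flipCoin (i, j) ω) n).tour.Beats i j ↔
      (randomTournament ω n).tour.Beats j i) ∧
    ((randomTournament (flipCoin (i, j) ω) n).tour.Beats j i ↔
      (randomTournament ω n).tour.Beats i j) := by
  simp [randomTournament, flipCoin, hij, hij.not_gt]

/-- For two vertices there is a coin whose flip reverses exactly the arc between them. -/
theorem exists_flipCoin {n : ℕ} {i j : Fin n} (hij : i ≠ j) : ∃ e, ∀ ω,
    (randomTournament (flipCoin e ω) n).tour.sgn i j = -(randomTournament ω n).tour.sgn i j ∧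
    ∀ u v, ¬ (u = i ∧ v = j) → ¬ (u = j ∧ v = i) →
      ((randomTournament (flipCoin e ω) n).tour.Beats u v ↔
        (randomTournament ω n).tour.Beats u v) := by
  rcases lt_or_gt_of_ne hij with h | h
  · refine ⟨(i, j), fun ω => ⟨?_, fun u v h1 h2 => beats_flipCoin_of_ne ω h1 h2⟩⟩
    have := beats_flipCoin_self ω h
    rw [Tournament.sgn, Tournament.sgn, this.1, this.2]
    ring
  · refine ⟨(j, i), fun ω => ⟨?_, fun u v h1 h2 => beats_flipCoin_of_ne ω h2 h1⟩⟩
    have := beats_flipCoin_self ω h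
    rw [Tournament.sgn, Tournament.sgn, this.1, this.2]
    ring

theorem Tournament.comap_congr {V W : Type} {S T : Tournament W} (θ : V ↪ W)
    (h : ∀ u v, S.Beats (θ u) (θ v) ↔ T.Beats (θ u) (θ v)) : S.comap θ = T.comap θ :=
  Tournament.ext h

theorem Tournament.sgn_congr {W : Type} {S T : Tournament W} {u v : W}
    (h : S.Beats u v ↔ T.Beats u v) (h' : S.Beats v u ↔ T.Beats v u) : S.sgn u v = T.sgn u v := by
  rw [Tournament.sgn, Tournament.sgn, h, h']

section
variable {V : Type} [Finite V]

/-- A product of signs at the new vertex times a function of the other vertices. -/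
def signFunction (A : Finset V) (b : Tournament V → ℝ) (T : Tournament (Option V)) : ℝ :=
  (∏ w ∈ A, T.sgn (some w) none) * b (T.comap Function.Embedding.some)

-- The arc from v to the new vertex enters the sign product exactly once and does not enter b.
omit [Finite V] in
theorem signFunction_flip {n : ℕ} {A : Finset V} {v : V} (hv : v ∈ A) (b : Tournament V → ℝ)
    {S T : Tournament (Fin n)} (θ : Option V ↪ Fin n)
    (h1 : S.sgn (θ (some v)) (θ none) = -T.sgn (θ (some v)) (θ none))
    (h2 : ∀ p q, ¬ (p = θ (some v) ∧ q = θ none) → ¬ (p = θ none ∧ q = θ (some v)) →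
      (S.Beats p q ↔ T.Beats p q)) :
    signFunction A b (S.comap θ) = -signFunction A b (T.comap θ) := by
  classical
  have hb : (S.comap θ).comap Function.Embedding.some =
      (T.comap θ).comap Function.Embedding.some := by
    refine Tournament.ext fun p q => h2 _ _ ?_ ?_
    · rintro ⟨-, h⟩
      exact absurd (θ.injective h) (by simp)
    · rintro ⟨h, -⟩
      exact absurd (θ.injective h) (by simp)
  have hprod : ∏ w ∈ A.erase v, (S.comap θ).sgn (some w) none =
      ∏ w ∈ A.erase v, (T.comap θ).sgn (some w) none := by
    refine Finset.prod_congr rfl fun w hw => ?_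
    have hwv := Finset.ne_of_mem_erase hw
    have hne : θ (some w) ≠ θ (some v) := fun h => hwv (Option.some_injective _ (θ.injective h))
    have hne' : θ (some w) ≠ θ none := fun h => absurd (θ.injective h) (by simp)
    exact Tournament.sgn_congr (h2 _ _ (fun h => hne h.1) (fun h => hne' h.1))
      (h2 _ _ (fun h => hne' h.2) (fun h => hne h.2))
  rw [signFunction, signFunction, hb, ← Finset.mul_prod_erase A _ hv,
    ← Finset.mul_prod_erase A _ hv, hprod, Tournament.sgn_comap, Tournament.sgn_comap, h1]
  ring

-- Flipping the coin of the arc between θ(v) and θ(none) preserves the measure and negates the first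
-- factor. The second factor does not see that arc, so the integral equals its negative.
omit [Finite V] in
theorem integral_signFunction_mul {n : ℕ} {A : Finset V} {v : V} (hv : v ∈ A)
    (b : Tournament V → ℝ) (θ θ' : Option V ↪ Fin n)
    (h : ¬ (θ (some v) ∈ Set.range θ' ∧ θ none ∈ Set.range θ')) :
    ∫ ω, signFunction A b ((randomTournament ω n).tour.comap θ) *
      signFunction A b ((randomTournament ω n).tour.comap θ') ∂coins = 0 := by
  have hne : θ (some v) ≠ θ none := fun h => absurd (θ.injective h) (by simp)
  obtain ⟨e, he⟩ := exists_flipCoin hne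
  have hmeas := measurable_randomTournament n fun T =>
    signFunction A b (T.comap θ) * signFunction A b (T.comap θ')
  set G : (ℕ × ℕ → Bool) → ℝ := fun ω => signFunction A b ((randomTournament ω n).tour.comap θ) *
      signFunction A b ((randomTournament ω n).tour.comap θ') with hG
  have hflip : ∀ ω, G (flipCoin e ω) = -G ω := by
    intro ω
    have h1 := signFunction_flip hv b θ (he ω).1 (he ω).2
    have h2 : (randomTournament (flipCoin e ω) n).tour.comap θ' =
        (randomTournament ω n).tour.comap θ' := by
      refine Tournament.comap_congr θ' fun p q => (he ω).2 _ _ ?_ ?_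
      · rintro ⟨hp, hq⟩
        exact h ⟨⟨p, hp⟩, ⟨q, hq⟩⟩
      · rintro ⟨hp, hq⟩
        exact h ⟨⟨q, hq⟩, ⟨p, hp⟩⟩
    simp only [hG, h1, h2, neg_mul]
  have h1 : ∫ ω, G ω ∂coins = ∫ ω, G (flipCoin e ω) ∂coins := by
    conv_lhs => rw [← map_flipCoin e]
    exact integral_map (measurable_flipCoin e).aemeasurable hmeas.aestronglyMeasurable
  simp only [hflip, integral_neg] at h1
  linarith

theorem avgOn_comap {W : Type} [Finite W] {n : ℕ} (G : LabelledTournament emptyType (Fin n))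
    (hn : Nat.card W ≤ n) (κ : V ↪ W) (g : Tournament V → ℝ) :
    G.avgOn (noLabels W) (fun T => g (T.comap κ)) = G.avgOn (noLabels V) g :=
  avg_rel_comp (by simpa using hn) (⟨κ, fun i => i.elim0⟩ : Rel (noLabels V) (noLabels W))
    (fun θ : Rel (noLabels V) G.label => g (G.tour.comap θ.1))

/-- Two given vertices of a random embedding rarely both fall into a given small set. -/
theorem avg_mem_range_le {n : ℕ} (hn : Nat.card V ≤ n) (hn2 : 2 ≤ n) {u v : V} (huv : u ≠ v)
    (ℓ : Fin 0 ↪ Fin n) (R : Set (Fin n)) :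
    avg (fun θ : Rel (noLabels V) ℓ => ind (θ.1 u ∈ R ∧ θ.1 v ∈ R)) ≤
      (Nat.card R : ℝ) ^ 2 * (2 / (n : ℝ) ^ 2) := by
  classical
  let κ : Fin 2 ↪ V := ⟨![u, v], fun i j h => by fin_cases i <;> fin_cases j <;> simp_all⟩
  have h1 : avg (fun θ : Rel (noLabels V) ℓ => ind (θ.1 u ∈ R ∧ θ.1 v ∈ R)) =
      avg (fun θ : Rel (noLabels (Fin 2)) ℓ => ind (θ.1 0 ∈ R ∧ θ.1 1 ∈ R)) :=
    avg_rel_comp (by simpa using hn) (⟨κ, fun i => i.elim0⟩ : Rel (noLabels (Fin 2)) (noLabels V))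
      (fun θ : Rel (noLabels (Fin 2)) ℓ => ind (θ.1 0 ∈ R ∧ θ.1 1 ∈ R))
  let e : Rel (noLabels (Fin 2)) ℓ ≃ (Fin 2 ↪ Fin n) :=
    ⟨fun θ => θ.1, fun θ => ⟨θ, fun i => i.elim0⟩, fun _ => rfl, fun _ => rfl⟩
  have hcard : Nat.card (Rel (noLabels (Fin 2)) ℓ) = n * (n - 1) := by
    rw [Nat.card_congr e, Nat.card_eq_fintype_card, Fintype.card_embedding_eq]
    simp [Nat.descFactorial_succ, mul_comm]
  have hle : Nat.card {θ : Rel (noLabels (Fin 2)) ℓ // θ.1 0 ∈ R ∧ θ.1 1 ∈ R} ≤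
      Nat.card R ^ 2 := by
    rw [sq, ← Nat.card_prod]
    refine Nat.card_le_card_of_injective (fun θ => (⟨θ.1.1 0, θ.2.1⟩, ⟨θ.1.1 1, θ.2.2⟩)) ?_
    intro θ θ' h
    refine Subtype.ext (Subtype.ext (Function.Embedding.ext fun i => ?_))
    simp only [Prod.mk.injEq, Subtype.mk.injEq] at h
    fin_cases i
    · exact h.1
    · exact h.2
  rw [h1, avg_ind, hcard, div_eq_mul_inv]
  have hn' : (2 : ℝ) ≤ n := by exact_mod_cast hn2
  refine mul_le_mul (by exact_mod_cast hle) ?_ (by positivity) (by positivity)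
  -- The bound 1/(n(n-1)) ≤ 2/n² holds since n ≥ 2.
  rw [Nat.cast_mul, Nat.cast_sub (by omega), Nat.cast_one, ← one_div,
    div_le_div_iff₀ (by nlinarith) (by positivity)]
  nlinarith

theorem exists_abs_le (g : Tournament V → ℝ) : ∃ C : ℝ, 0 ≤ C ∧ ∀ T, |g T| ≤ C := by
  obtain ⟨C, hC⟩ := (Set.finite_range fun T => |g T|).bddAbove
  exact ⟨max C 0, le_max_right _ _, fun T => (hC ⟨T, rfl⟩).trans (le_max_left _ _)⟩

theorem integral_avg {α Ω : Type*} [Finite α] [MeasurableSpace Ω] {μ : Measure Ω}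
    (f : α → Ω → ℝ) (hf : ∀ a, Integrable (f a) μ) :
    ∫ ω, avg (fun a => f a ω) ∂μ = avg fun a => ∫ ω, f a ω ∂μ := by
  let _ := Fintype.ofFinite α
  simp only [avg_eq]
  rw [integral_div, integral_finsetSum _ fun a _ => hf a]

/-- The square is an average over pairs (θ, θ'). A pair can contribute only if both ends of the arc
from θ(v) to θ(none) lie in the range of θ', which has probability O(1/n²). -/
theorem exists_integral_sq_le {A : Finset V} (hA : A.Nonempty) (b : Tournament V → ℝ) :
    ∃ C : ℝ, ∀ᶠ n : ℕ in atTop, ∫ ω, (randomTournament ω n).avgOn (noLabels (Option V))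
      (signFunction A b) ^ 2 ∂coins ≤ C * (1 / (n : ℝ) ^ 2) := by
  obtain ⟨v, hv⟩ := hA
  obtain ⟨C, hC0, hC⟩ := exists_abs_le (signFunction A b)
  refine ⟨C ^ 2 * (Nat.card (Option V) : ℝ) ^ 2 * 2, ?_⟩
  filter_upwards [eventually_ge_atTop (Nat.card (Option V)), eventually_ge_atTop 2] with n hn hn2
  let ℓ : Fin 0 ↪ Fin n := noLabels (Fin n)
  let F : Rel (noLabels (Option V)) ℓ → (ℕ × ℕ → Bool) → ℝ := fun θ ω =>
    signFunction A b ((randomTournament ω n).tour.comap θ.1)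
  have hlab : ∀ ω, (randomTournament ω n).label = ℓ := fun ω =>
    Function.Embedding.ext fun i => i.elim0
  have hX : ∀ ω, (randomTournament ω n).avgOn (noLabels (Option V)) (signFunction A b) =
      avg (fun θ => F θ ω) := by
    intro ω
    exact congrArg (fun ℓ' : Fin 0 ↪ Fin n => avg (fun θ : Rel (noLabels (Option V)) ℓ' =>
      signFunction A b ((randomTournament ω n).tour.comap θ.1))) (hlab ω)
  have hbound : ∀ θ θ' ω, |F θ ω * F θ' ω| ≤ C ^ 2 := fun θ θ' ω => by
    rw [abs_mul, sq]
    exact mul_le_mul (hC _) (hC _) (abs_nonneg _) hC0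
  have hint : ∀ θ θ', Integrable (fun ω => F θ ω * F θ' ω) coins := fun θ θ' =>
    Integrable.of_bound (C := C ^ 2) (measurable_randomTournament n fun T =>
      signFunction A b (T.comap θ.1) * signFunction A b (T.comap θ'.1)).aestronglyMeasurable
      (Eventually.of_forall fun ω => hbound θ θ' ω)
  have hsq : ∀ ω, (avg fun θ => F θ ω) ^ 2 = avg fun θ' => avg fun θ => F θ ω * F θ' ω := by
    intro ω
    simp only [fun θ θ' => mul_comm (F θ ω) (F θ' ω), avg_const_mul]
    simp only [mul_comm _ (avg _), avg_const_mul]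
    ring
  have hint' : ∀ θ', Integrable (fun ω => avg fun θ => F θ ω * F θ' ω) coins := fun θ' => by
    let _ := Fintype.ofFinite (Rel (noLabels (Option V)) ℓ)
    simp only [avg_eq]
    exact (integrable_finsetSum _ fun θ _ => hint θ θ').div_const _
  have hpair : ∀ θ θ', ∫ ω, F θ ω * F θ' ω ∂coins ≤
      C ^ 2 * ind (θ.1 (some v) ∈ Set.range θ'.1 ∧ θ.1 none ∈ Set.range θ'.1) := by
    intro θ θ'
    by_cases h : θ.1 (some v) ∈ Set.range θ'.1 ∧ θ.1 none ∈ Set.range θ'.1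
    · rw [ind_true h, mul_one]
      calc ∫ ω, F θ ω * F θ' ω ∂coins ≤ ∫ _ω, C ^ 2 ∂coins :=
            integral_mono (hint θ θ') (integrable_const _) fun ω =>
              (le_abs_self _).trans (hbound θ θ' ω)
        _ = C ^ 2 := by simp
    · rw [ind_false h, mul_zero]
      exact (integral_signFunction_mul hv b θ.1 θ'.1 h).le
  simp only [hX, hsq]
  rw [integral_avg _ hint']
  have hθ' : ∀ θ' : Rel (noLabels (Option V)) ℓ,
      ∫ ω, avg (fun θ => F θ ω * F θ' ω) ∂coins ≤
        C ^ 2 * ((Nat.card (Option V) : ℝ) ^ 2 * (2 / (n : ℝ) ^ 2)) := by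
    intro θ'
    rw [integral_avg _ fun θ => hint θ θ']
    refine (avg_mono fun θ => hpair θ θ').trans ?_
    rw [avg_const_mul]
    refine mul_le_mul_of_nonneg_left ?_ (sq_nonneg C)
    have := avg_mem_range_le hn hn2 (Option.some_ne_none v) ℓ (Set.range θ'.1)
    rwa [Nat.card_range_of_injective θ'.1.injective] at this
  have := Rel.nonempty (noLabels (Option V)) ℓ (by simpa using hn)
  calc _ ≤ avg (fun _ : Rel (noLabels (Option V)) ℓ =>
        C ^ 2 * ((Nat.card (Option V) : ℝ) ^ 2 * (2 / (n : ℝ) ^ 2))) := avg_mono hθ'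
    _ = _ := by rw [avg_const]; ring

/-- The tail sum of the squares has finite integral, so it is almost surely finite and its terms
tend to 0. -/
theorem tendsto_zero_of_integral_sq_le {Ω : Type*} [MeasurableSpace Ω] {μ : Measure Ω}
    {X : ℕ → Ω → ℝ} (hX : ∀ n, Integrable (fun ω => X n ω ^ 2) μ) {c : ℕ → ℝ} (hc : Summable c)
    (h : ∀ᶠ n in atTop, ∫ ω, X n ω ^ 2 ∂μ ≤ c n) :
    ∀ᵐ ω ∂μ, Tendsto (fun n => X n ω) atTop (𝓝 0) := by
  obtain ⟨N, hN⟩ := eventually_atTop.mp h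
  have hfin : ∑' n, ∫⁻ ω, ENNReal.ofReal (X (n + N) ω ^ 2) ∂μ ≠ ⊤ := by
    have hle : ∀ n, ∫⁻ ω, ENNReal.ofReal (X (n + N) ω ^ 2) ∂μ ≤ ENNReal.ofReal (c (n + N)) := by
      intro n
      rw [← ofReal_integral_eq_lintegral_ofReal (hX _) (Eventually.of_forall fun _ => sq_nonneg _)]
      exact ENNReal.ofReal_le_ofReal (hN _ (Nat.le_add_left _ _))
    refine ne_top_of_le_ne_top ?_ (ENNReal.tsum_le_tsum hle)
    exact ((summable_nat_add_iff N).mpr hc).tsum_ofReal_ne_top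
  rw [← lintegral_tsum fun n => (hX _).aestronglyMeasurable.aemeasurable.ennreal_ofReal] at hfin
  have hae := ae_lt_top' (AEMeasurable.tsum fun n =>
    (hX (n + N)).aestronglyMeasurable.aemeasurable.ennreal_ofReal) hfin
  filter_upwards [hae] with ω hω
  have h1 := ENNReal.tendsto_atTop_zero_of_tsum_ne_top hω.ne
  have h2 : Tendsto (fun n => X (n + N) ω ^ 2) atTop (𝓝 0) := by
    have := (ENNReal.tendsto_toReal ENNReal.zero_ne_top).comp h1
    refine this.congr fun n => ?_
    simp [ENNReal.toReal_ofReal (sq_nonneg _)]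
  have h3 := (Real.continuous_sqrt.tendsto 0).comp h2
  rw [Real.sqrt_zero] at h3
  have h4 : Tendsto (fun n => |X (n + N) ω|) atTop (𝓝 0) :=
    h3.congr fun n => Real.sqrt_sq_eq_abs _
  exact (tendsto_add_atTop_iff_nat N).mp (tendsto_zero_iff_abs_tendsto_zero _ |>.mpr h4)

theorem ae_tendsto_signFunction {A : Finset V} (hA : A.Nonempty) (b : Tournament V → ℝ) :
    ∀ᵐ ω ∂coins, Tendsto (fun n => (randomTournament ω n).avgOn (noLabels (Option V))
      (signFunction A b)) atTop (𝓝 0) := by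
  obtain ⟨C, hC⟩ := exists_integral_sq_le hA b
  refine tendsto_zero_of_integral_sq_le (fun n => ?_)
    ((Real.summable_one_div_nat_pow.mpr one_lt_two).mul_left C) hC
  obtain ⟨D, hD0, hD⟩ := exists_abs_le fun T : Tournament (Fin n) =>
    (⟨T, noLabels _, fun i => i.elim0⟩ : LabelledTournament emptyType (Fin n)).avgOn
      (noLabels (Option V)) (signFunction A b) ^ 2
  have heq : ∀ ω, (randomTournament ω n) =
      ⟨(randomTournament ω n).tour, noLabels _, fun i => i.elim0⟩ := fun ω => by
    have : (randomTournament ω n).label = noLabels (Fin n) :=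
      Function.Embedding.ext fun i => i.elim0
    rw [← this]
  refine Integrable.of_bound (C := D) ?_ (Eventually.of_forall fun ω => ?_)
  · have := measurable_randomTournament n fun T : Tournament (Fin n) =>
      (⟨T, noLabels _, fun i => i.elim0⟩ : LabelledTournament emptyType (Fin n)).avgOn
        (noLabels (Option V)) (signFunction A b) ^ 2
    simp only [← heq] at this
    exact this.aestronglyMeasurable
  · have := hD (randomTournament ω n).tour
    rw [← heq] at this
    exact this

end

/-- Induction on the vertices: in the sign expansion at one vertex all nonempty products average to
0 almost surely, and the empty one is covered by the induction hypothesis. -/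
theorem exists_ae_tendsto (V : Type) [Finite V] (g : Tournament V → ℝ) : ∃ c : ℝ,
    ∀ᵐ ω ∂coins, Tendsto (fun n => (randomTournament ω n).avgOn (noLabels V) g) atTop (𝓝 c) := by
  classical
  suffices h : ∀ [Finite V] (g : Tournament V → ℝ), ∃ c : ℝ, ∀ᵐ ω ∂coins,
      Tendsto (fun n => (randomTournament ω n).avgOn (noLabels V) g) atTop (𝓝 c) from h g
  refine Finite.induction_empty_option (P := fun V => ∀ [Finite V] (g : Tournament V → ℝ),
    ∃ c : ℝ, ∀ᵐ ω ∂coins, Tendsto (fun n => (randomTournament ω n).avgOn (noLabels V) g) atTop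
      (𝓝 c)) ?_ ?_ ?_ V
  · intro V₁ V₂ e ih _ g
    have := Finite.of_equiv V₂ e.symm
    obtain ⟨c, hc⟩ := ih fun T => g (T.comap e.symm.toEmbedding)
    refine ⟨c, ?_⟩
    filter_upwards [hc] with ω hω
    refine hω.congr' ?_
    filter_upwards [eventually_ge_atTop (Nat.card V₁)] with n hn
    exact avgOn_comap _ hn e.symm.toEmbedding g
  · intro _ g
    have hg : ∀ T S : Tournament PEmpty, T = S := fun T S => Tournament.ext fun u => u.elim
    let T₀ : Tournament PEmpty := ⟨fun u => u.elim, fun u => u.elim, fun u => u.elim⟩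
    refine ⟨g T₀, Eventually.of_forall fun ω => ?_⟩
    refine tendsto_const_nhds.congr fun n => ?_
    have := Rel.nonempty (noLabels PEmpty) (randomTournament ω n).label (by simp)
    rw [LabelledTournament.avgOn, ← avg_const (α := Rel (noLabels PEmpty)
      (randomTournament ω n).label) (g T₀)]
    exact congrArg avg (funext fun η => congrArg g (hg _ _))
  · intro W _ ih _ g
    obtain ⟨c, hc⟩ := exists_sgn_expansion g
    obtain ⟨d, hd⟩ := ih (c ∅)
    refine ⟨d, ?_⟩
    have hA : ∀ᵐ ω ∂coins, ∀ A : {A : Finset W // A.Nonempty},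
        Tendsto (fun n => (randomTournament ω n).avgOn (noLabels (Option W))
          (signFunction A.1 (c A))) atTop (𝓝 0) :=
      ae_all_iff.mpr fun A => ae_tendsto_signFunction A.2 (c A)
    filter_upwards [hd, hA] with ω hω hωA
    have hsum : ∀ n, (randomTournament ω n).avgOn (noLabels (Option W)) g =
        ∑ A : Finset W, (randomTournament ω n).avgOn (noLabels (Option W))
          (signFunction A (c A)) := fun n => by
      rw [funext hc]
      exact avg_sum _ _
    have hlim : ∀ A : Finset W, Tendsto (fun n => (randomTournament ω n).avgOn
        (noLabels (Option W)) (signFunction A (c A))) atTop (𝓝 (if A = ∅ then d else 0)) := by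
      intro A
      split_ifs with h
      · subst h
        refine hω.congr' ?_
        filter_upwards [eventually_ge_atTop (Nat.card (Option W))] with n hn
        rw [← avgOn_comap _ hn Function.Embedding.some (c ∅)]
        refine congrArg _ (funext fun T => ?_)
        simp [signFunction]
      · exact hωA ⟨A, Finset.nonempty_iff_ne_empty.mpr h⟩
    simp only [hsum]
    simpa using tendsto_finsetSum Finset.univ fun A _ => hlim A

theorem exists_isRandomLimit : ∃ φ : HomPlus emptyType, IsRandomLimit φ := by
  have h := fun F : Flag emptyType => exists_ae_tendsto (Fin F.1)
    fun T => ind (Ind F.2 (noLabels _) T)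
  choose x hx using h
  have hall : ∀ᵐ ω ∂coins, ∀ F : Flag emptyType,
      Tendsto (fun n => density F.2 (randomTournament ω n)) atTop (𝓝 (x F)) := by
    filter_upwards [ae_all_iff.mpr hx] with ω hω F
    refine (hω F).congr' ?_
    filter_upwards [eventually_ge_atTop F.1] with n hn
    exact (density_eq_avgOn F.2 (randomTournament ω n) (noLabels _) (Nat.card_fin _)
      (by simpa using hn)).symm
  -- The limits do not depend on the sample, so a single good one suffices to show that they form a
  -- homomorphism.
  obtain ⟨ω, hω⟩ := hall.exists
  obtain ⟨φ, hφ⟩ := exists_homPlus_of_tendsto (fun n => randomTournament ω n) x hω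
  refine ⟨φ, ?_⟩
  filter_upwards [hall] with ω' hω' m F
  have := hω' ⟨m, F⟩
  rwa [← hφ] at this

theorem IsRandomLimit.ae_tendsto {φ : HomPlus emptyType} (hφ : IsRandomLimit φ) {V : Type}
    [Finite V] (g : Tournament V → ℝ) : ∀ᵐ ω ∂coins, Tendsto
      (fun n => (randomTournament ω n).avgOn (noLabels V) g) atTop (𝓝 (expect φ.values g)) := by
  filter_upwards [hφ] with ω hω
  have h1 : Tendsto (fun n => ∑ F : FlagOfSize emptyType (Nat.card V),
      F.rep.avgOn (noLabels V) g * density F (randomTournament ω n)) atTop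
      (𝓝 (∑ F : FlagOfSize emptyType (Nat.card V),
        F.rep.avgOn (noLabels V) g * φ.values ⟨_, F⟩)) :=
    tendsto_finsetSum _ fun F _ => (hω _ F).const_mul _
  have h2 : expect φ.values g = ∑ F : FlagOfSize emptyType (Nat.card V),
      F.rep.avgOn (noLabels V) g * φ.values ⟨_, F⟩ :=
    Finset.sum_congr rfl fun F _ => mul_comm _ _
  rw [h2]
  refine h1.congr' ?_
  filter_upwards [eventually_ge_atTop (Nat.card V)] with n hn
  exact sum_avgOn_mul_density (randomTournament ω n) (noLabels V) g le_rfl (by simpa using hn)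

/-- On a common sample the averages of a sign function converge both to its expectation under φ and
to 0. -/
theorem IsRandomLimit.uniform {φ : HomPlus emptyType} (hφ : IsRandomLimit φ) :
    Uniform φ.values := by
  intro V _ A hA b
  obtain ⟨ω, h1, h2⟩ := ((hφ.ae_tendsto (signFunction A b)).and
    (ae_tendsto_signFunction hA b)).exists
  exact tendsto_nhds_unique h1 h2

/-! ### Extensions -/

section
variable {V : Type} [Finite V]

theorem HomPlus.downward_eq_expect (φ : HomPlus emptyType) {n : ℕ} (F : FlagOfSize σ n)
    (ℓ : Fin k ↪ V) (hV : Nat.card V = n) :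
    φ.toHom (downward F) = expect φ.values (fun T : Tournament V => ind (Ind F ℓ T)) := by
  rw [← labellingProb_mul_eq_expect φ.isAveraging F ℓ hV, downward, map_smul]
  rfl

theorem HomPlus.downward_nonneg (φ : HomPlus emptyType) {n : ℕ} (F : FlagOfSize σ n) :
    0 ≤ φ.toHom (downward F) := by
  rw [φ.downward_eq_expect F F.rep.label (Nat.card_fin n)]
  exact expect_nonneg φ.values_nonneg fun T => ind_nonneg _

omit [Finite V] in
theorem Ind.isType {n : ℕ} {F : FlagOfSize σ n} {ℓ : Fin k ↪ V} {T : Tournament V}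
    (h : Ind F ℓ T) : IsType σ ℓ T := h.1

/-- The downward operator respects averaging, so the normalized values φ(⟦F⟧)/φ(⟦1⟧) are the means
of a random homomorphism by `exists_randomHom`. -/
theorem HomPlus.downward_average (φ : HomPlus emptyType) {n N : ℕ} (F : FlagOfSize σ n)
    (h : n ≤ N) : φ.toHom (downward F) =
      ∑ G : FlagOfSize σ N, density F G.rep * φ.toHom (downward G) := by
  let ι : Fin k ↪ Fin n := Fin.castLEEmb F.le_size
  let κ : Fin k ↪ Fin N := Fin.castLEEmb (F.le_size.trans h)
  have h1 : ∀ G : FlagOfSize σ N, density F G.rep =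
      G.rep.avgOn ι fun T => ind (Ind F ι T) := fun G =>
    density_eq_avgOn F G.rep ι (Nat.card_fin n) (by simpa using h)
  simp only [h1, fun G : FlagOfSize σ N => φ.downward_eq_expect G κ (Nat.card_fin N)]
  rw [sum_avgOn_mul_expect φ.isAveraging κ (Nat.card_fin N) ι (by simpa using h),
    φ.downward_eq_expect F ι (Nat.card_fin n)]
  refine congrArg _ (funext fun T => ?_)
  rw [← ind_and, and_iff_right_of_imp Ind.isType]

theorem exists_isExtension (φ : HomPlus emptyType)
    (hφ : φ.toHom (downward (unitFlag σ)) ≠ 0) :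
    ∃ P : Measure (HomPlus σ), IsExtension φ P := by
  obtain ⟨P, hP, hP'⟩ := exists_randomHom (σ := σ)
    (x := fun F => φ.toHom (downward F.2) / φ.toHom (downward (unitFlag σ)))
    (fun F => div_nonneg (φ.downward_nonneg _) (φ.downward_nonneg _)) (div_self hφ)
    (fun n N F h => by
      simp only
      rw [φ.downward_average F h, Finset.sum_div]
      exact Finset.sum_congr rfl fun G _ => mul_div_assoc _ _ _)
  exact ⟨P, hP, fun n F => hP' ⟨n, F⟩⟩

theorem IsExtension.eq {φ : HomPlus emptyType} {P Q : Measure (HomPlus σ)}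
    (hP : IsExtension φ P) (hQ : IsExtension φ Q) : P = Q := by
  have := hP.isProbabilityMeasure
  have := hQ.isProbabilityMeasure
  exact HomPlus.measure_ext fun n F => (hP.expectation n F).trans (hQ.expectation n F).symm

/-- Expanded in signs, every term of the balance condition contains one or two signs at the new
vertex; the factor 1 + s(u,v) is absorbed into g. -/
theorem Uniform.balanced {x : Flag emptyType → ℝ} (h : Uniform x) : Balanced x := by
  classical
  intro V _ u v huv g
  have h1 := h V {v} (Finset.singleton_nonempty v) fun T => (1 + T.sgn u v) * g T
  have h2 := h V {u} (Finset.singleton_nonempty u) fun T => (1 + T.sgn u v) * g T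
  have h3 := h V {u, v} (Finset.insert_nonempty u _) fun T => (1 + T.sgn u v) * g T
  simp only [Finset.prod_singleton, Finset.prod_pair huv] at h1 h2 h3
  have h4 : ∀ T : Tournament (Option V), ind (T.Beats (some u) (some v)) *
      (ind (T.Beats (some v) none) * ind (T.Beats none (some u)) - 1 / 4) *
      g (T.comap Function.Embedding.some) =
      (1 / 8) * (T.sgn (some v) none * ((1 + (T.comap Function.Embedding.some).sgn u v) *
        g (T.comap Function.Embedding.some)) -
      T.sgn (some u) none * ((1 + (T.comap Function.Embedding.some).sgn u v) *
        g (T.comap Function.Embedding.some)) -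
      T.sgn (some u) none * T.sgn (some v) none *
        ((1 + (T.comap Function.Embedding.some).sgn u v) *
        g (T.comap Function.Embedding.some))) := by
    intro T
    rw [T.ind_beats (fun h => huv (Option.some_injective _ h)),
      T.ind_beats (Option.some_ne_none v), T.ind_beats (Option.some_ne_none u).symm,
      T.sgn_swap (some u) none, Tournament.sgn_comap]
    simp only [Function.Embedding.some_apply]
    ring
  rw [funext h4, expect_const_mul, expect_sub, expect_sub, h1, h2, h3]
  norm_num

/-! ### The type of an arc -/

omit [Finite V] in
theorem isType_typeA {ι : Fin 2 ↪ V} {T : Tournament V} :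
    IsType typeA ι T ↔ T.Beats (ι 0) (ι 1) := by
  constructor
  · intro h
    exact (h 0 1).mpr ⟨rfl, rfl⟩
  · intro h i j
    fin_cases i <;> fin_cases j <;> simp [typeA, h, T.irrefl, T.asymm _ _ h]

theorem ind_unitFlag {V : Type} (ι : Fin k ↪ V) (hι : Function.Surjective ι) {T : Tournament V} :
    Ind (unitFlag σ) ι T ↔ IsType σ ι T := by
  refine ⟨fun h => h.1, fun h => ⟨h, ?_⟩⟩
  have h1 : (unitFlag σ).rep.Isomorphic (⟨σ, Function.Embedding.refl _, fun _ _ => Iff.rfl⟩ :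
      LabelledTournament σ (Fin k)) :=
    ((FlagOfSize.rep_isomorphic_iff _ (unitFlag σ)).mpr rfl).symm
  refine Isomorphic.trans (Isomorphic.symm ?_) h1.symm
  exact ⟨Equiv.ofBijective ι ⟨ι.injective, hι⟩, fun i j => (h i j).symm, fun i => rfl⟩

/-- Exchanging the two vertices turns the indicator of the arc into its complement, and the law is
invariant. This is the source of the factor 2 in integrals over the extension. -/
theorem HomPlus.downward_unitFlag_typeA (φ : HomPlus emptyType) :
    φ.toHom (downward (unitFlag typeA)) = 1 / 2 := by
  rw [φ.downward_eq_expect _ (Function.Embedding.refl (Fin 2)) (Nat.card_fin 2)]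
  simp only [ind_unitFlag (σ := typeA) (Function.Embedding.refl (Fin 2)) Function.surjective_id,
    isType_typeA, Function.Embedding.refl_apply]
  have hswap := expect_comap φ.isAveraging (Equiv.swap (0 : Fin 2) 1).toEmbedding
    fun T => ind (T.Beats 0 1)
  have hs : ∀ T : Tournament (Fin 2),
      ind ((T.comap (Equiv.swap (0 : Fin 2) 1).toEmbedding).Beats 0 1) =
      1 - ind (T.Beats 0 1) := by
    intro T
    change ind (T.Beats 1 0) = _
    rw [T.ind_beats (by decide : (1 : Fin 2) ≠ 0), T.ind_beats (by decide : (0 : Fin 2) ≠ 1),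
      T.sgn_swap 0 1]
    ring
  rw [funext hs, expect_sub, expect_const φ.isAveraging φ.values_unit] at hswap
  linarith

theorem ind_cycleFlag {S : Tournament (Fin 2 ⊕ Fin 1)} :
    Ind cycleFlag Function.Embedding.inl S ↔ S.Beats (Sum.inl 0) (Sum.inl 1) ∧
      S.Beats (Sum.inl 1) (Sum.inr 0) ∧ S.Beats (Sum.inr 0) (Sum.inl 0) := by
  have hrep := (FlagOfSize.rep_isomorphic_iff _ cycleFlag).mpr rfl
  constructor
  · rintro ⟨h, hiso⟩
    obtain ⟨e, he, hl⟩ := hiso.trans hrep.symm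
    have h0 : e (Sum.inl 0) = 0 := hl 0
    have h1 : e (Sum.inl 1) = 1 := hl 1
    have h2 : e (Sum.inr 0) = 2 := by
      have h20 : e (Sum.inr 0) ≠ 0 := fun h' => by
        have := e.injective (h'.trans h0.symm)
        simp at this
      have h21 : e (Sum.inr 0) ≠ 1 := fun h' => by
        have := e.injective (h'.trans h1.symm)
        simp at this
      generalize e (Sum.inr 0) = a at *
      fin_cases a <;> simp_all
    refine ⟨(he _ _).mpr ?_, (he _ _).mpr ?_, (he _ _).mpr ?_⟩
    · change e (Sum.inl 1) = e (Sum.inl 0) + 1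
      rw [h0, h1]; rfl
    · change e (Sum.inr 0) = e (Sum.inl 1) + 1
      rw [h2, h1]; rfl
    · change e (Sum.inl 0) = e (Sum.inr 0) + 1
      rw [h0, h2]; rfl
  · rintro ⟨h01, h12, h20⟩
    refine ⟨isType_typeA.mpr h01, Isomorphic.trans ?_ hrep⟩
    refine ⟨finSumFinEquiv, ?_, fun i => rfl⟩
    have hn01 := S.asymm _ _ h01
    have hn12 := S.asymm _ _ h12
    have hn20 := S.asymm _ _ h20
    rintro (u | u) (v | v)
    · change _ ↔ (Fin.castAdd 1 v : Fin 3) = (Fin.castAdd 1 u : Fin 3) + 1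
      fin_cases u <;> fin_cases v <;> simp [h01, hn01, S.irrefl]
    · change _ ↔ (Fin.natAdd 2 v : Fin 3) = (Fin.castAdd 1 u : Fin 3) + 1
      fin_cases u <;> fin_cases v <;> simp [h12, hn20]
    · change _ ↔ (Fin.castAdd 1 v : Fin 3) = (Fin.natAdd 2 u : Fin 3) + 1
      fin_cases u; fin_cases v <;> simp [h20, hn12]
    · change _ ↔ (Fin.natAdd 2 v : Fin 3) = (Fin.natAdd 2 u : Fin 3) + 1
      exact iff_of_false (Subsingleton.elim u v ▸ S.irrefl _)
        (by fin_cases u; fin_cases v; decide)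

/-- Collapsing the petal of size one to a single new vertex. -/
def petalOption (X Y : Type) : X ⊕ (Fin 1 ⊕ Y) ↪ Option (X ⊕ Y) where
  toFun
    | Sum.inl a => some (Sum.inl a)
    | Sum.inr (Sum.inl _) => none
    | Sum.inr (Sum.inr a) => some (Sum.inr a)
  inj' a b h := by
    rcases a with a | a | a <;> rcases b with b | b | b <;> simp_all
    exact Subsingleton.elim _ _

theorem IsExtension.integral_eq {φ : HomPlus emptyType} {P : Measure (HomPlus typeA)}
    (hP : IsExtension φ P) {n : ℕ} (F : FlagOfSize typeA n) (ℓ : Fin 2 ↪ V) (hV : Nat.card V = n) :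
    ∫ ψ, ψ.values ⟨n, F⟩ ∂P =
      2 * expect φ.values (fun T : Tournament V => ind (Ind F ℓ T)) := by
  refine (hP.expectation n F).trans ?_
  rw [φ.downward_unitFlag_typeA, φ.downward_eq_expect F ℓ hV]
  ring

/-- The bridge between the extension and φ: the product relation replaces ψ(C₃)ψ(F) by joint
densities. The third vertex of the cycle becomes the new vertex `none`, and the rest of F is the
other petal. -/
theorem IsExtension.integral_cycleFlag_mul {φ : HomPlus emptyType} {P : Measure (HomPlus typeA)}
    (hP : IsExtension φ P) {b : ℕ} (F : FlagOfSize typeA (2 + b)) :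
    ∫ ψ, ψ.values ⟨3, cycleFlag⟩ * ψ.values ⟨2 + b, F⟩ ∂P -
        1 / 4 * ∫ ψ, ψ.values ⟨2 + b, F⟩ ∂P =
      2 * expect φ.values (fun T : Tournament (Option (Fin 2 ⊕ Fin b)) =>
        (ind (T.Beats (some (Sum.inl 1)) none) * ind (T.Beats none (some (Sum.inl 0))) - 1 / 4) *
          ind (Ind F Function.Embedding.inl (T.comap Function.Embedding.some))) := by
  have := hP.isProbabilityMeasure
  have hx := φ.isAveraging
  let ι : Fin 2 ↪ Fin 2 ⊕ (Fin 1 ⊕ Fin b) := Function.Embedding.inl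
  let κ : Fin 2 ↪ Fin (3 + b) := Fin.castLEEmb (by omega)
  let g : Tournament (Fin 2 ⊕ (Fin 1 ⊕ Fin b)) → ℝ := fun T =>
    ind (Ind cycleFlag Function.Embedding.inl (T.comap (petal₁ (Fin 2) (Fin 1) (Fin b))) ∧
      Ind F Function.Embedding.inl (T.comap (petal₂ (Fin 2) (Fin 1) (Fin b))))
  have hprod : ∫ ψ, ψ.values ⟨3, cycleFlag⟩ * ψ.values ⟨2 + b, F⟩ ∂P =
      2 * expect φ.values (fun T : Tournament (Fin 2 ⊕ (Fin 1 ⊕ Fin b)) =>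
        ind (IsType typeA ι T) * g T) := by
    rw [← sum_avgOn_mul_expect hx κ (Nat.card_fin (3 + b)) ι (by simp; omega) g, Finset.mul_sum]
    have h1 : ∀ ψ : HomPlus typeA, ψ.values ⟨3, cycleFlag⟩ * ψ.values ⟨2 + b, F⟩ =
        ∑ G : FlagOfSize typeA (3 + b), density₂ cycleFlag F G.rep * ψ.values ⟨3 + b, G⟩ :=
      fun ψ => ψ.values_mul cycleFlag F (by omega)
    simp only [h1]
    rw [integral_finsetSum _ fun G _ => (HomPlus.integrable_eval P G.toAlgebra).const_mul _]
    refine Finset.sum_congr rfl fun G _ => ?_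
    rw [integral_const_mul, hP.integral_eq G κ (Nat.card_fin _),
      density₂_eq_avgOn cycleFlag F G.rep (a := 1) rfl rfl (by simp)]
    ring
  have hF : ∫ ψ, ψ.values ⟨2 + b, F⟩ ∂P = 2 * expect φ.values
      (fun T : Tournament (Option (Fin 2 ⊕ Fin b)) =>
        ind (Ind F Function.Embedding.inl (T.comap Function.Embedding.some))) := by
    rw [hP.integral_eq F (Function.Embedding.inl : Fin 2 ↪ Fin 2 ⊕ Fin b) (by simp)]
    congr 1
    exact (expect_comap hx Function.Embedding.some
      fun T : Tournament (Fin 2 ⊕ Fin b) => ind (Ind F Function.Embedding.inl T)).symm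
  rw [hprod, hF, ← expect_comap hx (petalOption (Fin 2) (Fin b)), mul_left_comm, ← mul_sub,
    ← expect_const_mul, ← expect_sub]
  congr 1
  refine congrArg _ (funext fun T => ?_)
  have hpet : (T.comap (petalOption (Fin 2) (Fin b))).comap (petal₂ (Fin 2) (Fin 1) (Fin b)) =
      T.comap Function.Embedding.some := by
    rw [Tournament.comap_comap]
    congr 1
    ext a
    rcases a with a | a <;> rfl
  simp only [g, ι, ind_and, isType_typeA, ind_cycleFlag, hpet]
  change ind (T.Beats (some (Sum.inl 0)) (some (Sum.inl 1))) *
    (ind (T.Beats (some (Sum.inl 0)) (some (Sum.inl 1))) *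
      (ind (T.Beats (some (Sum.inl 1)) none) * ind (T.Beats none (some (Sum.inl 0)))) * _) - _ = _
  -- Inducing F already forces the labelled arc, so the indicators of that arc are redundant.
  by_cases h : Ind F Function.Embedding.inl (T.comap Function.Embedding.some)
  · have h01 : T.Beats (some (Sum.inl 0)) (some (Sum.inl 1)) := isType_typeA.mp h.isType
    rw [ind_true h, ind_true h01]
    ring
  · rw [ind_false h]
    ring

/-- The hypothesis makes ψ(C₃) - 1/4 orthogonal to all flags. Flags see the remaining vertices only
up to label preserving isomorphism, but exchangeability extends this to every function g of them. -/
theorem IsExtension.balanced {φ : HomPlus emptyType} {P : Measure (HomPlus typeA)}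
    (hP : IsExtension φ P) (h : ∀ᵐ ψ ∂P, ψ.toHom cycleFlag.toAlgebra = 1 / 4) :
    Balanced φ.values := by
  have hx := φ.isAveraging
  have hflag : ∀ (b : ℕ) (F : FlagOfSize typeA (2 + b)), expect φ.values
      (fun T : Tournament (Option (Fin 2 ⊕ Fin b)) =>
        (ind (T.Beats (some (Sum.inl 1)) none) * ind (T.Beats none (some (Sum.inl 0))) - 1 / 4) *
          ind (Ind F Function.Embedding.inl (T.comap Function.Embedding.some))) = 0 := by
    intro b F
    have h1 := hP.integral_cycleFlag_mul F
    have h2 : ∫ ψ, ψ.values ⟨3, cycleFlag⟩ * ψ.values ⟨2 + b, F⟩ ∂P =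
        ∫ ψ, 1 / 4 * ψ.values ⟨2 + b, F⟩ ∂P := by
      refine integral_congr_ae ?_
      filter_upwards [h] with ψ hψ
      exact congrArg (· * ψ.values ⟨2 + b, F⟩) hψ
    rw [h2, integral_const_mul, sub_self] at h1
    linarith
  have hstd : ∀ (b : ℕ) (g : Tournament (Fin 2 ⊕ Fin b) → ℝ), expect φ.values
      (fun T : Tournament (Option (Fin 2 ⊕ Fin b)) =>
        ind (T.Beats (some (Sum.inl 0)) (some (Sum.inl 1))) *
        (ind (T.Beats (some (Sum.inl 1)) none) * ind (T.Beats none (some (Sum.inl 0))) - 1 / 4) *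
          g (T.comap Function.Embedding.some)) = 0 := by
    intro b g
    let ι : Fin 2 ↪ Fin 2 ⊕ Fin b := Function.Embedding.inl
    let Φ : Tournament (Option (Fin 2 ⊕ Fin b)) → ℝ := fun T =>
      ind (T.Beats (some (Sum.inl 1)) none) * ind (T.Beats none (some (Sum.inl 0))) - 1 / 4
    let Ψ : Tournament (Option (Fin 2 ⊕ Fin b)) → ℝ := fun S =>
      ind (IsType typeA ι (S.comap Function.Embedding.some)) * Φ S *
        g (S.comap Function.Embedding.some)
    have hsum : ∑ F : FlagOfSize typeA (2 + b), F.rep.avgOn ι g * expect φ.values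
        (fun T : Tournament (Option (Fin 2 ⊕ Fin b)) =>
          Φ T * ind (Ind F ι (T.comap Function.Embedding.some))) = 0 :=
      Finset.sum_eq_zero fun F _ => by rw [hflag b F, mul_zero]
    simp only [← expect_const_mul] at hsum
    rw [← expect_sum] at hsum
    -- Weighting the flags by their averages of g yields g averaged over relabellings η of the
    -- unlabelled vertices. The factor Φ involves only the labels and `none`, hence is unaffected by
    -- η.
    have hT : ∀ T : Tournament (Option (Fin 2 ⊕ Fin b)), ∑ F : FlagOfSize typeA (2 + b),
        F.rep.avgOn ι g * (Φ T * ind (Ind F ι (T.comap Function.Embedding.some))) =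
        avg (fun η : Rel ι ι => Ψ (T.comap η.1.optionMap)) := by
      intro T
      simp only [mul_left_comm _ (Φ T), ← Finset.mul_sum]
      rw [sum_avgOn_mul_ind ι (by simp) ι g, ← avg_const_mul]
      refine congrArg avg (funext fun η => ?_)
      have hΦ : Φ (T.comap η.1.optionMap) = Φ T := by
        change ind (T.Beats (some (η.1 (ι 1))) none) * ind (T.Beats none (some (η.1 (ι 0)))) - 1 / 4
          = _
        rw [η.2, η.2]
        rfl
      have hc : (T.comap Function.Embedding.some).comap η.1 =
          (T.comap η.1.optionMap).comap Function.Embedding.some := rfl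
      simp only [Ψ, hΦ, hc]
      ring
    rw [funext hT, expect_avg] at hsum
    have hη : ∀ η : Rel ι ι, expect φ.values (fun T : Tournament (Option (Fin 2 ⊕ Fin b)) =>
        Ψ (T.comap η.1.optionMap)) = expect φ.values Ψ := fun η =>
      expect_comap hx η.1.optionMap Ψ
    simp only [hη] at hsum
    have hne := Rel.nonempty ι ι le_rfl
    rw [avg_const] at hsum
    rw [← hsum]
    refine congrArg _ (funext fun T => ?_)
    simp only [Ψ, isType_typeA]
    rfl
  intro V _ u v huv g
  let ℓ : Fin 2 ↪ V := ⟨![u, v], fun i j h => by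
    fin_cases i <;> fin_cases j <;> simp_all⟩
  -- Any V with a marked pair embeds into a standard vertex set; two vertices more than needed do no
  -- harm, as expectations restrict.
  obtain ⟨κ, hκ⟩ := Rel.nonempty ℓ (Function.Embedding.inl : Fin 2 ↪ Fin 2 ⊕ Fin (Nat.card V))
    (by simp)
  have hu : κ u = Sum.inl 0 := hκ 0
  have hv : κ v = Sum.inl 1 := hκ 1
  rw [← hstd (Nat.card V) fun S => g (S.comap κ), ← expect_comap hx κ.optionMap]
  refine congrArg _ (funext fun T => ?_)
  rw [← hu, ← hv]
  rfl

/-- The two moment conditions give E[(f - c)²] = c² - 2c² + c² = 0. -/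
theorem ae_eq_const_of_integral {Ω : Type*} [MeasurableSpace Ω] {P : Measure Ω}
    [IsProbabilityMeasure P] {f : Ω → ℝ} {c : ℝ} (hf : Integrable f P)
    (hf2 : Integrable (fun ω => f ω * f ω) P) (h2 : ∫ ω, f ω * f ω ∂P = c * ∫ ω, f ω ∂P)
    (h1 : ∫ ω, f ω ∂P = c) : ∀ᵐ ω ∂P, f ω = c := by
  have he : (fun ω => (f ω - c) ^ 2) = fun ω => f ω * f ω - (2 * c * f ω - c ^ 2) :=
    funext fun ω => by ring
  have hi : Integrable (fun ω => 2 * c * f ω - c ^ 2) P :=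
    (hf.const_mul _).sub (integrable_const _)
  have hsq : ∫ ω, (f ω - c) ^ 2 ∂P = 0 := by
    rw [he, integral_sub hf2 hi, integral_sub (hf.const_mul _) (integrable_const _),
      integral_const_mul, h2, h1]
    simp
    ring
  rw [integral_eq_zero_iff_of_nonneg (fun ω => sq_nonneg _) (by rw [he]; exact hf2.sub hi)] at hsq
  filter_upwards [hsq] with ω hω
  exact sub_eq_zero.mp (pow_eq_zero_iff two_ne_zero |>.mp hω)

theorem IsExtension.ae_eq_of_balanced {φ : HomPlus emptyType} {P : Measure (HomPlus typeA)}
    (hP : IsExtension φ P) (h : Balanced φ.values) :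
    ∀ᵐ ψ ∂P, ψ.toHom cycleFlag.toAlgebra = 1 / 4 := by
  have := hP.isProbabilityMeasure
  have hzero : ∀ (b : ℕ) (F : FlagOfSize typeA (2 + b)),
      ∫ ψ, ψ.values ⟨3, cycleFlag⟩ * ψ.values ⟨2 + b, F⟩ ∂P =
        1 / 4 * ∫ ψ, ψ.values ⟨2 + b, F⟩ ∂P := by
    intro b F
    rw [← sub_eq_zero, hP.integral_cycleFlag_mul F]
    have h1 := h (Fin 2 ⊕ Fin b) (Sum.inl 0) (Sum.inl 1) (by simp)
      fun S => ind (Ind F Function.Embedding.inl S)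
    refine mul_eq_zero_of_right _ (h1.symm ▸ congrArg _ (funext fun T => ?_))
    by_cases hT : Ind F Function.Embedding.inl (T.comap Function.Embedding.some)
    · have h01 : T.Beats (some (Sum.inl 0)) (some (Sum.inl 1)) := isType_typeA.mp hT.isType
      rw [ind_true h01, one_mul]
    · rw [ind_false hT]
      ring
  -- Taking F to be the cycle gives the second moment of ψ(C₃), and taking F to be the unit gives
  -- the first.
  have h1 := hzero 1 cycleFlag
  have h2 := hzero 0 (unitFlag typeA)
  have hunit : ∀ ψ : HomPlus typeA, ψ.values ⟨2 + 0, unitFlag typeA⟩ = 1 := fun ψ =>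
    ψ.values_unit
  simp only [hunit, mul_one, integral_const, probReal_univ, smul_eq_mul] at h2
  have hi : Integrable (fun ψ : HomPlus typeA => ψ.values ⟨3, cycleFlag⟩) P :=
    HomPlus.integrable_eval P cycleFlag.toAlgebra
  have hi2 : Integrable (fun ψ : HomPlus typeA =>
      ψ.values ⟨3, cycleFlag⟩ * ψ.values ⟨3, cycleFlag⟩) P := by
    have := HomPlus.integrable_eval P (cycleFlag.toAlgebra * cycleFlag.toAlgebra)
    simp only [map_mul] at this
    exact this
  exact ae_eq_const_of_integral hi hi2 h1 h2

/-- This recovers φ from its expectations, so equality of all expectations gives equality of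
homomorphisms. -/
theorem HomPlus.values_eq_expect (φ : HomPlus emptyType) (F : Flag emptyType) :
    φ.values F = expect φ.values (fun T : Tournament (Fin F.1) => ind (Ind F.2 (noLabels _) T)) := by
  rw [← sampleMean_eq φ.isAveraging (N := F.1) (by simp), show φ.values F = φ.values ⟨F.1, F.2⟩
    from rfl, φ.isAveraging F.1 F.1 F.2 le_rfl]
  refine Finset.sum_congr rfl fun G _ => ?_
  rw [density_eq_avgOn F.2 G.rep (noLabels _) (Nat.card_fin _) (by simp), mul_comm]

end

end TournamentFlags

end

/-! ### The characterization of the random limit -/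

theorem theorem3 :
    ∃ φrdm : TournamentFlags.HomPlus TournamentFlags.emptyType,
      TournamentFlags.IsRandomLimit φrdm ∧
      ∀ φ : TournamentFlags.HomPlus TournamentFlags.emptyType,
        ∃ P : MeasureTheory.Measure (TournamentFlags.HomPlus TournamentFlags.typeA),
          TournamentFlags.IsExtension φ P ∧
          (∀ Q : MeasureTheory.Measure (TournamentFlags.HomPlus TournamentFlags.typeA),
            TournamentFlags.IsExtension φ Q → Q = P) ∧
          ((∀ᵐ ψ ∂P, ψ.toHom TournamentFlags.cycleFlag.toAlgebra = 1 / 4) ↔ φ = φrdm) := by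
  obtain ⟨φrdm, hrdm⟩ := TournamentFlags.exists_isRandomLimit
  refine ⟨φrdm, hrdm, fun φ => ?_⟩
  obtain ⟨P, hP⟩ := TournamentFlags.exists_isExtension (σ := TournamentFlags.typeA) φ
    (by rw [φ.downward_unitFlag_typeA]; norm_num)
  refine ⟨P, hP, fun Q hQ => hQ.eq hP, fun h => ?_, ?_⟩
  · have hu := (hP.balanced h).uniform φ.isAveraging φ.values_unit φ.values_nonneg
    refine TournamentFlags.HomPlus.values_injective (funext fun F => ?_)
    rw [φ.values_eq_expect, φrdm.values_eq_expect]
    exact TournamentFlags.expect_eq_of_uniform φ.isAveraging φ.values_unit hu φrdm.isAveraging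
      φrdm.values_unit hrdm.uniform _
  · rintro rfl
    exact hP.ae_eq_of_balanced hrdm.uniform.balanced
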